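/- **Conventions.** An *s-manifold* $\mathbf X$ of dimension $n$ is a locally compact, Hausdorff, second countable space $X$ with an at most countable partition into nonempty locally closed *strata* $X^i$, $i\in I$, each with the structure of a smooth manifold of dimension $\dim X^i\le n$, such that (1) each $x\in X$ has an open neighbourhood $U$ with a map $U\to\mathbb R^N$ that is a topological embedding and a smooth embedding on each $U\cap X^i$; (2) each $x\in X$ has an open neighbourhood $V$ for which $I_V=\{i:V\cap X^i\neq\emptyset\}$ is finite and carries a partial order $\preceq$ such that the closure of $V\cap X^i$ in $V$ lies in $\bigcup_{j\succeq i}V\cap X^j$, and if $i\preceq j$, $i\ne j$ then either $\dim X^i\in\{n-1,n\}$ and $\dim X^j<\dim X^i$, or $\dim X^i,\dim X^j\le n-2$. (For $n<0$ an s-manifold of dimension $n$ is empty.) Write $\dim_x\mathbf X$ and $T_x\mathbf X$ for the dimension and tangent space at $x$ of the stratum containing $x$. An *s-manifold of mixed dimension* is a disjoint union of s-manifolds $\mathbf X_m$ of dimension $m$, $m\ge0$. A *smooth map* of s-manifolds (of mixed dimension) is a continuous map which sends each stratum into a single stratum, smoothly. Smooth maps $g:\mathbf X\to\mathbf Z$,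 $h:\mathbf Y\to\mathbf Z$ are *transverse* if, whenever $g(x)=h(y)=z$, $T_xg\oplus T_yh:T_x\mathbf X\oplus T_y\mathbf Y\to T_z\mathbf Z$ is surjective and, with $l,m,n$ the dimensions of $\mathbf X,\mathbf Y,\mathbf Z$ (near $x,y,z$), the triple $(l-\dim_x\mathbf X,\ m-\dim_y\mathbf Y,\ n-\dim_z\mathbf Z)$ is $(0,0,0)$, $(1,0,0)$, $(0,1,0)$ or $(1,1,1)$, or $\dim_x\mathbf X+\dim_y\mathbf Y-\dim_z\mathbf Z\le l+m-n-2$. Then $X\times_ZY$ is stratified by the nonempty fibre products of strata, with their smooth structures as transverse fibre products. An *s-manifold with corners* $\mathfrak X$ of dimension $n$ consists of an s-manifold $\mathbf X$ of dimension $n$, s-manifolds $C_k(\mathbf X)$ of dimension $n-k$ with smooth maps $\Pi_k:C_k(\mathbf X)\to\mathbf X$ for $0\le k\le n$, and subsets $D_{kl}(\mathbf X)\subseteq C_k(X)\times_XC_l(X)$ for $0\le k\le l\le n$. Write $C(\mathbf X)=\coprod_kC_k(\mathbf X)$, $\Pi_{\mathbf X}=\coprod_k\Pi_k$, $D(\mathbf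 X)=\coprod_{k\le l}D_{kl}(\mathbf X)$. It is required that $\Pi_k$ is proper, and restricts to homeomorphisms with locally closed subsets on the sets of an open cover of $C_k(X)$; $\Pi_0$ is a diffeomorphism; $\Pi_k$ maps each stratum onto a stratum by a proper local diffeomorphism; $D_{kl}(\mathbf X)$ is open and closed in $C_k(X)\times_XC_l(X)$ and a union of fibre products of strata; $D_{kl}(\mathbf X)\to C_l(X)$ is a proper local homeomorphism; and, with $u\trianglelefteq v\iff(u,v)\in D(\mathbf X)$, each fibre $C(X)_x$ of $\Pi_{\mathbf X}$ is a partially ordered set in which nonempty subsets have least upper and greatest lower bounds, and in which distinct elements of the same $C_k(X)$ are not comparable. Let $C(\mathbf X)^\circ$ be the set of those $u\in C_k(X)$, $k\ge0$, which are not $\trianglelefteq$ any element of $C_l(X)$ for any $l>k$. A *morphism* $\mathfrak f=(f,C(f)):\mathfrak X\to\mathfrak Y$ consists of smooth maps $f:\mathbf X\to\mathbf Y$, $C(f):C(\mathbf X)\to C(\mathbf Y)$ with $\Pi_{\mathbf Y}\circ C(f)=f\circ\Pi_{\mathbf X}$, $(C(f)\times C(f))(D(\mathbf X))\subseteq D(\mathbf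 Y)$, $C(f)(C(\mathbf X)^\circ)\subseteq C(\mathbf Y)^\circ$. It is *interior* if $C(f)(C_0(\mathbf X))\subseteq C_0(\mathbf Y)$, and *b-normal* if $C(f)$ preserves least upper and greatest lower bounds of nonempty subsets of fibres $C(X)_x$, maps $C_k(\mathbf X)$ into $\coprod_{k'\le k}C_{k'}(\mathbf Y)$, and $C(f)\times C(f)$ maps $D_{kl}(\mathbf X)$ into $\coprod_{k'\le k,\,0\le l'-k'\le l-k}D_{k'l'}(\mathbf Y)$. These objects with morphisms, or interior morphisms, form categories $\mathbf{SMan^c}$, $\mathbf{SMan^c_{in}}$; allowing disjoint unions over all dimensions gives $\mathbf{\check SMan^c}$, $\mathbf{\check SMan^c_{in}}$. B-normal $\mathfrak g:\mathfrak X\to\mathfrak Z$, $\mathfrak h:\mathfrak Y\to\mathfrak Z$ are *transverse* if $g,h$ are transverse and $C(g),C(h)$ are transverse. The *corners* $C(\mathfrak X)$ have underlying s-manifold of mixed dimension $C(\mathbf X)$, corners $C(C(\mathbf X))=D(\mathbf X)$ (where $D_{kl}(\mathbf X)$ has dimension $n-l$ and is $C_{l-k}(C_k(\mathbf X))$, with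 strata the fibre products over $\mathbf X$ of strata of $C(\mathbf X)$), projection $(u,v)\mapsto u$, and $(u,v)\trianglelefteq(u,w)$ iff $(v,w)\in D(\mathbf X)$; $C(\mathfrak f)=(C(f),C(f)\times C(f))$; $\partial\mathfrak X$ is the part $C_1(\mathfrak X)$, with the natural morphism to $\mathfrak X$ given by $\Pi_1$ and $(u,v)\mapsto v$. For $\mathfrak f:\mathfrak X\to\mathfrak Y$ b-normal, $\partial\mathfrak X=\partial^{\mathfrak f}_0\mathfrak X\amalg\partial^{\mathfrak f}_1\mathfrak X$, where $\partial^{\mathfrak f}_i\mathfrak X$ is the part which $C(f)$ maps to $C_i(\mathbf Y)$; $\partial_0\mathfrak f:\partial_0^{\mathfrak f}\mathfrak X\to\mathfrak Y$ is the composition of $\partial_0^{\mathfrak f}\mathfrak X\to\mathfrak X$ with $\mathfrak f$, and $\partial_1\mathfrak f:\partial_1^{\mathfrak f}\mathfrak X\to\partial\mathfrak Y$ is the restriction of $C(\mathfrak f)$. **Theorem.** Let $\mathfrak X,\mathfrak Y,\mathfrak Z$ be s-manifolds with corners of dimensions $l,m,n$, and $\mathfrak g:\mathfrak X\to\mathfrak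 Z$, $\mathfrak h:\mathfrak Y\to\mathfrak Z$ transverse b-normal morphisms. Let $\mathfrak W$ be given by the fibre products $\mathbf W=\mathbf X\times_{\mathbf Z}\mathbf Y$, $C(\mathbf W)=C(\mathbf X)\times_{C(\mathbf Z)}C(\mathbf Y)$ with the induced projection $\Pi_{\mathbf W}$, where $C_h(\mathbf W)$ is the part of dimension $l+m-n-h$, and $D(\mathbf W)=D(\mathbf X)\times_{D(\mathbf Z)}D(\mathbf Y)$. Let $\mathfrak e:\mathfrak W\to\mathfrak X$, $\mathfrak f:\mathfrak W\to\mathfrak Y$ be the projections. Then: (a) $\mathfrak W$ is an s-manifold with corners of dimension $d=l+m-n$, where $d\ge0$ if $\mathfrak W\ne\emptyset$, and $\mathfrak e,\mathfrak f$ are b-normal (hence interior) morphisms with $\mathfrak g\circ\mathfrak e=\mathfrak h\circ\mathfrak f$. This square is Cartesian in both $\mathbf{SMan^c}$ and $\mathbf{SMan^c_{in}}$. (b) $C(\mathfrak g),C(\mathfrak h)$ are transverse, and the square $C(\mathfrak g)\circ C(\mathfrak e)=C(\mathfrak h)\circ C(\mathfrak f)$ is Cartesian in both $\mathbf{\check SMan^c}$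 and $\mathbf{\check SMan^c_{in}}$. (c) $\partial\mathfrak W$, $\partial^{\mathfrak g}_i\mathfrak X$, $\partial^{\mathfrak h}_i\mathfrak Y$ ($i=0,1$) and $\partial\mathfrak Z$ are s-manifolds with corners of dimensions $d-1$, $l-1$, $m-1$ and $n-1$, the three pairs $(\partial_0\mathfrak g,\mathfrak h)$, $(\mathfrak g,\partial_0\mathfrak h)$, $(\partial_1\mathfrak g,\partial_1\mathfrak h)$ are b-normal and transverse, and there is a canonical isomorphism $$\partial\mathfrak W\cong(\partial^{\mathfrak g}_0\mathfrak X\times_{\partial_0\mathfrak g,\mathfrak Z,\mathfrak h}\mathfrak Y)\amalg(\mathfrak X\times_{\mathfrak g,\mathfrak Z,\partial_0\mathfrak h}\partial^{\mathfrak h}_0\mathfrak Y)\amalg(\partial^{\mathfrak g}_1\mathfrak X\times_{\partial_1\mathfrak g,\partial\mathfrak Z,\partial_1\mathfrak h}\partial^{\mathfrak h}_1\mathfrak Y),$$ compatible with the natural morphisms of both sides to $\mathfrak X$ and to $\mathfrak Y$. -/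

import Mathlib

open scoped ContDiff

universe u

namespace SCorners

/-! ## Stratified manifolds -/

/-- The model space `ℝ^p`. -/
abbrev E (p : ℕ) : Type := EuclideanSpace ℝ (Fin p)

/-- Raw data of a `p`-dimensional chart on (a subset of) `X`: a domain `source` and a coordinate map,
of which only the values on `source` matter. -/
structure Chart (X : Type u) (p : ℕ) where
  source : Set X
  map : X → E p

/-- The map `F` read in the chart `c`, that is `F ∘ c⁻¹` on the image `c.map '' c.source`
(and `0` elsewhere). It is used only for charts that are injective on their source. -/
noncomputable def Chart.rep {X : Type u} {p q : ℕ} (c : Chart X p) (F : X → E q) : E p → E q :=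
  Function.extend (fun x : c.source => c.map x) (fun x : c.source => F x) 0

/-- `c` is a homeomorphism from an open subset of one stratum, of dimension `p`, to an open subset of
`ℝ^p`. Here the strata are the classes of `r`, and `sd x` is the dimension of the stratum of `x`. -/
structure Chart.IsStratumChart {X : Type u} [TopologicalSpace X] (r : Setoid X) (sd : X → ℕ) {p : ℕ}
    (c : Chart X p) : Prop where
  sdim_eq : ∀ x ∈ c.source, sd x = p
  open_source : ∀ x ∈ c.source, ∃ O : Set X, IsOpen O ∧ c.source = O ∩ {y | r x y}
  isOpenEmbedding : Topology.IsOpenEmbedding (fun x : c.source => c.map x)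

/-- The raw data of a stratified manifold, possibly of mixed dimension: a topological space, a
partition into strata (the classes of `rel`), an atlas on each stratum (the charts whose source lies in
that stratum), the dimension `sdim x` of the stratum of `x`, and the dimension `dim x` assigned to the
part of the space in which `x` lies. The axioms are in `PreSMan.IsSMan`. -/
structure PreSMan : Type (u + 1) where
  carrier : Type u
  [top : TopologicalSpace carrier]
  rel : Setoid carrier
  charts : (p : ℕ) → Set (Chart carrier p)
  sdim : carrier → ℕ
  dim : carrier → ℤ

attribute [instance] PreSMan.top

instance : CoeSort PreSMan.{u} (Type u) := ⟨PreSMan.carrier⟩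

/-- The set of strata. They are nonempty and disjoint, and cover the space. -/
def PreSMan.strata (X : PreSMan.{u}) : Set (Set X) := X.rel.classes

/-- The strata which meet `V`. -/
def PreSMan.strataMeeting (X : PreSMan.{u}) (V : Set X) : Set (Set X) :=
  {S | S ∈ X.strata ∧ (S ∩ V).Nonempty}

/-- The axioms of an s-manifold. The dimension function `dim` is locally constant, and the parts
`{x | dim x = n}` are s-manifolds of dimension `n`; so this describes s-manifolds of mixed dimension, and
an s-manifold of dimension `n` is the case in which `dim` is constant with value `n`, see
`PreSMan.HasDim`. -/
structure PreSMan.IsSMan (X : PreSMan.{u}) : Prop where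
  locallyCompact : LocallyCompactSpace X
  hausdorff : T2Space X
  secondCountable : SecondCountableTopology X
  /-- strata are locally closed, and at most countable in number -/
  locallyClosed : ∀ S ∈ X.strata, IsLocallyClosed S
  countable : X.strata.Countable
  /-- the dimensions are attached to strata -/
  sdim_rel : ∀ x y, X.rel x y → X.sdim x = X.sdim y
  dim_rel : ∀ x y, X.rel x y → X.dim x = X.dim y
  dim_locallyConstant : IsLocallyConstant X.dim
  sdim_le : ∀ x, (X.sdim x : ℤ) ≤ X.dim x
  /-- the charts form a smooth atlas on each stratum -/
  isStratumChart : ∀ p, ∀ c ∈ X.charts p, c.IsStratumChart X.rel X.sdim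
  exists_chart : ∀ x, ∃ c ∈ X.charts (X.sdim x), x ∈ c.source
  compatible : ∀ p, ∀ a ∈ X.charts p, ∀ b ∈ X.charts p,
    ContDiffOn ℝ ∞ (a.rep b.map) (a.map '' (a.source ∩ b.source))
  /-- local embeddings in some `ℝ^N`: topological embeddings, and smooth embeddings on strata -/
  embeds : ∀ x : X, ∃ (U : Set X) (N : ℕ) (F : X → E N), IsOpen U ∧ x ∈ U ∧
    Topology.IsEmbedding (fun y : U => F y) ∧
    ∀ p, ∀ c ∈ X.charts p, ContDiffOn ℝ ∞ (c.rep F) (c.map '' (c.source ∩ U)) ∧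
      ∀ y ∈ c.source ∩ U, Function.Injective (fderiv ℝ (c.rep F) (c.map y))
  /-- local finiteness, and the partial order on the strata near a point -/
  localOrder : ∀ x : X, ∃ V : Set X, IsOpen V ∧ x ∈ V ∧ (∀ y ∈ V, X.dim y = X.dim x) ∧
    (X.strataMeeting V).Finite ∧ ∃ le : Set X → Set X → Prop,
      (∀ S ∈ X.strataMeeting V, le S S) ∧
      (∀ S ∈ X.strataMeeting V, ∀ T ∈ X.strataMeeting V, le S T → le T S → S = T) ∧
      (∀ S ∈ X.strataMeeting V, ∀ T ∈ X.strataMeeting V, ∀ R ∈ X.strataMeeting V,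
        le S T → le T R → le S R) ∧
      (∀ S ∈ X.strataMeeting V, closure (V ∩ S) ∩ V ⊆
        ⋃ T ∈ {T | T ∈ X.strataMeeting V ∧ le S T}, V ∩ T) ∧
      (∀ S ∈ X.strataMeeting V, ∀ T ∈ X.strataMeeting V, S ≠ T → le S T →
        ∀ s ∈ S, ∀ t ∈ T,
          (((X.sdim s : ℤ) = X.dim x - 1 ∨ (X.sdim s : ℤ) = X.dim x) ∧ X.sdim t < X.sdim s) ∨
          ((X.sdim s : ℤ) ≤ X.dim x - 2 ∧ (X.sdim t : ℤ) ≤ X.dim x - 2))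

/-- All of `X` has dimension `n`. -/
def PreSMan.HasDim (X : PreSMan.{u}) (n : ℤ) : Prop := ∀ x : X, X.dim x = n

/-- Smooth maps: continuous maps which send each stratum into a stratum, smoothly. -/
structure IsSmooth (X Y : PreSMan.{u}) (f : X → Y) : Prop where
  continuous : Continuous f
  map_rel : ∀ x x', X.rel x x' → Y.rel (f x) (f x')
  contDiffOn : ∀ p q, ∀ a ∈ X.charts p, ∀ b ∈ Y.charts q,
    ContDiffOn ℝ ∞ (a.rep (b.map ∘ f)) (a.map '' (a.source ∩ f ⁻¹' b.source))

/-- The tangent map of `f` at `x`, between tangent spaces of strata, in a chart `a` at `x` and a chart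
`b` at `f x`. -/
noncomputable def tangentMap {X Y : Type u} (f : X → Y) {p q : ℕ} (a : Chart X p) (b : Chart Y q)
    (x : X) : E p →L[ℝ] E q :=
  fderiv ℝ (a.rep (b.map ∘ f)) (a.map x)

/-- Transversality of `g : X → Z` and `h : Y → Z` for s-manifolds, possibly of mixed dimension. -/
def IsTransverseSMan (X Y Z : PreSMan.{u}) (g : X → Z) (h : Y → Z) : Prop :=
  ∀ (x : X) (y : Y), g x = h y →
    (∀ p q r, ∀ a ∈ X.charts p, ∀ b ∈ Y.charts q, ∀ c ∈ Z.charts r,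
      x ∈ a.source → y ∈ b.source → g x ∈ c.source →
      ∀ t : E r, ∃ (v : E p) (w : E q), tangentMap g a c x v + tangentMap h b c y w = t) ∧
    (((X.sdim x : ℤ) = X.dim x ∧ (Y.sdim y : ℤ) = Y.dim y ∧ (Z.sdim (g x) : ℤ) = Z.dim (g x)) ∨
     ((X.sdim x : ℤ) = X.dim x - 1 ∧ (Y.sdim y : ℤ) = Y.dim y ∧
        (Z.sdim (g x) : ℤ) = Z.dim (g x)) ∨
     ((X.sdim x : ℤ) = X.dim x ∧ (Y.sdim y : ℤ) = Y.dim y - 1 ∧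
        (Z.sdim (g x) : ℤ) = Z.dim (g x)) ∨
     ((X.sdim x : ℤ) = X.dim x - 1 ∧ (Y.sdim y : ℤ) = Y.dim y - 1 ∧
        (Z.sdim (g x) : ℤ) = Z.dim (g x) - 1) ∨
     ((X.sdim x : ℤ) + Y.sdim y - Z.sdim (g x) ≤ X.dim x + Y.dim y - Z.dim (g x) - 2))

/-! ### Constructions of s-manifolds -/

/-- The charts of a space `W`, with given strata, for which the map `(π₁, π₂)` to `A × B` is a smooth
immersion on each stratum: for a transverse fibre product of manifolds `W ⊆ A × B` these are the charts
of its smooth structure, that of an embedded submanifold of the product. -/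
def submanifoldCharts {W : Type u} [TopologicalSpace W] (r : Setoid W) (sd : W → ℕ)
    (A B : PreSMan.{u}) (π₁ : W → A) (π₂ : W → B) (p : ℕ) : Set (Chart W p) :=
  {c | c.IsStratumChart r sd ∧
    (∀ q, ∀ a ∈ A.charts q,
      ContDiffOn ℝ ∞ (c.rep (a.map ∘ π₁)) (c.map '' (c.source ∩ π₁ ⁻¹' a.source))) ∧
    (∀ q, ∀ b ∈ B.charts q,
      ContDiffOn ℝ ∞ (c.rep (b.map ∘ π₂)) (c.map '' (c.source ∩ π₂ ⁻¹' b.source))) ∧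
    ∀ q, ∀ a ∈ A.charts q, ∀ q', ∀ b ∈ B.charts q',
      ∀ w ∈ c.source, π₁ w ∈ a.source → π₂ w ∈ b.source →
        ∀ v : E p, tangentMap π₁ c a w v = 0 → tangentMap π₂ c b w v = 0 → v = 0}

/-- The relation on `W` for which `w, w'` are related if their images in `A` and in `B` are. -/
def pairRel {W : Type u} (A B : PreSMan.{u}) (π₁ : W → A) (π₂ : W → B) : Setoid W :=
  Setoid.comap π₁ A.rel ⊓ Setoid.comap π₂ B.rel

/-- The fibre product `X ×_Z Y`, a subspace of `X × Y`; its strata are the nonempty fibre products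
of strata. -/
def PreSMan.pullback (X Y Z : PreSMan.{u}) (g : X → Z) (h : Y → Z) : PreSMan.{u} where
  carrier := {w : X × Y // g w.1 = h w.2}
  rel := pairRel X Y (fun w => w.1.1) (fun w => w.1.2)
  charts := submanifoldCharts (pairRel X Y (fun w => w.1.1) (fun w => w.1.2))
    (fun w => X.sdim w.1.1 + Y.sdim w.1.2 - Z.sdim (g w.1.1)) X Y (fun w => w.1.1) (fun w => w.1.2)
  sdim w := X.sdim w.1.1 + Y.sdim w.1.2 - Z.sdim (g w.1.1)
  dim w := X.dim w.1.1 + Y.dim w.1.2 - Z.dim (g w.1.1)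

/-- The restriction of `X` to a subset `U` (used for open `U`). -/
def PreSMan.restrict (X : PreSMan.{u}) (U : Set X) : PreSMan.{u} where
  carrier := U
  rel := Setoid.comap Subtype.val X.rel
  charts p := {c | ∃ a ∈ X.charts p, c = ⟨Subtype.val ⁻¹' a.source, fun x => a.map x⟩}
  sdim x := X.sdim x
  dim x := X.dim x

/-- The disjoint union of `X` and `Y`. -/
def PreSMan.sum (X Y : PreSMan.{u}) : PreSMan.{u} where
  carrier := X ⊕ Y
  rel :=
    { r := Sum.LiftRel X.rel Y.rel
      iseqv :=
        { refl := by rintro (x | y) <;> constructor <;> exact Setoid.refl' _ _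
          symm := by rintro _ _ (h | h) <;> constructor <;> exact Setoid.symm' _ h
          trans := by
            rintro _ _ _ (h | h) (k | k) <;> constructor <;> exact Setoid.trans' _ h k } }
  charts p :=
    {c | ∃ a ∈ X.charts p, c = ⟨Sum.inl '' a.source, Sum.elim a.map (fun _ => 0)⟩} ∪
    {c | ∃ b ∈ Y.charts p, c = ⟨Sum.inr '' b.source, Sum.elim (fun _ => 0) b.map⟩}
  sdim := Sum.elim X.sdim Y.sdim
  dim := Sum.elim X.dim Y.dim

/-! ## S-manifolds with corners -/

/-- The raw data of an s-manifold with corners, possibly of mixed dimension: the s-manifold `X`, the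
disjoint union `C` of all the `C_k(X)`, the projection `C → X`, and the subset `D` of the fibre product
`C ×_X C` (the union of all the `D_{kl}(X)`). The part `C_k(X)` of `C` is recovered from the dimensions,
see `PreSManC.codim`. The axioms are in `PreSManC.IsSManC`. -/
structure PreSManC : Type (u + 1) where
  X : PreSMan.{u}
  C : PreSMan.{u}
  proj : C → X
  D : Set (C × C)
  D_proj : ∀ p ∈ D, proj p.1 = proj p.2

/-- `u` lies in `C_k(X)` exactly if `codim u = k`: where `X` has dimension `n`, `C_k(X)` is the part of
`C` of dimension `n - k`. -/
def PreSManC.codim (M : PreSManC.{u}) (u : M.C) : ℤ := M.X.dim (M.proj u) - M.C.dim u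

/-- `u` is a least upper bound of the set `S` for the relation `D`. -/
def PreSManC.IsLub (M : PreSManC.{u}) (S : Set M.C) (u : M.C) : Prop :=
  (∀ s ∈ S, (s, u) ∈ M.D) ∧ ∀ v, (∀ s ∈ S, (s, v) ∈ M.D) → (u, v) ∈ M.D

/-- `u` is a greatest lower bound of the set `S` for the relation `D`. -/
def PreSManC.IsGlb (M : PreSManC.{u}) (S : Set M.C) (u : M.C) : Prop :=
  (∀ s ∈ S, (u, s) ∈ M.D) ∧ ∀ v, (∀ s ∈ S, (v, s) ∈ M.D) → (v, u) ∈ M.D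

/-- The axioms of an s-manifold with corners (of mixed dimension; for dimension `n`, combine with
`PreSManC.HasDim`). -/
structure PreSManC.IsSManC (M : PreSManC.{u}) : Prop where
  isSMan : M.X.IsSMan
  corners_isSMan : M.C.IsSMan
  /-- `C` is the union of the `C_k(X)` with `0 ≤ k` (`k ≤ n` is automatic, as strata have dimension at
  least `0`) -/
  codim_nonneg : ∀ u, 0 ≤ M.codim u
  /-- the projection is a proper smooth map, and locally a closed embedding -/
  proj_smooth : IsSmooth M.C M.X M.proj
  proj_proper : IsProperMap M.proj
  proj_locallyClosedEmbedding : ∀ u : M.C, ∃ V : Set M.C, IsOpen V ∧ u ∈ V ∧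
    Topology.IsEmbedding (fun v : V => M.proj v) ∧ IsLocallyClosed (M.proj '' V)
  /-- `C_0(X) → X` is an isomorphism, with inverse `s` -/
  zero_iso : ∃ s : M.X → M.C, IsSmooth M.X M.C s ∧ (∀ x, M.codim (s x) = 0 ∧ M.proj (s x) = x) ∧
    ∀ u, M.codim u = 0 → s (M.proj u) = u
  /-- each stratum of `C` is projected onto a stratum of `X`, by a proper local diffeomorphism -/
  proj_covering : ∀ S ∈ M.C.strata, M.proj '' S ∈ M.X.strata ∧
    IsProperMap (fun u : S => (⟨M.proj u, Set.mem_image_of_mem M.proj u.2⟩ : M.proj '' S)) ∧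
    ∀ u ∈ S, ∀ p q, ∀ a ∈ M.C.charts p, ∀ b ∈ M.X.charts q, u ∈ a.source → M.proj u ∈ b.source →
      Function.Bijective (tangentMap M.proj a b u)
  /-- `D` is the union of the `D_{kl}(X)` with `k ≤ l` -/
  D_codim : ∀ p ∈ M.D, M.codim p.1 ≤ M.codim p.2
  /-- `D` is open and closed in `C ×_X C`, and a union of fibre products of strata -/
  D_clopen : IsClopen {p : {p : M.C × M.C // M.proj p.1 = M.proj p.2} | p.1 ∈ M.D}
  D_strata : ∀ u v u' v', (u, v) ∈ M.D → M.C.rel u u' → M.C.rel v v' → M.proj u' = M.proj v' →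
    (u', v') ∈ M.D
  /-- the second projection `D → C` is a proper local homeomorphism -/
  D_proper : IsProperMap (fun p : M.D => p.1.2)
  D_localHomeomorph : IsLocalHomeomorph (fun p : M.D => p.1.2)
  /-- `D` is a partial order on each fibre of `C → X`, trivial on each fibre of `C_k(X) → X`, and nonempty
  subsets of fibres have least upper bounds and greatest lower bounds -/
  D_refl : ∀ u, (u, u) ∈ M.D
  D_antisymm : ∀ u v, (u, v) ∈ M.D → (v, u) ∈ M.D → u = v
  D_trans : ∀ u v w, (u, v) ∈ M.D → (v, w) ∈ M.D → (u, w) ∈ M.D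
  D_level : ∀ u v, (u, v) ∈ M.D → M.codim u = M.codim v → u = v
  exists_lub : ∀ (x : M.X) (S : Set M.C), S.Nonempty → S ⊆ M.proj ⁻¹' {x} → ∃ u, M.IsLub S u
  exists_glb : ∀ (x : M.X) (S : Set M.C), S.Nonempty → S ⊆ M.proj ⁻¹' {x} → ∃ u, M.IsGlb S u

/-- `M` has dimension `n`. Together with `IsSManC` this is an s-manifold with corners of dimension `n`;
for `n < 0` it is empty. -/
def PreSManC.HasDim (M : PreSManC.{u}) (n : ℤ) : Prop := M.X.HasDim n

/-- The interior `C(X)°`, the union over `k` of the complement in `C_k(X)` of the projections of the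
`D_{kl}(X)` with `l > k`. -/
def PreSManC.interior (M : PreSManC.{u}) : Set M.C :=
  {u | ¬ ∃ v, (u, v) ∈ M.D ∧ M.codim u < M.codim v}

/-- A pair of maps `X → Y` and `C(X) → C(Y)`, compatible with projections and mapping `D(X)` to
`D(Y)`. -/
@[ext]
structure SCMap (M N : PreSManC.{u}) : Type u where
  base : M.X → N.X
  corner : M.C → N.C
  comm : ∀ u, N.proj (corner u) = base (M.proj u)
  map_D : ∀ p ∈ M.D, (corner p.1, corner p.2) ∈ N.D

/-- Composition of pairs of maps. -/
def SCMap.comp {M N P : PreSManC.{u}} (g : SCMap N P) (f : SCMap M N) : SCMap M P where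
  base := g.base ∘ f.base
  corner := g.corner ∘ f.corner
  comm u := by simp only [Function.comp_apply, g.comm, f.comm]
  map_D p hp := g.map_D _ (f.map_D p hp)

/-- The identity pair. -/
def SCMap.id (M : PreSManC.{u}) : SCMap M M where
  base := fun x => x
  corner := fun u => u
  comm _ := rfl
  map_D _ hp := hp

/-- Morphisms (smooth maps) of s-manifolds with corners. -/
structure SCMap.IsMorphism {M N : PreSManC.{u}} (f : SCMap M N) : Prop where
  base_smooth : IsSmooth M.X N.X f.base
  corner_smooth : IsSmooth M.C N.C f.corner
  map_interior : ∀ u ∈ M.interior, f.corner u ∈ N.interior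

/-- Interior morphisms. -/
structure SCMap.IsInterior {M N : PreSManC.{u}} (f : SCMap M N) : Prop extends f.IsMorphism where
  map_zero : ∀ u, M.codim u = 0 → N.codim (f.corner u) = 0

/-- b-normal morphisms. -/
structure SCMap.IsBNormal {M N : PreSManC.{u}} (f : SCMap M N) : Prop extends f.IsMorphism where
  map_lub : ∀ (x : M.X) (S : Set M.C), S.Nonempty → S ⊆ M.proj ⁻¹' {x} → ∀ u, M.IsLub S u →
    N.IsLub (f.corner '' S) (f.corner u)
  map_glb : ∀ (x : M.X) (S : Set M.C), S.Nonempty → S ⊆ M.proj ⁻¹' {x} → ∀ u, M.IsGlb S u →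
    N.IsGlb (f.corner '' S) (f.corner u)
  codim_le : ∀ u, N.codim (f.corner u) ≤ M.codim u
  codim_D : ∀ p ∈ M.D, N.codim (f.corner p.1) ≤ M.codim p.1 ∧
    0 ≤ N.codim (f.corner p.2) - N.codim (f.corner p.1) ∧
    N.codim (f.corner p.2) - N.codim (f.corner p.1) ≤ M.codim p.2 - M.codim p.1

/-- Transverse b-normal morphisms of s-manifolds with corners. -/
structure IsTransverse {M N P : PreSManC.{u}} (g : SCMap M P) (h : SCMap N P) : Prop where
  left_bNormal : g.IsBNormal
  right_bNormal : h.IsBNormal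
  base : IsTransverseSMan M.X N.X P.X g.base h.base
  corner : IsTransverseSMan M.C N.C P.C g.corner h.corner

/-- The square `g ∘ e = h ∘ f` is Cartesian in the category whose objects are those satisfying `Obj` and
whose morphisms are those satisfying `Mor`. -/
structure IsCartesian (Obj : PreSManC.{u} → Prop) (Mor : ∀ {M N : PreSManC.{u}}, SCMap M N → Prop)
    {W M N P : PreSManC.{u}} (e : SCMap W M) (f : SCMap W N) (g : SCMap M P) (h : SCMap N P) : Prop where
  obj : Obj W ∧ Obj M ∧ Obj N ∧ Obj P
  mor : Mor e ∧ Mor f ∧ Mor g ∧ Mor h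
  comm : g.comp e = h.comp f
  lift : ∀ (T : PreSManC.{u}) (e' : SCMap T M) (f' : SCMap T N), Obj T → Mor e' → Mor f' →
    g.comp e' = h.comp f' → ∃! b : SCMap T W, Mor b ∧ e.comp b = e' ∧ f.comp b = f'

/-- Cartesian squares of s-manifolds with corners, each of some constant dimension. -/
def IsCartesianSManC {W M N P : PreSManC.{u}} (e : SCMap W M) (f : SCMap W N) (g : SCMap M P)
    (h : SCMap N P) : Prop :=
  IsCartesian (fun T => T.IsSManC ∧ ∃ n : ℤ, T.HasDim n) SCMap.IsMorphism e f g h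

/-- The same with interior morphisms. -/
def IsCartesianSManCIn {W M N P : PreSManC.{u}} (e : SCMap W M) (f : SCMap W N) (g : SCMap M P)
    (h : SCMap N P) : Prop :=
  IsCartesian (fun T => T.IsSManC ∧ ∃ n : ℤ, T.HasDim n) SCMap.IsInterior e f g h

/-- Cartesian squares of s-manifolds with corners of mixed dimension. -/
def IsCartesianMixed {W M N P : PreSManC.{u}} (e : SCMap W M) (f : SCMap W N) (g : SCMap M P)
    (h : SCMap N P) : Prop :=
  IsCartesian PreSManC.IsSManC SCMap.IsMorphism e f g h

/-- The same with interior morphisms. -/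
def IsCartesianMixedIn {W M N P : PreSManC.{u}} (e : SCMap W M) (f : SCMap W N) (g : SCMap M P)
    (h : SCMap N P) : Prop :=
  IsCartesian PreSManC.IsSManC SCMap.IsInterior e f g h

/-- `Φ` is an isomorphism (diffeomorphism) of s-manifolds with corners, which also respects the
dimensions of `X` and of `C` (hence the decompositions into the `C_k`). -/
def SCMap.IsIso {M N : PreSManC.{u}} (Φ : SCMap M N) : Prop :=
  Φ.IsMorphism ∧ (∀ x, N.X.dim (Φ.base x) = M.X.dim x) ∧ (∀ u, N.C.dim (Φ.corner u) = M.C.dim u) ∧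
    ∃ Ψ : SCMap N M, Ψ.IsMorphism ∧ Ψ.comp Φ = SCMap.id M ∧ Φ.comp Ψ = SCMap.id N

/-! ### The fibre product -/

/-- The fibre product `W = X ×_Z Y` of s-manifolds with corners, with `C(W) = C(X) ×_{C(Z)} C(Y)` and
`D(W) = D(X) ×_{D(Z)} D(Y)`. -/
def pullback {M N P : PreSManC.{u}} (g : SCMap M P) (h : SCMap N P) : PreSManC.{u} where
  X := PreSMan.pullback M.X N.X P.X g.base h.base
  C := PreSMan.pullback M.C N.C P.C g.corner h.corner
  proj := fun w => ⟨(M.proj w.1.1, N.proj w.1.2), by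
    have hw := congrArg P.proj w.2
    rwa [g.comm, h.comm] at hw⟩
  D := {p | (p.1.1.1, p.2.1.1) ∈ M.D ∧ (p.1.1.2, p.2.1.2) ∈ N.D}
  D_proj p hp := Subtype.ext (Prod.ext (M.D_proj _ hp.1) (N.D_proj _ hp.2))

/-- The projection `e : W → X`. -/
def pullbackFst {M N P : PreSManC.{u}} (g : SCMap M P) (h : SCMap N P) : SCMap (pullback g h) M where
  base := fun w => w.1.1
  corner := fun w => w.1.1
  comm _ := rfl
  map_D _ hp := hp.1

/-- The projection `f : W → Y`. -/
def pullbackSnd {M N P : PreSManC.{u}} (g : SCMap M P) (h : SCMap N P) : SCMap (pullback g h) N where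
  base := fun w => w.1.2
  corner := fun w => w.1.2
  comm _ := rfl
  map_D _ hp := hp.2

/-! ### Corners and boundaries -/

/-- `D(X)` as an s-manifold: the strata are the fibre products over `X` of pairs of strata of `C(X)`,
and `D_{kl}(X)` has the dimension of `C_l(X)`. -/
def PreSManC.DSMan (M : PreSManC.{u}) : PreSMan.{u} where
  carrier := M.D
  rel := pairRel M.C M.C (fun p => p.1.1) (fun p => p.1.2)
  charts := submanifoldCharts (pairRel M.C M.C (fun p => p.1.1) (fun p => p.1.2))
    (fun p => M.C.sdim p.1.1 + M.C.sdim p.1.2 - M.X.sdim (M.proj p.1.1)) M.C M.C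
    (fun p => p.1.1) (fun p => p.1.2)
  sdim p := M.C.sdim p.1.1 + M.C.sdim p.1.2 - M.X.sdim (M.proj p.1.1)
  dim p := M.C.dim p.1.2

/-- The corners `C(X)`, as an s-manifold with corners of mixed dimension, with `C(C(X)) = D(X)`. -/
def corners (M : PreSManC.{u}) : PreSManC.{u} where
  X := M.C
  C := M.DSMan
  proj := fun p => p.1.1
  D := {P | P.1.1.1 = P.2.1.1 ∧ (P.1.1.2, P.2.1.2) ∈ M.D}
  D_proj _ hP := hP.1

/-- The natural morphism `C(X) → X`. -/
def cornersProj (M : PreSManC.{u}) : SCMap (corners M) M where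
  base := M.proj
  corner := fun p => p.1.2
  comm p := (M.D_proj _ p.2).symm
  map_D _ hP := hP.2

/-- The corner functor on morphisms, `C(f) : C(X) → C(Y)`. -/
def cornersMap {M N : PreSManC.{u}} (f : SCMap M N) : SCMap (corners M) (corners N) where
  base := f.corner
  corner := fun p => ⟨(f.corner p.1.1, f.corner p.1.2), f.map_D _ p.2⟩
  comm _ := rfl
  map_D _ hP := ⟨congrArg f.corner hP.1, f.map_D _ hP.2⟩

/-- The restriction of an s-manifold with corners to a subset `U` of `X` (used for open and closed
`U`). -/
def PreSManC.restrict (M : PreSManC.{u}) (U : Set M.X) : PreSManC.{u} where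
  X := M.X.restrict U
  C := M.C.restrict (M.proj ⁻¹' U)
  proj := fun u => ⟨M.proj u.1, u.2⟩
  D := {p | (p.1.1, p.2.1) ∈ M.D}
  D_proj _ hp := Subtype.ext (M.D_proj _ hp)

/-- The inclusion of a restriction. -/
def restrictIncl (M : PreSManC.{u}) (U : Set M.X) : SCMap (M.restrict U) M where
  base := Subtype.val
  corner := Subtype.val
  comm _ := rfl
  map_D _ hp := hp

/-- Restriction of a map on both sides. -/
def SCMap.restrict {M N : PreSManC.{u}} (f : SCMap M N) (U : Set M.X) (V : Set N.X)
    (hUV : ∀ x ∈ U, f.base x ∈ V) : SCMap (M.restrict U) (N.restrict V) where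
  base := fun x => ⟨f.base x.1, hUV _ x.2⟩
  corner := fun u => ⟨f.corner u.1, by
    change N.proj (f.corner u.1) ∈ V
    rw [f.comm]
    exact hUV _ u.2⟩
  comm u := Subtype.ext (f.comm u.1)
  map_D _ hp := f.map_D _ hp

/-- The boundary `∂X = C_1(X)`. -/
def boundary (M : PreSManC.{u}) : PreSManC.{u} := (corners M).restrict {u | M.codim u = 1}

/-- The natural morphism `∂X → X`. -/
def boundaryIncl (M : PreSManC.{u}) : SCMap (boundary M) M :=
  (cornersProj M).comp (restrictIncl (corners M) _)

/-- The part `∂_0^f X` of `∂X` which `C(f)` maps to `C_0(Y)`. -/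
def boundary₀ {M N : PreSManC.{u}} (f : SCMap M N) : PreSManC.{u} :=
  (corners M).restrict {u | M.codim u = 1 ∧ N.codim (f.corner u) = 0}

/-- The part `∂_1^f X` of `∂X` which `C(f)` maps to `C_1(Y)`. -/
def boundary₁ {M N : PreSManC.{u}} (f : SCMap M N) : PreSManC.{u} :=
  (corners M).restrict {u | M.codim u = 1 ∧ N.codim (f.corner u) = 1}

/-- The natural morphism `∂_0^f X → X`. -/
def boundary₀Incl {M N : PreSManC.{u}} (f : SCMap M N) : SCMap (boundary₀ f) M :=
  (cornersProj M).comp (restrictIncl (corners M) _)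

/-- The natural morphism `∂_1^f X → X`. -/
def boundary₁Incl {M N : PreSManC.{u}} (f : SCMap M N) : SCMap (boundary₁ f) M :=
  (cornersProj M).comp (restrictIncl (corners M) _)

/-- The morphism `∂_0 f : ∂_0^f X → Y`, the restriction of `f ∘ Π_X`. -/
def boundary₀Map {M N : PreSManC.{u}} (f : SCMap M N) : SCMap (boundary₀ f) N :=
  f.comp (boundary₀Incl f)

/-- The morphism `∂_1 f : ∂_1^f X → ∂Y`, the restriction of `C(f)`. -/
def boundary₁Map {M N : PreSManC.{u}} (f : SCMap M N) : SCMap (boundary₁ f) (boundary N) :=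
  (cornersMap f).restrict _ _ (fun _ hu => hu.2)

/-! ### Disjoint unions -/

/-- The disjoint union of two s-manifolds with corners. -/
def PreSManC.sum (M N : PreSManC.{u}) : PreSManC.{u} where
  X := M.X.sum N.X
  C := M.C.sum N.C
  proj := Sum.map M.proj N.proj
  D := {p | (∃ q ∈ M.D, p = (Sum.inl q.1, Sum.inl q.2)) ∨ ∃ q ∈ N.D, p = (Sum.inr q.1, Sum.inr q.2)}
  D_proj := by
    rintro _ (⟨q, hq, rfl⟩ | ⟨q, hq, rfl⟩)
    · exact congrArg Sum.inl (M.D_proj q hq)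
    · exact congrArg Sum.inr (N.D_proj q hq)

/-- The map out of a disjoint union with given restrictions. -/
def SCMap.sumElim {M N P : PreSManC.{u}} (f : SCMap M P) (g : SCMap N P) : SCMap (M.sum N) P where
  base := Sum.elim f.base g.base
  corner := Sum.elim f.corner g.corner
  comm := by
    rintro (u | u)
    · exact f.comm u
    · exact g.comm u
  map_D := by
    rintro _ (⟨q, hq, rfl⟩ | ⟨q, hq, rfl⟩)
    · exact f.map_D q hq
    · exact g.map_D q hq

end SCorners

/-!
A transverse fibre product is treated in three layers: strata, spaces with their local orders on
strata, and corners.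

*Strata.* The s-manifolds `W`, `C(W)` and `D(X)` are all closed parts of a product, given by an equation
`g x = h y` and saturated for the strata (`IsFibre`), so that one construction serves for all of them.
At a transverse point the equation, read in charts, is a submersion. Completing it by linear
coordinates to a local diffeomorphism gives a chart of the fibre product
(`IsFibre.exists_submanifoldChart`). The inverse of that diffeomorphism parametrizes `W` by smooth
maps, so smoothness of a map into `W` may be tested on its two components (`smoothAt_lift`); this
gives the universal property, and smoothness of every structure map. Local embeddings in `ℝᴺ` are
products of those of the factors (`IsFibre.embeds`).

*Local orders.* The strata of `W` carry the product order. Strata of codimensions `a`, `b` over one of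
codimension `c` give codimension `a + b - c`, and the codimension triples which transversality allows
are what makes the dimension condition on comparable strata survive (`hasLocalOrder_pullback`).
For `D(X)` transversality is automatic: `Π` maps each stratum of `C(X)` by a local diffeomorphism, so
the tangent map of `D(X) → C(X)`, `(u, v) ↦ v`, is bijective, and that map is étale. The order on the
strata of `D(X)` is pulled back along it (`hasLocalOrder_D`).

*Corners.* The axioms for `W` (`isSManC_pullback`) are checked componentwise. Since `C(g)` and `C(h)`
preserve least upper and greatest lower bounds, bounds in the fibres of `C(W)` are pairs of bounds. In
particular the least elements, which form `C_0`, and the greatest ones, which form `C(W)°`, are pairs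
(`mem_interior_pullback_iff`). That `D(W) → C(W)` is a local homeomorphism uses in addition that
`D(Z) → C(Z)` is locally injective. The corners of an s-manifold with corners are again one
(`isSManC_corners`). Transversality is a condition on dimensions and tangent spaces only, so it passes
along étale maps (`IsTransverseSMan.of_etale`). As `D(X) → C(X)` is étale, the maps
which `C(g)` and `C(h)` induce on `D` inherit transversality from `C(g)` and `C(h)` themselves
(`isTransverse_cornersMap`), and the square of corners is the fibre product square of that pair up to
rearranging components.

*Boundaries.* `X = C_0(X)`, `∂X`, `∂₀X` and `∂₁X` are open unions of strata of `C(X)`, with the corners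
of `C(X)` over them (`IsCornerPart`), and `g`, `∂₀g`, `∂₁g` are restrictions of `C(g)`. Hence the three
pairs are transverse (`isTransverse_of_isCornerPart`), and their fibre products are open unions of
strata of `C(W)` (`isOpenPart_cornersLift`). They exhaust `∂W` and are disjoint because
`codim (u, v) = codim u + codim v - codim (g u)` is `1` only for the triples `(1, 0, 0)`, `(0, 1, 0)` and
`(1, 1, 1)` (`exists_isIso_boundary_pullback`).
-/

/-! ### Functions read in a chart -/

namespace SCorners

open Filter Topology Set

section ChartCalculus

/-- `F` is smooth at `x` along the stratum charted by `c`. -/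
def Chart.SmoothAt {X : Type u} {p q : ℕ} (c : Chart X p) (F : X → E q) (x : X) : Prop :=
  ContDiffAt ℝ ∞ (c.rep F) (c.map x)

theorem Chart.SmoothAt.differentiableAt {X : Type u} {p q : ℕ} {c : Chart X p} {F : X → E q} {x : X}
    (hF : c.SmoothAt F x) : DifferentiableAt ℝ (c.rep F) (c.map x) :=
  ContDiffAt.differentiableAt hF (by simp)

variable {X Y : Type u} [TopologicalSpace X] [TopologicalSpace Y] {p q r : ℕ}

/-- The coordinate map of `c` is a homeomorphism from the source onto an open subset of `ℝ^p`. -/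
abbrev Chart.IsEmb (c : Chart X p) : Prop :=
  IsOpenEmbedding (fun x : c.source => c.map x)

theorem Chart.rep_map {c : Chart X p} (hc : c.IsEmb) (F : X → E q) {x : X} (hx : x ∈ c.source) :
    c.rep F (c.map x) = F x :=
  hc.injective.extend_apply (fun x : c.source => F x) 0 ⟨x, hx⟩

theorem Chart.map_nhdsWithin {c : Chart X p} (hc : c.IsEmb) {x : X} (hx : x ∈ c.source) :
    Filter.map c.map (𝓝[c.source] x) = 𝓝 (c.map x) := by
  have h := hc.map_nhds_eq ⟨x, hx⟩
  rw [← h, ← map_nhds_subtype_val ⟨x, hx⟩, Filter.map_map]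
  rfl

theorem Chart.eventually_nhds {c : Chart X p} (hc : c.IsEmb) {x : X} (hx : x ∈ c.source)
    {P : E p → Prop} : (∀ᶠ e in 𝓝 (c.map x), P e) ↔ ∀ᶠ y in 𝓝[c.source] x, P (c.map y) := by
  rw [← Chart.map_nhdsWithin hc hx, Filter.eventually_map]

theorem Chart.injOn {c : Chart X p} (hc : c.IsEmb) : InjOn c.map c.source :=
  injOn_iff_injective.2 hc.injective

theorem Chart.tendsto_map {c : Chart X p} (hc : c.IsEmb) {x : X} (hx : x ∈ c.source) :
    Tendsto c.map (𝓝[c.source] x) (𝓝 (c.map x)) :=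
  (Chart.map_nhdsWithin hc hx).le

theorem Chart.image_mem_nhds {c : Chart X p} (hc : c.IsEmb) {S : Set X} {x : X}
    (hx : x ∈ c.source) (hS : S ∈ 𝓝[c.source] x) : c.map '' (c.source ∩ S) ∈ 𝓝 (c.map x) := by
  have : ∀ᶠ e in 𝓝 (c.map x), e ∈ c.map '' (c.source ∩ S) := by
    rw [Chart.eventually_nhds hc hx]
    filter_upwards [hS, self_mem_nhdsWithin] with y h1 h2
    exact mem_image_of_mem _ ⟨h2, h1⟩
  exact this

/-- Smoothness of a chart representative on a relatively open set is a pointwise condition. -/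
theorem Chart.contDiffOn_iff {c : Chart X p} (hc : c.IsEmb) {F : X → E q} {S : Set X}
    (hS : ∀ x ∈ c.source, x ∈ S → S ∈ 𝓝[c.source] x) :
    ContDiffOn ℝ ∞ (c.rep F) (c.map '' (c.source ∩ S)) ↔
      ∀ x ∈ c.source, x ∈ S → c.SmoothAt F x := by
  constructor
  · intro h x hx hxS
    exact h.contDiffAt (Chart.image_mem_nhds hc hx (hS x hx hxS))
  · rintro h _ ⟨x, ⟨hx, hxS⟩, rfl⟩
    exact (h x hx hxS : ContDiffAt ℝ ∞ _ _).contDiffWithinAt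

theorem Chart.rep_comp {a : Chart X p} {b : Chart Y q} (ha : a.IsEmb) (hb : b.IsEmb) {f : X → Y}
    (G : Y → E r) {x : X} (hx : x ∈ a.source) (hf : ∀ᶠ x' in 𝓝[a.source] x, f x' ∈ b.source) :
    a.rep (G ∘ f) =ᶠ[𝓝 (a.map x)] b.rep G ∘ a.rep (b.map ∘ f) := by
  rw [EventuallyEq, Chart.eventually_nhds ha hx]
  filter_upwards [hf, self_mem_nhdsWithin] with y hy hys
  simp only [Function.comp_apply]
  rw [Chart.rep_map ha _ hys, Chart.rep_map ha _ hys, Function.comp_apply, Function.comp_apply,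
    Chart.rep_map hb _ hy]

theorem Chart.SmoothAt.comp {a : Chart X p} {b : Chart Y q} (ha : a.IsEmb) (hb : b.IsEmb)
    {f : X → Y} {G : Y → E r} {x : X} (hx : x ∈ a.source)
    (hf : ∀ᶠ x' in 𝓝[a.source] x, f x' ∈ b.source)
    (hG : b.SmoothAt G (f x)) (hfs : a.SmoothAt (b.map ∘ f) x) : a.SmoothAt (G ∘ f) x := by
  refine ContDiffAt.congr_of_eventuallyEq ?_ (Chart.rep_comp ha hb G hx hf)
  refine ContDiffAt.comp _ ?_ hfs
  rw [Chart.rep_map ha _ hx]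
  exact hG

theorem Chart.fderiv_rep_comp {a : Chart X p} {b : Chart Y q} (ha : a.IsEmb) (hb : b.IsEmb)
    {f : X → Y} {G : Y → E r} {x : X} (hx : x ∈ a.source)
    (hf : ∀ᶠ x' in 𝓝[a.source] x, f x' ∈ b.source)
    (hG : b.SmoothAt G (f x)) (hfs : a.SmoothAt (b.map ∘ f) x) :
    fderiv ℝ (a.rep (G ∘ f)) (a.map x) =
      (fderiv ℝ (b.rep G) (b.map (f x))).comp (tangentMap f a b x) := by
  rw [(Chart.rep_comp ha hb G hx hf).fderiv_eq]
  have h1 : a.rep (b.map ∘ f) (a.map x) = b.map (f x) := Chart.rep_map ha _ hx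
  rw [fderiv_comp (a.map x) (by rw [h1]; exact hG.differentiableAt) hfs.differentiableAt, h1]
  rfl

theorem Chart.rep_self {c : Chart X p} (hc : c.IsEmb) {x : X} (hx : x ∈ c.source) :
    c.rep c.map =ᶠ[𝓝 (c.map x)] id := by
  rw [EventuallyEq, Chart.eventually_nhds hc hx]
  filter_upwards [self_mem_nhdsWithin] with y hys
  rw [Chart.rep_map hc _ hys]
  rfl

theorem tangentMap_self {c : Chart X p} (hc : c.IsEmb) {x : X} (hx : x ∈ c.source) :
    tangentMap id c c x = ContinuousLinearMap.id ℝ _ := by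
  unfold tangentMap
  rw [Function.comp_id, (Chart.rep_self hc hx).fderiv_eq, fderiv_id]

/-- The chart `a'` corresponds to the chart `a` under the map `j`. -/
structure Chart.Corr {X' X : Type u} (j : X' → X) (a' : Chart X' p) (a : Chart X p) : Prop where
  mem_iff : ∀ x', x' ∈ a'.source ↔ j x' ∈ a.source
  map_eq : ∀ x' ∈ a'.source, a'.map x' = a.map (j x')

theorem Chart.Corr.rep_eventuallyEq {j : X → Y} {a' : Chart X p} {a : Chart Y p}
    (hj : Chart.Corr j a' a) (ha' : a'.IsEmb) (ha : a.IsEmb) (F : Y → E q) {x : X}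
    (hx : x ∈ a'.source) : a'.rep (F ∘ j) =ᶠ[𝓝 (a'.map x)] a.rep F := by
  rw [EventuallyEq, Chart.eventually_nhds ha' hx]
  filter_upwards [self_mem_nhdsWithin] with y hy
  rw [Chart.rep_map ha' _ hy, hj.map_eq y hy, Chart.rep_map ha _ ((hj.mem_iff y).1 hy)]
  rfl

theorem Chart.Corr.smoothAt_iff {j : X → Y} {a' : Chart X p} {a : Chart Y p}
    (hj : Chart.Corr j a' a) (ha' : a'.IsEmb) (ha : a.IsEmb) (F : Y → E q) {x : X}
    (hx : x ∈ a'.source) : a'.SmoothAt (F ∘ j) x ↔ a.SmoothAt F (j x) := by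
  unfold Chart.SmoothAt
  rw [← hj.map_eq x hx]
  have h := hj.rep_eventuallyEq ha' ha F hx
  exact ⟨fun k => k.congr_of_eventuallyEq h.symm, fun k => k.congr_of_eventuallyEq h⟩

theorem Chart.Corr.tangentMap_eq {Z : Type u} {j : X → Y} {a' : Chart X p} {a : Chart Y p}
    (hj : Chart.Corr j a' a) (ha' : a'.IsEmb) (ha : a.IsEmb) (f : Y → Z) (b : Chart Z q) {x : X}
    (hx : x ∈ a'.source) : tangentMap (f ∘ j) a' b x = tangentMap f a b (j x) := by
  unfold tangentMap
  rw [← Function.comp_assoc, (hj.rep_eventuallyEq ha' ha (b.map ∘ f) hx).fderiv_eq,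
    hj.map_eq x hx]

end ChartCalculus

/-! ### Immersions and submersions -/

section Calculus

variable {V U F : Type*} [NormedAddCommGroup V] [NormedSpace ℝ V] [FiniteDimensional ℝ V]
  [NormedAddCommGroup U] [NormedSpace ℝ U] [FiniteDimensional ℝ U]
  [NormedAddCommGroup F] [NormedSpace ℝ F] [FiniteDimensional ℝ F]

/-- A continuous map `τ` is smooth if its composition with an immersion `G` is: `G` has a smooth
local left inverse, because a linear left inverse of its derivative, composed with `G`, is a local
diffeomorphism. -/
theorem contDiffAt_of_comp_immersion {K : Type*} [NormedAddCommGroup K] [NormedSpace ℝ K]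
    {G : V → U} {τ : K → V} {H : K → U} {k : K}
    (hG : ContDiffAt ℝ ∞ G (τ k)) (hinj : Function.Injective (fderiv ℝ G (τ k)))
    (hτ : ContinuousAt τ k) (hH : ContDiffAt ℝ ∞ H k) (hcomp : ∀ᶠ x in 𝓝 k, G (τ x) = H x) :
    ContDiffAt ℝ ∞ τ k := by
  obtain ⟨L, hL⟩ := LinearMap.exists_leftInverse_of_injective
    ((fderiv ℝ G (τ k) : V →L[ℝ] U) : V →ₗ[ℝ] U) (LinearMap.ker_eq_bot.2 hinj)
  let L' : U →L[ℝ] V := LinearMap.toContinuousLinearMap L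
  have hP : ContDiffAt ℝ ∞ (L' ∘ G) (τ k) := L'.contDiff.contDiffAt.comp _ hG
  have hd : HasFDerivAt (L' ∘ G) ((ContinuousLinearEquiv.refl ℝ V : V ≃L[ℝ] V) : V →L[ℝ] V)
      (τ k) := by
    have h1 := L'.hasFDerivAt.comp (τ k) (hG.differentiableAt (by simp)).hasFDerivAt
    convert! h1 using 1
    ext v
    exact (LinearMap.congr_fun hL v).symm
  have hn : (∞ : WithTop ℕ∞) ≠ 0 := by simp
  have hinv := hP.to_localInverse hd hn
  have hev : τ =ᶠ[𝓝 k] (hP.localInverse hd hn) ∘ (L' ∘ H) := by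
    have hsrc : ∀ᶠ v in 𝓝 (τ k), (hP.localInverse hd hn) ((L' ∘ G) v) = v :=
      (hP.toOpenPartialHomeomorph _ hd hn).eventually_left_inverse
        (hP.mem_toOpenPartialHomeomorph_source hd hn)
    filter_upwards [hτ.eventually hsrc, hcomp] with x hx hc
    simp only [Function.comp_apply] at hx ⊢
    rw [← hc, hx]
  refine ContDiffAt.congr_of_eventuallyEq ?_ hev
  refine ContDiffAt.comp k ?_ (L'.contDiff.contDiffAt.comp _ hH)
  have : (L' ∘ H) k = (L' ∘ G) (τ k) := by simp [hcomp.self_of_nhds]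
  rw [this]
  exact hinv

/-- A submersion `Φ` can be completed by linear coordinates to a local diffeomorphism. -/
theorem exists_openPartialHomeomorph_of_submersion {Φ : V → U} {v₀ : V} {O : Set V}
    (hO : IsOpen O) (hv₀ : v₀ ∈ O) (hΦ : ∀ v ∈ O, ContDiffAt ℝ ∞ Φ v)
    (hsurj : Function.Surjective (fderiv ℝ Φ v₀))
    (hdim : Module.finrank ℝ V = Module.finrank ℝ U + Module.finrank ℝ F) :
    ∃ (L : V →L[ℝ] F) (H : OpenPartialHomeomorph V (U × F)), v₀ ∈ H.source ∧ H.source ⊆ O ∧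
      (∀ v, H v = (Φ v, L v)) ∧ ∀ y ∈ H.target, ContDiffAt ℝ ∞ H.symm y := by
  let A : V →ₗ[ℝ] U := (fderiv ℝ Φ v₀ : V →L[ℝ] U)
  have hrank : Module.finrank ℝ (LinearMap.ker A) = Module.finrank ℝ F := by
    have h1 := LinearMap.finrank_range_add_finrank_ker A
    rw [LinearMap.range_eq_top.2 hsurj, finrank_top] at h1
    omega
  -- `L` is a projection to the kernel of the derivative, so that `(Φ, L)` has invertible derivative
  let e := LinearEquiv.ofFinrankEq _ _ hrank
  obtain ⟨P, hP⟩ := (LinearMap.ker A).exists_isCompl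
  let L₀ : V →ₗ[ℝ] F := e.toLinearMap ∘ₗ (Submodule.projectionOnto _ _ hP)
  let L : V →L[ℝ] F := LinearMap.toContinuousLinearMap L₀
  let T : V →ₗ[ℝ] U × F := A.prod L₀
  have hTinj : Function.Injective T := by
    rw [← LinearMap.ker_eq_bot, LinearMap.ker_eq_bot']
    intro v hv
    have h1 : A v = 0 := congrArg Prod.fst hv
    have h2 : L₀ v = 0 := congrArg Prod.snd hv
    have h3 : (Submodule.projectionOnto _ _ hP) v = 0 := by
      simpa [L₀] using h2
    have h4 := Submodule.projectionOnto_apply_left hP ⟨v, h1⟩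
    rw [h3] at h4
    exact (congrArg Subtype.val h4).symm
  have hfin : Module.finrank ℝ V = Module.finrank ℝ (U × F) := by
    rw [Module.finrank_prod, hdim]
  let T' : V ≃L[ℝ] U × F :=
    (LinearEquiv.ofInjectiveOfFinrankEq T hTinj hfin).toContinuousLinearEquiv
  let Ψ : V → U × F := fun v => (Φ v, L v)
  have hΨ : ∀ v ∈ O, ContDiffAt ℝ ∞ Ψ v := fun v hv => (hΦ v hv).prodMk L.contDiff.contDiffAt
  have hΨd : ∀ v ∈ O, HasFDerivAt Ψ ((fderiv ℝ Φ v).prod L) v := fun v hv =>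
    ((hΦ v hv).differentiableAt (by simp)).hasFDerivAt.prodMk L.hasFDerivAt
  have hT' : (T' : V →L[ℝ] U × F) = (fderiv ℝ Φ v₀).prod L := by
    ext v <;> rfl
  have hn : (∞ : WithTop ℕ∞) ≠ 0 := by simp
  have hd0 : HasFDerivAt Ψ (T' : V →L[ℝ] U × F) v₀ := by rw [hT']; exact hΨd v₀ hv₀
  let H₀ := (hΨ v₀ hv₀).toOpenPartialHomeomorph Ψ hd0 hn
  -- the domain is shrunk so that the derivative stays invertible, and the inverse is smooth everywhere
  have hcont : ContinuousAt (fun v => (fderiv ℝ Φ v).prod L) v₀ := by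
    have : ContinuousAt (fderiv ℝ Φ) v₀ :=
      ((hΦ v₀ hv₀).fderiv_right (m := 0) (by simp)).continuousAt
    exact (ContinuousLinearMap.prodₗᵢ (E := V) (F := U) (G := F) (𝕜 := ℝ)
      ℝ).continuous.continuousAt.comp (this.prodMk continuousAt_const)
  have hev : ∀ᶠ v in 𝓝 v₀, (fderiv ℝ Φ v).prod L ∈
      range ((↑) : (V ≃L[ℝ] U × F) → V →L[ℝ] U × F) := by
    apply hcont.eventually
    have h := ContinuousLinearEquiv.nhds T'
    rw [hT'] at h
    exact h
  obtain ⟨O', hO'sub, hO', hv₀'⟩ := eventually_nhds_iff.1 hev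
  refine ⟨L, H₀.restrOpen (O ∩ O') (hO.inter hO'), ?_, ?_, ?_, ?_⟩
  · rw [OpenPartialHomeomorph.restrOpen_source]
    exact ⟨(hΨ v₀ hv₀).mem_toOpenPartialHomeomorph_source hd0 hn, hv₀, hv₀'⟩
  · rw [OpenPartialHomeomorph.restrOpen_source]
    exact fun v hv => hv.2.1
  · intro v; rfl
  · intro y hy
    set H := H₀.restrOpen (O ∩ O') (hO.inter hO')
    have hs : H.symm y ∈ H.source := H.map_target hy
    have hs' : H.symm y ∈ H₀.source ∩ (O ∩ O') := by
      rw [← OpenPartialHomeomorph.restrOpen_source]; exact hs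
    obtain ⟨B, hB⟩ := hO'sub _ hs'.2.2
    have h1 : HasFDerivAt H (B : V →L[ℝ] U × F) (H.symm y) := by
      rw [hB]; exact hΨd _ hs'.2.1
    exact H.contDiffAt_symm hy h1 (hΨ _ hs'.2.1)

end Calculus

/-! ### Smooth maps between stratified manifolds -/

section StratumChart

variable {X Y : Type u} [TopologicalSpace X] [TopologicalSpace Y] {p q : ℕ}
  {rX : Setoid X} {sX : X → ℕ} {rY : Setoid Y} {sY : Y → ℕ}

theorem Chart.IsStratumChart.rel {c : Chart X p} (hc : c.IsStratumChart rX sX) {x y : X}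
    (hx : x ∈ c.source) (hy : y ∈ c.source) : rX x y := by
  obtain ⟨O, -, h⟩ := hc.open_source x hx
  have : y ∈ O ∩ {y | rX x y} := h ▸ hy
  exact this.2

/-- A continuous map which preserves strata maps a neighbourhood of `x` in its stratum to the source of
any given chart at `f x`. -/
theorem Chart.IsStratumChart.eventually_mem {a : Chart X p} (ha : a.IsStratumChart rX sX)
    {b : Chart Y q} (hb : b.IsStratumChart rY sY) {f : X → Y} (hf : Continuous f)
    (hr : ∀ x x', rX x x' → rY (f x) (f x')) {x : X} (hx : x ∈ a.source) (hfx : f x ∈ b.source) :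
    ∀ᶠ x' in 𝓝[a.source] x, f x' ∈ b.source := by
  obtain ⟨O, hO, h⟩ := hb.open_source _ hfx
  have hfO : f x ∈ O := (h ▸ hfx : f x ∈ O ∩ _).1
  filter_upwards [self_mem_nhdsWithin,
    mem_nhdsWithin_of_mem_nhds (hf.continuousAt.preimage_mem_nhds (hO.mem_nhds hfO))] with x' h1 h2
  rw [h]
  exact ⟨h2, hr _ _ (ha.rel hx h1)⟩

theorem Chart.IsStratumChart.contDiffOn_iff {a : Chart X p} (ha : a.IsStratumChart rX sX)
    {b : Chart Y q} (hb : b.IsStratumChart rY sY) {f : X → Y} (hf : Continuous f)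
    (hr : ∀ x x', rX x x' → rY (f x) (f x')) :
    ContDiffOn ℝ ∞ (a.rep (b.map ∘ f)) (a.map '' (a.source ∩ f ⁻¹' b.source)) ↔
      ∀ x ∈ a.source, f x ∈ b.source → a.SmoothAt (b.map ∘ f) x :=
  Chart.contDiffOn_iff ha.isOpenEmbedding
    (fun _ hx hfx => ha.eventually_mem hb hf hr hx hfx)

theorem Chart.IsStratumChart.continuousAt_rep {a : Chart X p} (ha : a.IsStratumChart rX sX)
    {b : Chart Y q} (hb : b.IsStratumChart rY sY) {f : X → Y} (hf : Continuous f)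
    (hr : ∀ x x', rX x x' → rY (f x) (f x')) {x : X} (hx : x ∈ a.source) (hfx : f x ∈ b.source) :
    ContinuousAt (a.rep (b.map ∘ f)) (a.map x) := by
  have hA := ha.isOpenEmbedding
  rw [ContinuousAt, ← Chart.map_nhdsWithin hA hx, tendsto_map'_iff, Chart.rep_map hA _ hx]
  have h1 : Tendsto f (𝓝[a.source] x) (𝓝[b.source] (f x)) :=
    tendsto_nhdsWithin_iff.2 ⟨hf.continuousAt.tendsto.mono_left nhdsWithin_le_nhds,
      ha.eventually_mem hb hf hr hx hfx⟩
  refine ((Chart.tendsto_map hb.isOpenEmbedding hfx).comp h1).congr' ?_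
  filter_upwards [self_mem_nhdsWithin] with y hy
  rw [Function.comp_apply, Function.comp_apply, Chart.rep_map hA _ hy]
  rfl

end StratumChart

section SMan

variable {X Y Z : PreSMan.{u}} {p q r : ℕ}

theorem PreSMan.IsSMan.emb (hX : X.IsSMan) {a : Chart X p} (ha : a ∈ X.charts p) : a.IsEmb :=
  (hX.isStratumChart p a ha).isOpenEmbedding

theorem IsSmooth.eventually_mem (hX : X.IsSMan) (hY : Y.IsSMan) {f : X → Y} (hf : IsSmooth X Y f)
    {a : Chart X p} (ha : a ∈ X.charts p) {b : Chart Y q} (hb : b ∈ Y.charts q) {x : X}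
    (hx : x ∈ a.source) (hfx : f x ∈ b.source) : ∀ᶠ x' in 𝓝[a.source] x, f x' ∈ b.source :=
  (hX.isStratumChart p a ha).eventually_mem (hY.isStratumChart q b hb) hf.continuous hf.map_rel
    hx hfx

theorem IsSmooth.smoothAt (hX : X.IsSMan) (hY : Y.IsSMan) {f : X → Y} (hf : IsSmooth X Y f)
    {a : Chart X p} (ha : a ∈ X.charts p) {b : Chart Y q} (hb : b ∈ Y.charts q) {x : X}
    (hx : x ∈ a.source) (hfx : f x ∈ b.source) : a.SmoothAt (b.map ∘ f) x :=
  ((hX.isStratumChart p a ha).contDiffOn_iff (hY.isStratumChart q b hb) hf.continuous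
    hf.map_rel).1 (hf.contDiffOn p q a ha b hb) x hx hfx

theorem IsSmooth.of_smoothAt (hX : ∀ p, ∀ c ∈ X.charts p, c.IsStratumChart X.rel X.sdim)
    (hY : ∀ p, ∀ c ∈ Y.charts p, c.IsStratumChart Y.rel Y.sdim) {f : X → Y}
    (hf : Continuous f) (hr : ∀ x x', X.rel x x' → Y.rel (f x) (f x'))
    (hs : ∀ p q, ∀ a ∈ X.charts p, ∀ b ∈ Y.charts q, ∀ x ∈ a.source, f x ∈ b.source →
      a.SmoothAt (b.map ∘ f) x) : IsSmooth X Y f :=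
  ⟨hf, hr, fun p q a ha b hb =>
    ((hX p a ha).contDiffOn_iff (hY q b hb) hf hr).2 (hs p q a ha b hb)⟩

theorem PreSMan.IsSMan.smoothAt_map (hX : X.IsSMan) {a : Chart X p} (ha : a ∈ X.charts p)
    {b : Chart X q} (hb : b ∈ X.charts q) {x : X} (hx : x ∈ a.source) (hx' : x ∈ b.source) :
    a.SmoothAt b.map x := by
  obtain rfl : p = q := by
    rw [← (hX.isStratumChart p a ha).sdim_eq x hx, (hX.isStratumChart q b hb).sdim_eq x hx']
  exact ((hX.isStratumChart p a ha).contDiffOn_iff (hX.isStratumChart p b hb) continuous_id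
    (fun _ _ h => h)).1 (hX.compatible p a ha b hb) x hx hx'

theorem IsSmooth.id (hX : X.IsSMan) : IsSmooth X X (fun x => x) :=
  .of_smoothAt hX.isStratumChart hX.isStratumChart continuous_id (fun _ _ h => h)
    fun _ _ _ ha _ hb _ hx hx' => hX.smoothAt_map ha hb hx hx'

theorem IsSmooth.comp (hX : X.IsSMan) (hY : Y.IsSMan) (hZ : Z.IsSMan) {g : Y → Z} {f : X → Y}
    (hg : IsSmooth Y Z g) (hf : IsSmooth X Y f) : IsSmooth X Z (g ∘ f) := by
  refine .of_smoothAt hX.isStratumChart hZ.isStratumChart (hg.continuous.comp hf.continuous)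
    (fun x x' h => hg.map_rel _ _ (hf.map_rel _ _ h)) fun p q a ha c hc x hx hgx => ?_
  obtain ⟨b, hb, hbx⟩ := hY.exists_chart (f x)
  exact Chart.SmoothAt.comp (G := c.map ∘ g) (hX.emb ha) (hY.emb hb) hx
    (hf.eventually_mem hX hY ha hb hx hbx) (hg.smoothAt hY hZ hb hc hbx hgx)
    (hf.smoothAt hX hY ha hb hx hbx)

theorem tangentMap_comp (hX : X.IsSMan) (hY : Y.IsSMan) (hZ : Z.IsSMan) {g : Y → Z} {f : X → Y}
    (hg : IsSmooth Y Z g) (hf : IsSmooth X Y f) {a : Chart X p} (ha : a ∈ X.charts p)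
    {b : Chart Y q} (hb : b ∈ Y.charts q) {c : Chart Z r} (hc : c ∈ Z.charts r) {x : X}
    (hx : x ∈ a.source) (hfx : f x ∈ b.source) (hgx : g (f x) ∈ c.source) :
    tangentMap (g ∘ f) a c x = (tangentMap g b c (f x)).comp (tangentMap f a b x) :=
  Chart.fderiv_rep_comp (G := c.map ∘ g) (hX.emb ha) (hY.emb hb) hx
    (hf.eventually_mem hX hY ha hb hx hfx) (hg.smoothAt hY hZ hb hc hfx hgx)
    (hf.smoothAt hX hY ha hb hx hfx)

theorem tangentMap_comp_apply (hX : X.IsSMan) (hY : Y.IsSMan) (hZ : Z.IsSMan) {g : Y → Z}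
    {f : X → Y} (hg : IsSmooth Y Z g) (hf : IsSmooth X Y f) {a : Chart X p} (ha : a ∈ X.charts p)
    {b : Chart Y q} (hb : b ∈ Y.charts q) {c : Chart Z r} (hc : c ∈ Z.charts r) {x : X}
    (hx : x ∈ a.source) (hfx : f x ∈ b.source) (hgx : g (f x) ∈ c.source) (v : E p) :
    tangentMap (fun x => g (f x)) a c x v = tangentMap g b c (f x) (tangentMap f a b x v) :=
  DFunLike.congr_fun (tangentMap_comp hX hY hZ hg hf ha hb hc hx hfx hgx) v

theorem tangentMap_id_bijective (hX : X.IsSMan) {a : Chart X p} (ha : a ∈ X.charts p)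
    {b : Chart X q} (hb : b ∈ X.charts q) {x : X} (hx : x ∈ a.source) (hx' : x ∈ b.source) :
    Function.Bijective (tangentMap (fun x => x) a b x) := by
  have h1 := fun v => (tangentMap_comp_apply hX hX hX (.id hX) (.id hX) ha hb ha hx hx' hx v).symm
  have h2 := fun v => (tangentMap_comp_apply hX hX hX (.id hX) (.id hX) hb ha hb hx' hx hx' v).symm
  have k1 : tangentMap (fun x => x) a a x = ContinuousLinearMap.id ℝ _ :=
    tangentMap_self (hX.emb ha) hx
  have k2 : tangentMap (fun x => x) b b x = ContinuousLinearMap.id ℝ _ :=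
    tangentMap_self (hX.emb hb) hx'
  simp only [k1, k2] at h1 h2
  exact Function.bijective_iff_has_inverse.2 ⟨_, h1, h2⟩

/-- A smooth map which preserves both dimensions of each point and restricts to local
diffeomorphisms of strata. -/
structure IsEtale (X Y : PreSMan.{u}) (f : X → Y) : Prop extends IsSmooth X Y f where
  sdim_eq : ∀ x, Y.sdim (f x) = X.sdim x
  dim_eq : ∀ x, Y.dim (f x) = X.dim x
  bijective : ∀ x, ∀ p q, ∀ a ∈ X.charts p, ∀ b ∈ Y.charts q, x ∈ a.source → f x ∈ b.source →
    Function.Bijective (tangentMap f a b x)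

theorem IsEtale.id (hX : X.IsSMan) : IsEtale X X (fun x => x) :=
  { IsSmooth.id hX with
    sdim_eq := fun _ => rfl
    dim_eq := fun _ => rfl
    bijective := fun _ _ _ _ ha _ hb hx hx' => tangentMap_id_bijective hX ha hb hx hx' }

theorem IsEtale.comp (hX : X.IsSMan) (hY : Y.IsSMan) (hZ : Z.IsSMan) {g : Y → Z} {f : X → Y}
    (hg : IsEtale Y Z g) (hf : IsEtale X Y f) : IsEtale X Z (g ∘ f) :=
  { hg.toIsSmooth.comp hX hY hZ hf.toIsSmooth with
    sdim_eq := fun x => (hg.sdim_eq _).trans (hf.sdim_eq x)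
    dim_eq := fun x => (hg.dim_eq _).trans (hf.dim_eq x)
    bijective := by
      intro x p q a ha c hc hx hx'
      obtain ⟨b, hb, hbx⟩ := hY.exists_chart (f x)
      rw [tangentMap_comp hX hY hZ hg.toIsSmooth hf.toIsSmooth ha hb hc hx hbx hx']
      exact (hg.bijective _ _ _ b hb c hc hbx hx').comp (hf.bijective _ _ _ a ha b hb hx hbx) }

/-- The tangent maps of `g : X → Z` at `x` and of `h : Y → Z` at `y` jointly span the tangent space of
`Z` at `g x`. -/
def TangentTransverse (X Y Z : PreSMan.{u}) (g : X → Z) (h : Y → Z) (x : X) (y : Y) : Prop :=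
  ∀ p q r, ∀ a ∈ X.charts p, ∀ b ∈ Y.charts q, ∀ c ∈ Z.charts r,
    x ∈ a.source → y ∈ b.source → g x ∈ c.source →
      ∀ t : E r, ∃ (v : E p) (w : E q), tangentMap g a c x v + tangentMap h b c y w = t

theorem TangentTransverse.sdim_le (hX : X.IsSMan) (hY : Y.IsSMan) (hZ : Z.IsSMan) {g : X → Z}
    {h : Y → Z} {x : X} {y : Y} (ht : TangentTransverse X Y Z g h x y) :
    Z.sdim (g x) ≤ X.sdim x + Y.sdim y := by
  obtain ⟨a, ha, hax⟩ := hX.exists_chart x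
  obtain ⟨b, hb, hby⟩ := hY.exists_chart y
  obtain ⟨c, hc, hcz⟩ := hZ.exists_chart (g x)
  have hs : Function.Surjective
      ((tangentMap g a c x).coprod (tangentMap h b c y)) := by
    intro t
    obtain ⟨v, w, hvw⟩ := ht _ _ _ a ha b hb c hc hax hby hcz t
    exact ⟨(v, w), by simpa using hvw⟩
  have := LinearMap.finrank_le_finrank_of_surjective
    (f := ((tangentMap g a c x).coprod (tangentMap h b c y)).toLinearMap) hs
  simpa using this

/-- Transversality may be checked after étale maps: it only depends on the tangent spaces and
dimensions of the strata. -/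
theorem IsTransverseSMan.of_etale {X' Y' Z' : PreSMan.{u}} (hX : X.IsSMan) (hY : Y.IsSMan)
    (hZ : Z.IsSMan) (hX' : X'.IsSMan) (hY' : Y'.IsSMan) (hZ' : Z'.IsSMan)
    {g : X → Z} {h : Y → Z} (hg : IsSmooth X Z g) (hh : IsSmooth Y Z h)
    {g' : X' → Z'} {h' : Y' → Z'} (hg' : IsSmooth X' Z' g') (hh' : IsSmooth Y' Z' h')
    {i : X' → X} {j : Y' → Y} {k : Z' → Z} (hi : IsEtale X' X i) (hj : IsEtale Y' Y j)
    (hk : IsEtale Z' Z k) (hgi : ∀ x, g (i x) = k (g' x)) (hhj : ∀ y, h (j y) = k (h' y))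
    (ht : IsTransverseSMan X Y Z g h) : IsTransverseSMan X' Y' Z' g' h' := by
  intro x y hxy
  have hij : g (i x) = h (j y) := by rw [hgi, hhj, hxy]
  obtain ⟨h1, h2⟩ := ht (i x) (j y) hij
  constructor
  · intro p q r a' ha' b' hb' c' hc' hx hy hz t
    have hz2 : h' y ∈ c'.source := hxy ▸ hz
    obtain ⟨a, ha, hax⟩ := hX.exists_chart (i x)
    obtain ⟨b, hb, hby⟩ := hY.exists_chart (j y)
    obtain ⟨c, hc, hcz⟩ := hZ.exists_chart (g (i x))
    have hcz' : k (g' x) ∈ c.source := hgi x ▸ hcz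
    have hcz2 : k (h' y) ∈ c.source := hxy ▸ hcz'
    have hcz2' : h (j y) ∈ c.source := hij ▸ hcz
    obtain ⟨v, w, hvw⟩ := h1 _ _ _ a ha b hb c hc hax hby hcz (tangentMap k c' c (g' x) t)
    obtain ⟨v', rfl⟩ := (hi.bijective x _ _ a' ha' a ha hx hax).2 v
    obtain ⟨w', rfl⟩ := (hj.bijective y _ _ b' hb' b hb hy hby).2 w
    refine ⟨v', w', (hk.bijective (g' x) _ _ c' hc' c hc hz hcz').1 ?_⟩
    rw [← hvw, map_add]
    congr 1
    · rw [← tangentMap_comp_apply hX' hX hZ hg hi.toIsSmooth ha' ha hc hx hax hcz,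
        ← tangentMap_comp_apply hX' hZ' hZ hk.toIsSmooth hg' ha' hc' hc hx hz hcz']
      simp only [hgi]
    · rw [← tangentMap_comp_apply hY' hY hZ hh hj.toIsSmooth hb' hb hc hy hby hcz2', hxy,
        ← tangentMap_comp_apply hY' hZ' hZ hk.toIsSmooth hh' hb' hc' hc hy hz2 hcz2]
      simp only [hhj]
  · rw [hgi, hi.sdim_eq, hi.dim_eq, hj.sdim_eq, hj.dim_eq, hk.sdim_eq, hk.dim_eq] at h2
    exact h2

end SMan

/-! ### The local order on strata, in terms of points -/

/-- The stratum of `x`. -/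
def PreSMan.stratum (X : PreSMan.{u}) (x : X) : Set X := {y | X.rel y x}

theorem PreSMan.mem_stratum_self (X : PreSMan.{u}) (x : X) : x ∈ X.stratum x := X.rel.refl' x

theorem PreSMan.stratum_eq_iff (X : PreSMan.{u}) {x y : X} :
    X.stratum x = X.stratum y ↔ X.rel x y := by
  constructor
  · intro h
    have : x ∈ X.stratum y := h ▸ X.mem_stratum_self x
    exact this
  · intro h
    ext z
    exact ⟨fun hz => X.rel.trans' hz h, fun hz => X.rel.trans' hz (X.rel.symm' h)⟩

theorem PreSMan.stratum_mem_strata (X : PreSMan.{u}) (x : X) : X.stratum x ∈ X.strata :=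
  ⟨x, rfl⟩

theorem PreSMan.strata_eq_range (X : PreSMan.{u}) : X.strata = range X.stratum := by
  ext S
  exact ⟨fun ⟨x, hx⟩ => ⟨x, hx.symm⟩, fun ⟨x, hx⟩ => ⟨x, hx.symm⟩⟩

theorem PreSMan.strataMeeting_eq (X : PreSMan.{u}) (V : Set X) :
    X.strataMeeting V = X.stratum '' V := by
  ext S
  constructor
  · rintro ⟨⟨x, rfl⟩, y, hy, hyV⟩
    exact ⟨y, hyV, X.stratum_eq_iff.2 hy⟩
  · rintro ⟨x, hx, rfl⟩
    exact ⟨X.stratum_mem_strata x, x, X.mem_stratum_self x, hx⟩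

/-- The local condition on strata in the definition of an s-manifold, for an order on strata given as a
relation between points. -/
def PreSMan.HasLocalOrder (X : PreSMan.{u}) (x : X) : Prop :=
  ∃ (V : Set X) (le : X → X → Prop), IsOpen V ∧ x ∈ V ∧ (∀ y ∈ V, X.dim y = X.dim x) ∧
    (X.stratum '' V).Finite ∧
    (∀ s s' t t', X.rel s s' → X.rel t t' → le s t → le s' t') ∧
    (∀ s ∈ V, le s s) ∧
    (∀ s ∈ V, ∀ t ∈ V, le s t → le t s → X.rel s t) ∧
    (∀ s ∈ V, ∀ t ∈ V, ∀ r ∈ V, le s t → le t r → le s r) ∧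
    (∀ s ∈ V, ∀ t ∈ V, t ∈ closure (V ∩ X.stratum s) → le s t) ∧
    (∀ s ∈ V, ∀ t ∈ V, ¬ X.rel s t → le s t →
      (((X.sdim s : ℤ) = X.dim x - 1 ∨ (X.sdim s : ℤ) = X.dim x) ∧ X.sdim t < X.sdim s) ∨
      ((X.sdim s : ℤ) ≤ X.dim x - 2 ∧ (X.sdim t : ℤ) ≤ X.dim x - 2))

theorem PreSMan.IsSMan.hasLocalOrder {X : PreSMan.{u}} (hX : X.IsSMan) (x : X) :
    X.HasLocalOrder x := by
  obtain ⟨V, hV, hxV, hdim, hfin, le, h1, h2, h3, h4, h5⟩ := hX.localOrder x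
  rw [X.strataMeeting_eq] at hfin h1 h2 h3 h4 h5
  have hm : ∀ s ∈ V, X.stratum s ∈ X.stratum '' V := fun s hs => mem_image_of_mem _ hs
  refine ⟨V, fun s t => le (X.stratum s) (X.stratum t), hV, hxV, hdim, hfin, ?_,
    fun s hs => h1 _ (hm s hs), ?_, ?_, ?_, ?_⟩
  · intro s s' t t' hs ht hst
    rwa [← X.stratum_eq_iff.2 hs, ← X.stratum_eq_iff.2 ht]
  · exact fun s hs t ht hst hts => X.stratum_eq_iff.1 (h2 _ (hm s hs) _ (hm t ht) hst hts)
  · exact fun s hs t ht r hr => h3 _ (hm s hs) _ (hm t ht) _ (hm r hr)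
  · intro s hs t ht hcl
    obtain ⟨T, hT⟩ := mem_iUnion.1 (h4 _ (hm s hs) ⟨hcl, ht⟩)
    obtain ⟨⟨⟨t', ht', rfl⟩, hle⟩, -, htT⟩ := mem_iUnion.1 hT |>.choose_spec |> fun h =>
      (⟨(mem_iUnion.1 hT).choose, h⟩ : _ ∧ t ∈ V ∩ T)
    rw [X.stratum_eq_iff.2 htT]
    exact hle
  · intro s hs t ht hne hle
    exact h5 _ (hm s hs) _ (hm t ht) (fun h => hne (X.stratum_eq_iff.1 h)) hle s
      (X.mem_stratum_self s) t (X.mem_stratum_self t)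

theorem PreSMan.HasLocalOrder.localOrder {X : PreSMan.{u}}
    (hs : ∀ x y, X.rel x y → X.sdim x = X.sdim y) {x : X} (h : X.HasLocalOrder x) :
    ∃ V : Set X, IsOpen V ∧ x ∈ V ∧ (∀ y ∈ V, X.dim y = X.dim x) ∧
    (X.strataMeeting V).Finite ∧ ∃ le : Set X → Set X → Prop,
      (∀ S ∈ X.strataMeeting V, le S S) ∧
      (∀ S ∈ X.strataMeeting V, ∀ T ∈ X.strataMeeting V, le S T → le T S → S = T) ∧
      (∀ S ∈ X.strataMeeting V, ∀ T ∈ X.strataMeeting V, ∀ R ∈ X.strataMeeting V,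
        le S T → le T R → le S R) ∧
      (∀ S ∈ X.strataMeeting V, closure (V ∩ S) ∩ V ⊆
        ⋃ T ∈ {T | T ∈ X.strataMeeting V ∧ le S T}, V ∩ T) ∧
      (∀ S ∈ X.strataMeeting V, ∀ T ∈ X.strataMeeting V, S ≠ T → le S T →
        ∀ s ∈ S, ∀ t ∈ T,
          (((X.sdim s : ℤ) = X.dim x - 1 ∨ (X.sdim s : ℤ) = X.dim x) ∧ X.sdim t < X.sdim s) ∨
          ((X.sdim s : ℤ) ≤ X.dim x - 2 ∧ (X.sdim t : ℤ) ≤ X.dim x - 2)) := by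
  obtain ⟨V, le, hV, hxV, hdim, hfin, hrel, h1, h2, h3, h4, h5⟩ := h
  let le' : Set X → Set X → Prop := fun S T => ∃ s t, X.stratum s = S ∧ X.stratum t = T ∧ le s t
  have hle : ∀ s t, le' (X.stratum s) (X.stratum t) ↔ le s t := by
    intro s t
    constructor
    · rintro ⟨s', t', hs', ht', hl⟩
      exact hrel _ _ _ _ (X.stratum_eq_iff.1 hs') (X.stratum_eq_iff.1 ht') hl
    · exact fun hl => ⟨s, t, rfl, rfl, hl⟩
  refine ⟨V, hV, hxV, hdim, (X.strataMeeting_eq V).symm ▸ hfin, le', ?_⟩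
  rw [X.strataMeeting_eq]
  refine ⟨?_, ?_, ?_, ?_, ?_⟩
  · rintro _ ⟨s, hs, rfl⟩
    exact (hle _ _).2 (h1 s hs)
  · rintro _ ⟨s, hs, rfl⟩ _ ⟨t, ht, rfl⟩
    rw [hle, hle]
    exact fun ha hb => X.stratum_eq_iff.2 (h2 s hs t ht ha hb)
  · rintro _ ⟨s, hs, rfl⟩ _ ⟨t, ht, rfl⟩ _ ⟨r, hr, rfl⟩
    rw [hle, hle, hle]
    exact h3 s hs t ht r hr
  · rintro _ ⟨s, hs, rfl⟩ t ⟨htc, ht⟩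
    refine mem_iUnion₂.2 ⟨X.stratum t, ⟨mem_image_of_mem _ ht, (hle _ _).2 (h4 s hs t ht htc)⟩,
      ht, X.mem_stratum_self t⟩
  · rintro _ ⟨s, hsV, rfl⟩ _ ⟨t, htV, rfl⟩ hne hl s' hs' t' ht'
    rw [hs _ _ hs', hs _ _ ht']
    exact h5 s hsV t htV (fun hr => hne (X.stratum_eq_iff.2 hr)) ((hle _ _).1 hl)

/-! ### Stratified fibre products -/

/-- `W` is, by `(π₁, π₂)`, an open and closed part of the fibre product of `g : A → Z` and
`h : B → Z`. -/
structure IsFibre (A B Z : PreSMan.{u}) (g : A → Z) (h : B → Z) {W : Type u} [TopologicalSpace W]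
    (π₁ : W → A) (π₂ : W → B) : Prop where
  isEmbedding : IsEmbedding (fun w => (π₁ w, π₂ w))
  comm : ∀ w, g (π₁ w) = h (π₂ w)
  isClosed_range : IsClosed (range fun w => (π₁ w, π₂ w))
  exists_open : ∃ O : Set (A × B), IsOpen O ∧ (∀ w, (π₁ w, π₂ w) ∈ O) ∧
    ∀ x y, (x, y) ∈ O → g x = h y → ∃ w, π₁ w = x ∧ π₂ w = y

/-- The stratified manifold structure on a part `W` of the fibre product of `A` and `B` over `Z`, with
a given dimension function. Both `PreSMan.pullback` and `PreSManC.DSMan` are of this form. -/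
def fibreSMan (A B Z : PreSMan.{u}) (g : A → Z) {W : Type u} [TopologicalSpace W]
    (π₁ : W → A) (π₂ : W → B) (dim : W → ℤ) : PreSMan.{u} where
  carrier := W
  rel := pairRel A B π₁ π₂
  charts := submanifoldCharts (pairRel A B π₁ π₂)
    (fun w => A.sdim (π₁ w) + B.sdim (π₂ w) - Z.sdim (g (π₁ w))) A B π₁ π₂
  sdim w := A.sdim (π₁ w) + B.sdim (π₂ w) - Z.sdim (g (π₁ w))
  dim := dim

section Fibre

variable {A B Z : PreSMan.{u}} {g : A → Z} {h : B → Z} {W : Type u} [TopologicalSpace W]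
  {π₁ : W → A} {π₂ : W → B}

theorem IsFibre.continuous_fst (hF : IsFibre A B Z g h π₁ π₂) : Continuous π₁ :=
  _root_.continuous_fst.comp hF.isEmbedding.continuous

theorem IsFibre.continuous_snd (hF : IsFibre A B Z g h π₁ π₂) : Continuous π₂ :=
  _root_.continuous_snd.comp hF.isEmbedding.continuous

theorem IsFibre.ext (hF : IsFibre A B Z g h π₁ π₂) {w w' : W} (h1 : π₁ w = π₁ w')
    (h2 : π₂ w = π₂ w') : w = w' :=
  hF.isEmbedding.injective (Prod.ext h1 h2)

/-- The conditions on a submanifold chart, pointwise. -/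
theorem mem_submanifoldCharts_iff (hA : A.IsSMan) (hB : B.IsSMan) (h1 : Continuous π₁)
    (h2 : Continuous π₂) {sd : W → ℕ} {p : ℕ} {c : Chart W p} :
    c ∈ submanifoldCharts (pairRel A B π₁ π₂) sd A B π₁ π₂ p ↔
      c.IsStratumChart (pairRel A B π₁ π₂) sd ∧
      (∀ q, ∀ a ∈ A.charts q, ∀ w ∈ c.source, π₁ w ∈ a.source → c.SmoothAt (a.map ∘ π₁) w) ∧
      (∀ q, ∀ b ∈ B.charts q, ∀ w ∈ c.source, π₂ w ∈ b.source → c.SmoothAt (b.map ∘ π₂) w) ∧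
      ∀ q, ∀ a ∈ A.charts q, ∀ q', ∀ b ∈ B.charts q',
        ∀ w ∈ c.source, π₁ w ∈ a.source → π₂ w ∈ b.source →
          ∀ v : E p, tangentMap π₁ c a w v = 0 → tangentMap π₂ c b w v = 0 → v = 0 := by
  refine and_congr_right fun hc => and_congr ?_ (and_congr_left' ?_)
  · exact forall_congr' fun q => forall₂_congr fun a ha =>
      hc.contDiffOn_iff (hA.isStratumChart q a ha) h1 (fun _ _ h => h.1)
  · exact forall_congr' fun q => forall₂_congr fun a ha =>
      hc.contDiffOn_iff (hB.isStratumChart q a ha) h2 (fun _ _ h => h.2)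

/-- A continuous map into `W` which preserves strata is smooth at a point if its two components are,
because submanifold charts are immersions to `A × B`. -/
theorem smoothAt_lift (hA : A.IsSMan) (hB : B.IsSMan) (h1 : Continuous π₁)
    (h2 : Continuous π₂) {sd : W → ℕ} {p : ℕ} {c : Chart W p}
    (hc : c ∈ submanifoldCharts (pairRel A B π₁ π₂) sd A B π₁ π₂ p)
    {T : Type u} [TopologicalSpace T] {rT : Setoid T} {sT : T → ℕ} {k : ℕ} {a : Chart T k}
    (ha : a.IsStratumChart rT sT) {φ : T → W} (hφ : Continuous φ)
    (hr : ∀ t t', rT t t' → pairRel A B π₁ π₂ (φ t) (φ t')) {t : T} (ht : t ∈ a.source)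
    (hφt : φ t ∈ c.source)
    (hs1 : ∀ q, ∀ α ∈ A.charts q, π₁ (φ t) ∈ α.source → a.SmoothAt (α.map ∘ π₁ ∘ φ) t)
    (hs2 : ∀ q, ∀ β ∈ B.charts q, π₂ (φ t) ∈ β.source → a.SmoothAt (β.map ∘ π₂ ∘ φ) t) :
    a.SmoothAt (c.map ∘ φ) t := by
  obtain ⟨hcs, hc1, hc2, hc3⟩ := (mem_submanifoldCharts_iff hA hB h1 h2).1 hc
  obtain ⟨α, hα, hαx⟩ := hA.exists_chart (π₁ (φ t))
  obtain ⟨β, hβ, hβx⟩ := hB.exists_chart (π₂ (φ t))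
  have hac := ha.isOpenEmbedding
  have hcc := hcs.isOpenEmbedding
  have hev := ha.eventually_mem hcs hφ hr ht hφt
  have hτ : a.rep (c.map ∘ φ) (a.map t) = c.map (φ t) := Chart.rep_map hac _ ht
  have k1 := hc1 _ α hα _ hφt hαx
  have k2 := hc2 _ β hβ _ hφt hβx
  refine contDiffAt_of_comp_immersion (τ := a.rep (c.map ∘ φ))
    (G := fun e => (c.rep (α.map ∘ π₁) e, c.rep (β.map ∘ π₂) e))
    (H := fun e => (a.rep (α.map ∘ π₁ ∘ φ) e, a.rep (β.map ∘ π₂ ∘ φ) e)) ?_ ?_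
    (ha.continuousAt_rep hcs hφ hr ht hφt)
    (ContDiffAt.prodMk (hs1 _ α hα hαx) (hs2 _ β hβ hβx)) ?_
  · rw [hτ]
    exact ContDiffAt.prodMk k1 k2
  · rw [hτ, (k1.differentiableAt.hasFDerivAt.prodMk k2.differentiableAt.hasFDerivAt).fderiv]
    rw [injective_iff_map_eq_zero]
    intro v hv
    exact hc3 _ α hα _ β hβ _ hφt hαx hβx v (congrArg Prod.fst hv) (congrArg Prod.snd hv)
  · filter_upwards [Chart.rep_comp hac hcc (α.map ∘ π₁) ht hev,
      Chart.rep_comp hac hcc (β.map ∘ π₂) ht hev] with e he1 he2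
    exact Prod.ext he1.symm he2.symm

/-- The submanifold charts cover `W`: the equation `g x = h y`, read in charts, is a submersion at a point
of `W`, so it can be completed by linear coordinates to a diffeomorphism, and these coordinates
restrict to a chart of the fibre product. -/
theorem IsFibre.exists_submanifoldChart (hA : A.IsSMan) (hB : B.IsSMan) (hZ : Z.IsSMan)
    (hg : IsSmooth A Z g) (hh : IsSmooth B Z h) (hF : IsFibre A B Z g h π₁ π₂) (w₀ : W)
    (ht : TangentTransverse A B Z g h (π₁ w₀) (π₂ w₀)) :
    ∃ c ∈ submanifoldCharts (pairRel A B π₁ π₂)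
      (fun w => A.sdim (π₁ w) + B.sdim (π₂ w) - Z.sdim (g (π₁ w))) A B π₁ π₂
      (A.sdim (π₁ w₀) + B.sdim (π₂ w₀) - Z.sdim (g (π₁ w₀))), w₀ ∈ c.source := by
  have hle := ht.sdim_le hA hB hZ
  have eA := hA.exists_chart (π₁ w₀)
  have eB := hB.exists_chart (π₂ w₀)
  have eZ := hZ.exists_chart (g (π₁ w₀))
  generalize hp : A.sdim (π₁ w₀) = p at eA hle ⊢
  generalize hq : B.sdim (π₂ w₀) = q at eB hle ⊢
  generalize hr : Z.sdim (g (π₁ w₀)) = r at eZ hle ⊢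
  obtain ⟨α, hα, hα₀⟩ := eA
  obtain ⟨β, hβ, hβ₀⟩ := eB
  obtain ⟨γ, hγ, hγ₀⟩ := eZ
  have hγ₀' : h (π₂ w₀) ∈ γ.source := hF.comm w₀ ▸ hγ₀
  have hαe := hA.emb hα
  have hβe := hB.emb hβ
  have hγe := hZ.emb hγ
  have hc1 := hF.continuous_fst
  have hc2 := hF.continuous_snd
  -- the equation of the fibre product, read in charts
  let Φ : E p × E q → E r := fun v => α.rep (γ.map ∘ g) v.1 - β.rep (γ.map ∘ h) v.2
  let Oα : Set (E p) := α.map '' (α.source ∩ g ⁻¹' γ.source)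
  let Oβ : Set (E q) := β.map '' (β.source ∩ h ⁻¹' γ.source)
  have hOα : IsOpen Oα := by
    rw [isOpen_iff_mem_nhds]
    rintro _ ⟨x, ⟨hx, hgx⟩, rfl⟩
    exact Chart.image_mem_nhds hαe hx (hg.eventually_mem hA hZ hα hγ hx hgx)
  have hOβ : IsOpen Oβ := by
    rw [isOpen_iff_mem_nhds]
    rintro _ ⟨x, ⟨hx, hgx⟩, rfl⟩
    exact Chart.image_mem_nhds hβe hx (hh.eventually_mem hB hZ hβ hγ hx hgx)
  have hΦ : ∀ v ∈ Oα ×ˢ Oβ, ContDiffAt ℝ ∞ Φ v := by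
    rintro ⟨_, _⟩ ⟨⟨x, ⟨hx, hgx⟩, rfl⟩, ⟨y, ⟨hy, hhy⟩, rfl⟩⟩
    have k1 : ContDiffAt ℝ ∞ (α.rep (γ.map ∘ g)) (α.map x) := hg.smoothAt hA hZ hα hγ hx hgx
    have k2 : ContDiffAt ℝ ∞ (β.rep (γ.map ∘ h)) (β.map y) := hh.smoothAt hB hZ hβ hγ hy hhy
    exact ContDiffAt.sub (ContDiffAt.comp (α.map x, β.map y) k1 contDiffAt_fst)
      (ContDiffAt.comp (α.map x, β.map y) k2 contDiffAt_snd)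
  have hsurj : Function.Surjective (fderiv ℝ Φ (α.map (π₁ w₀), β.map (π₂ w₀))) := by
    have k1 : DifferentiableAt ℝ (α.rep (γ.map ∘ g)) (α.map (π₁ w₀)) :=
      (hg.smoothAt hA hZ hα hγ hα₀ hγ₀).differentiableAt
    have k2 : DifferentiableAt ℝ (β.rep (γ.map ∘ h)) (β.map (π₂ w₀)) :=
      (hh.smoothAt hB hZ hβ hγ hβ₀ hγ₀').differentiableAt
    have hd : HasFDerivAt Φ _ (α.map (π₁ w₀), β.map (π₂ w₀)) :=
      (HasFDerivAt.comp (α.map (π₁ w₀), β.map (π₂ w₀)) k1.hasFDerivAt hasFDerivAt_fst).sub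
        (HasFDerivAt.comp (α.map (π₁ w₀), β.map (π₂ w₀)) k2.hasFDerivAt hasFDerivAt_snd)
    rw [hd.fderiv]
    intro t
    obtain ⟨v, w, hvw⟩ := ht _ _ _ α hα β hβ γ hγ hα₀ hβ₀ hγ₀ t
    refine ⟨(v, -w), ?_⟩
    simpa [tangentMap] using hvw
  obtain ⟨L, H, hv₀, hHO, hH, hHs⟩ := exists_openPartialHomeomorph_of_submersion
    (F := E (p + q - r)) (hOα.prod hOβ) (v₀ := (α.map (π₁ w₀), β.map (π₂ w₀)))
    ⟨mem_image_of_mem _ ⟨hα₀, hγ₀⟩, mem_image_of_mem _ ⟨hβ₀, hγ₀'⟩⟩ hΦ hsurj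
    (by simp; omega)
  -- on `W` the first component of `H` vanishes, and the second one is the chart
  let θ : W → E p × E q := fun w => (α.map (π₁ w), β.map (π₂ w))
  let c : Chart W (p + q - r) :=
    ⟨{w | pairRel A B π₁ π₂ w₀ w ∧ π₁ w ∈ α.source ∧ π₂ w ∈ β.source ∧ θ w ∈ H.source},
      fun w => L (θ w)⟩
  have hHθ : ∀ w ∈ c.source, H (θ w) = (0, c.map w) := by
    intro w hw
    rw [hH]
    refine Prod.ext ?_ rfl
    change α.rep (γ.map ∘ g) (α.map (π₁ w)) - β.rep (γ.map ∘ h) (β.map (π₂ w)) = 0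
    rw [Chart.rep_map hαe _ hw.2.1, Chart.rep_map hβe _ hw.2.2.1, Function.comp_apply,
      Function.comp_apply, hF.comm, sub_self]
  have hHsymm : ∀ w ∈ c.source, H.symm (0, c.map w) = θ w := by
    intro w hw
    rw [← hHθ w hw, H.left_inv hw.2.2.2]
  have hαS := hA.isStratumChart _ α hα
  have hβS := hB.isStratumChart _ β hβ
  have hcontα : ContinuousOn α.map α.source :=
    continuousOn_iff_continuous_domRestrict.2 hαe.continuous
  have hcontβ : ContinuousOn β.map β.source :=
    continuousOn_iff_continuous_domRestrict.2 hβe.continuous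
  let D : Set W := {w | π₁ w ∈ α.source ∧ π₂ w ∈ β.source}
  have hθc : ContinuousOn θ D :=
    (hcontα.comp hc1.continuousOn fun w hw => hw.1).prodMk
      (hcontβ.comp hc2.continuousOn fun w hw => hw.2)
  have hθi : IsInducing (fun w : D => θ w) := by
    have i1 : IsInducing (fun w : D => ((⟨π₁ w, w.2.1⟩, ⟨π₂ w, w.2.2⟩) :
        α.source × β.source)) := by
      have i2 : IsInducing (fun w : D => (π₁ w, π₂ w)) :=
        hF.isEmbedding.isInducing.comp IsInducing.subtypeVal
      exact IsInducing.of_comp (by fun_prop)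
        (IsInducing.subtypeVal.prodMap IsInducing.subtypeVal).continuous i2
    exact (hαe.isInducing.prodMap hβe.isInducing).comp i1
  have hcS : c.IsStratumChart (pairRel A B π₁ π₂)
      (fun w => A.sdim (π₁ w) + B.sdim (π₂ w) - Z.sdim (g (π₁ w))) := by
    refine ⟨?_, ?_, ?_⟩
    · intro w hw
      rw [← hA.sdim_rel _ _ hw.1.1, ← hB.sdim_rel _ _ hw.1.2,
        ← hZ.sdim_rel _ _ (hg.map_rel _ _ hw.1.1), hp, hq, hr]
    · intro w hw
      obtain ⟨O₁, hO₁, e₁⟩ := hαS.open_source _ hα₀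
      obtain ⟨O₂, hO₂, e₂⟩ := hβS.open_source _ hβ₀
      obtain ⟨O₃, hO₃, e₃⟩ := (continuousOn_iff'.1 hθc) H.source H.open_source
      refine ⟨π₁ ⁻¹' O₁ ∩ π₂ ⁻¹' O₂ ∩ O₃,
        ((hO₁.preimage hc1).inter (hO₂.preimage hc2)).inter hO₃, ?_⟩
      ext w'
      constructor
      · rintro ⟨k1, k2, k3, k4⟩
        have k5 : w' ∈ O₃ ∩ D := e₃ ▸ (⟨k4, k2, k3⟩ : w' ∈ θ ⁻¹' H.source ∩ D)
        rw [e₁] at k2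
        rw [e₂] at k3
        exact ⟨⟨⟨k2.1, k3.1⟩, k5.1⟩, Setoid.trans' _ (Setoid.symm' _ hw.1) k1⟩
      · rintro ⟨⟨⟨k1, k2⟩, k3⟩, k4⟩
        have k5 : pairRel A B π₁ π₂ w₀ w' := Setoid.trans' _ hw.1 k4
        have m1 : π₁ w' ∈ α.source := by rw [e₁]; exact ⟨k1, k5.1⟩
        have m2 : π₂ w' ∈ β.source := by rw [e₂]; exact ⟨k2, k5.2⟩
        have m3 : w' ∈ θ ⁻¹' H.source ∩ D := e₃ ▸ (⟨k3, m1, m2⟩ : w' ∈ O₃ ∩ D)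
        exact ⟨k5, m1, m2, m3.1⟩
    · refine IsOpenEmbedding.of_continuous_injective_isOpenMap ?_ ?_ ?_
      · exact L.continuous.comp (continuousOn_iff_continuous_domRestrict.1
          (hθc.mono fun w hw => ⟨hw.2.1, hw.2.2.1⟩))
      · rintro ⟨w, hw⟩ ⟨w', hw'⟩ he
        have he' : c.map w = c.map w' := he
        have : θ w = θ w' := by rw [← hHsymm w hw, ← hHsymm w' hw', he']
        exact Subtype.ext (hF.ext (Chart.injOn hαe hw.2.1 hw'.2.1 (congrArg Prod.fst this))
          (Chart.injOn hβe hw.2.2.1 hw'.2.2.1 (congrArg Prod.snd this)))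
      · rw [isOpenMap_iff_nhds_le]
        rintro ⟨w, hw⟩ U hU
        obtain ⟨O, hO, hOw, hOs⟩ := hF.exists_open
        have hi : IsInducing (fun w : c.source => θ w) :=
          hθi.comp (f := fun w : c.source => (⟨w, w.2.2.1, w.2.2.2.1⟩ : D))
            (IsInducing.of_comp (by fun_prop) continuous_subtype_val IsInducing.subtypeVal)
        rw [Filter.mem_map, hi.nhds_eq_comap, Filter.mem_comap] at hU
        obtain ⟨N, hN, hNU⟩ := hU
        -- near `θ w` all points of the product of charts come from the open set `O`
        have hOn : ∀ᶠ v in 𝓝 (θ w), ∃ x ∈ α.source, ∃ y ∈ β.source,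
            (x, y) ∈ O ∧ v = (α.map x, β.map y) := by
          change ∀ᶠ v in 𝓝 (α.map (π₁ w), β.map (π₂ w)), _
          rw [nhds_prod_eq, ← Chart.map_nhdsWithin hαe hw.2.1, ← Chart.map_nhdsWithin hβe hw.2.2.1,
            Filter.prod_map_map_eq, Filter.eventually_map, ← nhdsWithin_prod_eq]
          filter_upwards [self_mem_nhdsWithin,
            mem_nhdsWithin_of_mem_nhds (hO.mem_nhds (hOw w))] with z hz1 hz2
          exact ⟨z.1, hz1.1, z.2, hz1.2, hz2, rfl⟩
        have hwt : (0, c.map w) ∈ H.target := hHθ w hw ▸ H.map_source hw.2.2.2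
        have htend : Tendsto (fun e => H.symm ((0 : E r), e)) (𝓝 (c.map w)) (𝓝 (θ w)) := by
          have h2 := (H.continuousAt_symm hwt).tendsto
          rw [hHsymm w hw] at h2
          exact h2.comp ((Continuous.prodMk_right (0 : E r)).tendsto _)
        have htarget : ∀ᶠ e in 𝓝 (c.map w), ((0 : E r), e) ∈ H.target :=
          (Continuous.prodMk_right (0 : E r)).continuousAt.eventually
            (H.open_target.mem_nhds hwt)
        filter_upwards [htend.eventually hOn, htend.eventually hN, htarget] with e he1 he2 he3
        obtain ⟨x, hx, y, hy, hxy, hv⟩ := he1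
        have hvs := H.map_target he3
        have hHv := H.right_inv he3
        rw [hv] at hvs hHv he2
        obtain ⟨⟨x', ⟨hx', hgx⟩, hxe⟩, ⟨y', ⟨hy', hhy⟩, hye⟩⟩ := hHO hvs
        obtain rfl := Chart.injOn hαe hx' hx hxe
        obtain rfl := Chart.injOn hβe hy' hy hye
        have hz : g x' = h y' := by
          rw [hH] at hHv
          have := congrArg Prod.fst hHv
          change α.rep (γ.map ∘ g) (α.map x') - β.rep (γ.map ∘ h) (β.map y') = 0 at this
          rw [Chart.rep_map hαe _ hx, Chart.rep_map hβe _ hy, sub_eq_zero] at this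
          exact Chart.injOn hγe hgx hhy this
        obtain ⟨w', rfl, rfl⟩ := hOs _ _ hxy hz
        have hw' : w' ∈ c.source := ⟨⟨hαS.rel hα₀ hx, hβS.rel hβ₀ hy⟩, hx, hy, hvs⟩
        have hU' : (⟨w', hw'⟩ : c.source) ∈ (fun w : c.source => θ w) ⁻¹' N := he2
        have h3 : c.map w' = e := by
          have := hHθ w' hw'
          rw [show θ w' = _ from rfl, hHv] at this
          exact (congrArg Prod.snd this).symm
        have := hNU hU'
        simp only [mem_preimage] at this
        rwa [h3] at this
  have hce := hcS.isOpenEmbedding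
  have hσ1 : ∀ w ∈ c.source, c.rep (α.map ∘ π₁) =ᶠ[𝓝 (c.map w)] fun e => (H.symm (0, e)).1 := by
    intro w hw
    rw [EventuallyEq, Chart.eventually_nhds hce hw]
    filter_upwards [self_mem_nhdsWithin] with w' hw'
    rw [Chart.rep_map hce _ hw', hHsymm w' hw']
    rfl
  have hσ2 : ∀ w ∈ c.source, c.rep (β.map ∘ π₂) =ᶠ[𝓝 (c.map w)] fun e => (H.symm (0, e)).2 := by
    intro w hw
    rw [EventuallyEq, Chart.eventually_nhds hce hw]
    filter_upwards [self_mem_nhdsWithin] with w' hw'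
    rw [Chart.rep_map hce _ hw', hHsymm w' hw']
    rfl
  have hσ : ∀ w ∈ c.source, ContDiffAt ℝ ∞ (fun e => H.symm ((0 : E r), e)) (c.map w) := by
    intro w hw
    have h1 : (0, c.map w) ∈ H.target := hHθ w hw ▸ H.map_source hw.2.2.2
    exact (hHs _ h1).comp (c.map w) (contDiffAt_const.prodMk contDiffAt_id)
  have hs1 : ∀ w ∈ c.source, c.SmoothAt (α.map ∘ π₁) w := fun w hw =>
    (contDiffAt_fst.comp _ (hσ w hw)).congr_of_eventuallyEq (hσ1 w hw)
  have hs2 : ∀ w ∈ c.source, c.SmoothAt (β.map ∘ π₂) w := fun w hw =>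
    (contDiffAt_snd.comp _ (hσ w hw)).congr_of_eventuallyEq (hσ2 w hw)
  have hm1 : ∀ w ∈ c.source, ∀ᶠ w' in 𝓝[c.source] w, π₁ w' ∈ α.source := fun w _ => by
    filter_upwards [self_mem_nhdsWithin] with w' hw'
    exact hw'.2.1
  have hm2 : ∀ w ∈ c.source, ∀ᶠ w' in 𝓝[c.source] w, π₂ w' ∈ β.source := fun w _ => by
    filter_upwards [self_mem_nhdsWithin] with w' hw'
    exact hw'.2.2.1
  refine ⟨c, (mem_submanifoldCharts_iff hA hB hc1 hc2).2 ⟨hcS, ?_, ?_, ?_⟩,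
    Setoid.refl' _ _, hα₀, hβ₀, hv₀⟩
  · intro q' a ha w hw hwa
    exact Chart.SmoothAt.comp hce hαe hw (hm1 w hw) (hA.smoothAt_map hα ha hw.2.1 hwa) (hs1 w hw)
  · intro q' b hb w hw hwb
    exact Chart.SmoothAt.comp hce hβe hw (hm2 w hw) (hB.smoothAt_map hβ hb hw.2.2.1 hwb) (hs2 w hw)
  · intro q₁ a ha q₂ b hb w hw hwa hwb v hv1 hv2
    have t1 : tangentMap π₁ c α w v = 0 := by
      have e := Chart.fderiv_rep_comp (G := a.map) hce hαe hw (hm1 w hw)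
        (hA.smoothAt_map hα ha hw.2.1 hwa) (hs1 w hw)
      apply (tangentMap_id_bijective hA hα ha hw.2.1 hwa).1
      rw [map_zero, ← hv1]
      exact (DFunLike.congr_fun e v).symm
    have t2 : tangentMap π₂ c β w v = 0 := by
      have e := Chart.fderiv_rep_comp (G := b.map) hce hβe hw (hm2 w hw)
        (hB.smoothAt_map hβ hb hw.2.2.1 hwb) (hs2 w hw)
      apply (tangentMap_id_bijective hB hβ hb hw.2.2.1 hwb).1
      rw [map_zero, ← hv2]
      exact (DFunLike.congr_fun e v).symm
    -- the coordinates `L` are a left inverse of the embedding of the fibre product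
    have hd := ((hσ w hw).differentiableAt (by simp)).hasFDerivAt
    have d1 : (fderiv ℝ (fun e => H.symm ((0 : E r), e)) (c.map w) v).1 = 0 := by
      rw [← t1]
      unfold tangentMap
      rw [(hσ1 w hw).fderiv_eq, hd.fst.fderiv]
      rfl
    have d2 : (fderiv ℝ (fun e => H.symm ((0 : E r), e)) (c.map w) v).2 = 0 := by
      rw [← t2]
      unfold tangentMap
      rw [(hσ2 w hw).fderiv_eq, hd.snd.fderiv]
      rfl
    have hL : (fun e => L (H.symm ((0 : E r), e))) =ᶠ[𝓝 (c.map w)] id := by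
      rw [EventuallyEq, Chart.eventually_nhds hce hw]
      filter_upwards [self_mem_nhdsWithin] with w' hw'
      rw [hHsymm w' hw']
      rfl
    have hdL := (L.hasFDerivAt.comp (c.map w) hd).congr_of_eventuallyEq hL.symm
    have := DFunLike.congr_fun (hdL.unique (hasFDerivAt_id _)) v
    rw [ContinuousLinearMap.comp_apply,
      show fderiv ℝ (fun e => H.symm ((0 : E r), e)) (c.map w) v = 0 from Prod.ext d1 d2,
      map_zero] at this
    exact this.symm

end Fibre

/-! ### Criteria for a fibre product to be an s-manifold -/

theorem PreSMan.IsSMan.exists_smooth_embedding {X : PreSMan.{u}} (hX : X.IsSMan) (x : X) :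
    ∃ (U : Set X) (N : ℕ) (F : X → E N), IsOpen U ∧ x ∈ U ∧ IsEmbedding (fun y : U => F y) ∧
      ∀ p, ∀ c ∈ X.charts p, ∀ y ∈ c.source, y ∈ U → c.SmoothAt F y ∧
        Function.Injective (fderiv ℝ (c.rep F) (c.map y)) := by
  obtain ⟨U, N, F, hU, hx, hF, h⟩ := hX.embeds x
  refine ⟨U, N, F, hU, hx, hF, fun p c hc y hy hyU => ⟨?_, (h p c hc).2 y ⟨hy, hyU⟩⟩⟩
  exact (Chart.contDiffOn_iff (hX.emb hc) fun z _ hz =>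
    mem_nhdsWithin_of_mem_nhds (hU.mem_nhds hz)).1 (h p c hc).1 y hy hyU

section Fibre

variable {A B Z : PreSMan.{u}} {g : A → Z} {h : B → Z} {W : Type u} [TopologicalSpace W]
  {π₁ : W → A} {π₂ : W → B}

theorem isStratumChart_of_mem_fibreSMan (dim : W → ℤ) (p : ℕ) (c : Chart W p)
    (hc : c ∈ (fibreSMan A B Z g π₁ π₂ dim).charts p) :
    c.IsStratumChart (fibreSMan A B Z g π₁ π₂ dim).rel (fibreSMan A B Z g π₁ π₂ dim).sdim :=
  hc.1

theorem IsFibre.smooth_fst (hA : A.IsSMan) (hB : B.IsSMan) (hF : IsFibre A B Z g h π₁ π₂)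
    (dim : W → ℤ) : IsSmooth (fibreSMan A B Z g π₁ π₂ dim) A π₁ :=
  .of_smoothAt (isStratumChart_of_mem_fibreSMan dim) hA.isStratumChart hF.continuous_fst (fun _ _ h => h.1)
    fun _ q _ hc b hb w hw hwb => ((mem_submanifoldCharts_iff hA hB hF.continuous_fst
      hF.continuous_snd).1 hc).2.1 q b hb w hw hwb

theorem IsFibre.smooth_snd (hA : A.IsSMan) (hB : B.IsSMan) (hF : IsFibre A B Z g h π₁ π₂)
    (dim : W → ℤ) : IsSmooth (fibreSMan A B Z g π₁ π₂ dim) B π₂ :=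
  .of_smoothAt (isStratumChart_of_mem_fibreSMan dim) hB.isStratumChart hF.continuous_snd (fun _ _ h => h.2)
    fun _ q _ hc b hb w hw hwb => ((mem_submanifoldCharts_iff hA hB hF.continuous_fst
      hF.continuous_snd).1 hc).2.2.1 q b hb w hw hwb

/-- A map to a fibre product is smooth if its two components are. -/
theorem IsFibre.smooth_lift (hA : A.IsSMan) (hB : B.IsSMan) (hF : IsFibre A B Z g h π₁ π₂)
    (dim : W → ℤ) {T : PreSMan.{u}} (hT : T.IsSMan) {φ : T → W}
    (h1 : IsSmooth T A (fun t => π₁ (φ t))) (h2 : IsSmooth T B (fun t => π₂ (φ t))) :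
    IsSmooth T (fibreSMan A B Z g π₁ π₂ dim) φ := by
  have hφ : Continuous φ :=
    hF.isEmbedding.isInducing.continuous_iff.2 (h1.continuous.prodMk h2.continuous)
  have hr : ∀ t t', T.rel t t' → pairRel A B π₁ π₂ (φ t) (φ t') := fun t t' htt =>
    ⟨h1.map_rel _ _ htt, h2.map_rel _ _ htt⟩
  refine .of_smoothAt hT.isStratumChart (isStratumChart_of_mem_fibreSMan dim) hφ hr
    fun p q a ha c hc t hta htc => ?_
  exact smoothAt_lift hA hB hF.continuous_fst hF.continuous_snd hc (hT.isStratumChart p a ha) hφ hr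
    hta htc (fun _ α hα hαt => h1.smoothAt hT hA ha hα hta hαt)
    (fun _ β hβ hβt => h2.smoothAt hT hB ha hβ hta hβt)

/-- The product of smooth embeddings of the factors is a smooth embedding of the fibre product. -/
theorem IsFibre.embeds (hA : A.IsSMan) (hB : B.IsSMan) (hF : IsFibre A B Z g h π₁ π₂)
    (sd : W → ℕ) (w : W) : ∃ (U : Set W) (N : ℕ) (F : W → E N), IsOpen U ∧ w ∈ U ∧
    IsEmbedding (fun y : U => F y) ∧
    ∀ p, ∀ c ∈ submanifoldCharts (pairRel A B π₁ π₂) sd A B π₁ π₂ p,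
      ContDiffOn ℝ ∞ (c.rep F) (c.map '' (c.source ∩ U)) ∧
      ∀ y ∈ c.source ∩ U, Function.Injective (fderiv ℝ (c.rep F) (c.map y)) := by
  obtain ⟨U₁, N₁, F₁, hU₁, hw₁, hE₁, hS₁⟩ := hA.exists_smooth_embedding (π₁ w)
  obtain ⟨U₂, N₂, F₂, hU₂, hw₂, hE₂, hS₂⟩ := hB.exists_smooth_embedding (π₂ w)
  let Λ : (E N₁ × E N₂) ≃L[ℝ] E (N₁ + N₂) := ContinuousLinearEquiv.ofFinrankEq (by simp)
  have hc1 := hF.continuous_fst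
  have hc2 := hF.continuous_snd
  let U : Set W := π₁ ⁻¹' U₁ ∩ π₂ ⁻¹' U₂
  have hU : IsOpen U := (hU₁.preimage hc1).inter (hU₂.preimage hc2)
  let F : W → E (N₁ + N₂) := fun w => Λ (F₁ (π₁ w), F₂ (π₂ w))
  have key : ∀ p, ∀ c ∈ submanifoldCharts (pairRel A B π₁ π₂) sd A B π₁ π₂ p,
      ∀ y ∈ c.source, y ∈ U →
        c.SmoothAt F y ∧ Function.Injective (fderiv ℝ (c.rep F) (c.map y)) := by
    intro p c hc y hy hyU
    obtain ⟨hcs, hc3, hc4, hc5⟩ := (mem_submanifoldCharts_iff hA hB hc1 hc2).1 hc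
    have hce := hcs.isOpenEmbedding
    obtain ⟨α, hα, hαy⟩ := hA.exists_chart (π₁ y)
    obtain ⟨β, hβ, hβy⟩ := hB.exists_chart (π₂ y)
    have e1 := hcs.eventually_mem (hA.isStratumChart _ α hα) hc1 (fun _ _ h => h.1) hy hαy
    have e2 := hcs.eventually_mem (hB.isStratumChart _ β hβ) hc2 (fun _ _ h => h.2) hy hβy
    obtain ⟨f1, i1⟩ := hS₁ _ α hα _ hαy hyU.1
    obtain ⟨f2, i2⟩ := hS₂ _ β hβ _ hβy hyU.2
    have s1 := Chart.SmoothAt.comp hce (hA.emb hα) hy e1 f1 (hc3 _ α hα y hy hαy)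
    have s2 := Chart.SmoothAt.comp hce (hB.emb hβ) hy e2 f2 (hc4 _ β hβ y hy hβy)
    have d1 := Chart.fderiv_rep_comp hce (hA.emb hα) hy e1 f1 (hc3 _ α hα y hy hαy)
    have d2 := Chart.fderiv_rep_comp hce (hB.emb hβ) hy e2 f2 (hc4 _ β hβ y hy hβy)
    have hrep : c.rep F =ᶠ[𝓝 (c.map y)]
        fun e => Λ (c.rep (F₁ ∘ π₁) e, c.rep (F₂ ∘ π₂) e) := by
      rw [EventuallyEq, Chart.eventually_nhds hce hy]
      filter_upwards [self_mem_nhdsWithin] with z hz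
      rw [Chart.rep_map hce _ hz, Chart.rep_map hce _ hz, Chart.rep_map hce _ hz]
      rfl
    constructor
    · exact ((Λ : (E N₁ × E N₂) →L[ℝ] E (N₁ + N₂)).contDiff.contDiffAt.comp _
        (ContDiffAt.prodMk s1 s2)).congr_of_eventuallyEq hrep
    · have hd : HasFDerivAt (fun e => Λ (c.rep (F₁ ∘ π₁) e, c.rep (F₂ ∘ π₂) e)) _ (c.map y) :=
        (Λ : (E N₁ × E N₂) →L[ℝ] E (N₁ + N₂)).hasFDerivAt.comp (c.map y)
          (s1.differentiableAt.hasFDerivAt.prodMk s2.differentiableAt.hasFDerivAt)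
      rw [hrep.fderiv_eq, hd.fderiv, injective_iff_map_eq_zero]
      intro v hv
      have hv' := Λ.injective (hv.trans (map_zero Λ).symm)
      have v1 : fderiv ℝ (c.rep (F₁ ∘ π₁)) (c.map y) v = 0 := congrArg Prod.fst hv'
      have v2 : fderiv ℝ (c.rep (F₂ ∘ π₂)) (c.map y) v = 0 := congrArg Prod.snd hv'
      rw [d1] at v1
      rw [d2] at v2
      exact hc5 _ α hα _ β hβ y hy hαy hβy v (i1 (v1.trans (map_zero _).symm))
        (i2 (v2.trans (map_zero _).symm))
  refine ⟨U, N₁ + N₂, F, hU, ⟨hw₁, hw₂⟩, ?_, fun p c hc => ⟨?_, fun y hy =>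
    (key p c hc y hy.1 hy.2).2⟩⟩
  · have i2 : IsEmbedding (fun w : U => (π₁ w, π₂ w)) := hF.isEmbedding.comp IsEmbedding.subtypeVal
    have i1 : IsEmbedding (fun w : U => ((⟨π₁ w, w.2.1⟩, ⟨π₂ w, w.2.2⟩) : U₁ × U₂)) :=
      IsEmbedding.of_comp (by fun_prop)
        (IsEmbedding.subtypeVal.prodMap IsEmbedding.subtypeVal).continuous i2
    exact Λ.toHomeomorph.isEmbedding.comp ((hE₁.prodMap hE₂).comp i1)
  · exact (Chart.contDiffOn_iff hc.1.isOpenEmbedding fun z _ hz =>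
      mem_nhdsWithin_of_mem_nhds (hU.mem_nhds hz)).2 fun y hy hyU => (key p c hc y hy hyU).1

/-- A transverse fibre product is an s-manifold as soon as its dimension function and the closure relations
between its strata are as required. -/
theorem IsFibre.isSMan (hA : A.IsSMan) (hB : B.IsSMan) (hZ : Z.IsSMan)
    (hg : IsSmooth A Z g) (hh : IsSmooth B Z h) (hF : IsFibre A B Z g h π₁ π₂)
    (ht : ∀ w, TangentTransverse A B Z g h (π₁ w) (π₂ w)) {dim : W → ℤ}
    (hdr : ∀ w w', pairRel A B π₁ π₂ w w' → dim w = dim w') (hdc : IsLocallyConstant dim)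
    (hle : ∀ w, ((A.sdim (π₁ w) + B.sdim (π₂ w) - Z.sdim (g (π₁ w)) : ℕ) : ℤ) ≤ dim w)
    (hlo : ∀ w, (fibreSMan A B Z g π₁ π₂ dim).HasLocalOrder w) :
    (fibreSMan A B Z g π₁ π₂ dim).IsSMan := by
  have hc1 := hF.continuous_fst
  have hc2 := hF.continuous_snd
  have hsr : ∀ w w', pairRel A B π₁ π₂ w w' →
      A.sdim (π₁ w) + B.sdim (π₂ w) - Z.sdim (g (π₁ w)) =
        A.sdim (π₁ w') + B.sdim (π₂ w') - Z.sdim (g (π₁ w')) := by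
    intro w w' hr
    rw [hA.sdim_rel _ _ hr.1, hB.sdim_rel _ _ hr.2, hZ.sdim_rel _ _ (hg.map_rel _ _ hr.1)]
  have := hA.locallyCompact
  have := hB.locallyCompact
  have := hA.hausdorff
  have := hB.hausdorff
  have := hA.secondCountable
  have := hB.secondCountable
  refine
    { locallyCompact :=
        (IsClosedEmbedding.mk hF.isEmbedding hF.isClosed_range).locallyCompactSpace
      hausdorff := hF.isEmbedding.t2Space
      secondCountable := hF.isEmbedding.secondCountableTopology
      locallyClosed := ?_
      countable := ?_
      sdim_rel := hsr
      dim_rel := hdr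
      dim_locallyConstant := hdc
      sdim_le := hle
      isStratumChart := fun _ _ hc => hc.1
      exists_chart := fun w => hF.exists_submanifoldChart hA hB hZ hg hh w (ht w)
      compatible := ?_
      embeds := hF.embeds hA hB _
      localOrder := fun w => (hlo w).localOrder hsr }
  · rintro _ ⟨w, rfl⟩
    exact ((hA.locallyClosed _ (A.stratum_mem_strata (π₁ w))).preimage hc1).inter
      ((hB.locallyClosed _ (B.stratum_mem_strata (π₂ w))).preimage hc2)
  · refine ((hA.countable.prod hB.countable).image
      fun P => π₁ ⁻¹' P.1 ∩ π₂ ⁻¹' P.2).mono ?_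
    rintro _ ⟨w, rfl⟩
    exact ⟨(A.stratum (π₁ w), B.stratum (π₂ w)),
      ⟨A.stratum_mem_strata _, B.stratum_mem_strata _⟩, rfl⟩
  · intro p a ha b hb
    refine (ha.1.contDiffOn_iff hb.1 continuous_id (fun _ _ h => h)).2 fun w hwa hwb => ?_
    obtain ⟨-, ha1, ha2, -⟩ := (mem_submanifoldCharts_iff hA hB hc1 hc2).1 ha
    exact smoothAt_lift hA hB hc1 hc2 hb ha.1 continuous_id (fun _ _ h => h) hwa hwb
      (fun q α hα hα' => ha1 q α hα w hwa hα') (fun q β hβ hβ' => ha2 q β hβ w hwa hβ')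

end Fibre

/-! ### The fibre product of s-manifolds -/

section Pullback

variable {X Y Z : PreSMan.{u}} {g : X → Z} {h : Y → Z}

theorem isFibre_pullback (hZ : Z.IsSMan) (hg : IsSmooth X Z g) (hh : IsSmooth Y Z h) :
    IsFibre X Y Z g h (W := PreSMan.pullback X Y Z g h) (fun w => w.1.1) (fun w => w.1.2) where
  isEmbedding := IsEmbedding.subtypeVal
  comm w := w.2
  isClosed_range := by
    have := hZ.hausdorff
    have hcl : IsClosed {w : X × Y | g w.1 = h w.2} :=
      isClosed_eq (hg.continuous.comp continuous_fst) (hh.continuous.comp continuous_snd)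
    have e : (range fun w : PreSMan.pullback X Y Z g h => (w.1.1, w.1.2)) =
        {w : X × Y | g w.1 = h w.2} := by
      ext p
      exact ⟨fun ⟨w, hw⟩ => hw ▸ w.2, fun hp => ⟨⟨p, hp⟩, rfl⟩⟩
    rw [e]
    exact hcl
  exists_open := ⟨univ, isOpen_univ, fun _ => trivial, fun x y _ hxy => ⟨⟨(x, y), hxy⟩, rfl, rfl⟩⟩

theorem IsTransverseSMan.tangentTransverse (ht : IsTransverseSMan X Y Z g h) {x : X} {y : Y}
    (hxy : g x = h y) : TangentTransverse X Y Z g h x y := (ht x y hxy).1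

/-- The order on strata of the fibre product is the product order. The codimensions `a`, `b`, `c` of the
strata in `X`, `Y`, `Z` give codimension `a + b - c` in the fibre product, and transversality leaves only
`(0,0,0)`, `(1,0,0)`, `(0,1,0)`, `(1,1,1)` and codimension at least `2`. -/
theorem hasLocalOrder_pullback (hX : X.IsSMan) (hY : Y.IsSMan) (hZ : Z.IsSMan)
    (hg : IsSmooth X Z g) (hh : IsSmooth Y Z h) (ht : IsTransverseSMan X Y Z g h)
    (w : PreSMan.pullback X Y Z g h) : (PreSMan.pullback X Y Z g h).HasLocalOrder w := by
  obtain ⟨V₁, le₁, hV₁, hw₁, hd₁, hf₁, hr₁, a₁, b₁, c₁, e₁, m₁⟩ := hX.hasLocalOrder w.1.1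
  obtain ⟨V₂, le₂, hV₂, hw₂, hd₂, hf₂, hr₂, a₂, b₂, c₂, e₂, m₂⟩ := hY.hasLocalOrder w.1.2
  have hF := isFibre_pullback hZ hg hh
  have hzc : IsOpen {z : Z | Z.dim z = Z.dim (g w.1.1)} :=
    hZ.dim_locallyConstant.isOpen_fiber _
  let W := PreSMan.pullback X Y Z g h
  refine ⟨{s : W | s.1.1 ∈ V₁ ∧ s.1.2 ∈ V₂ ∧ Z.dim (g s.1.1) = Z.dim (g w.1.1)},
    fun s t => le₁ s.1.1 t.1.1 ∧ le₂ s.1.2 t.1.2, ?_, ⟨hw₁, hw₂, rfl⟩, ?_, ?_, ?_, ?_, ?_, ?_, ?_, ?_⟩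
  · exact (hV₁.preimage hF.continuous_fst).inter ((hV₂.preimage hF.continuous_snd).inter
      (hzc.preimage (hg.continuous.comp hF.continuous_fst)))
  · intro s hs
    change X.dim s.1.1 + Y.dim s.1.2 - Z.dim (g s.1.1) =
      X.dim w.1.1 + Y.dim w.1.2 - Z.dim (g w.1.1)
    rw [hd₁ _ hs.1, hd₂ _ hs.2.1, hs.2.2]
  · refine ((hf₁.prod hf₂).image fun P : Set X × Set Y =>
      {s : W | s.1.1 ∈ P.1 ∧ s.1.2 ∈ P.2}).subset ?_
    rintro _ ⟨s, hs, rfl⟩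
    exact ⟨(X.stratum s.1.1, Y.stratum s.1.2),
      ⟨mem_image_of_mem _ hs.1, mem_image_of_mem _ hs.2.1⟩, rfl⟩
  · exact fun s s' t t' hs hT hst =>
      ⟨hr₁ _ _ _ _ hs.1 hT.1 hst.1, hr₂ _ _ _ _ hs.2 hT.2 hst.2⟩
  · exact fun s hs => ⟨a₁ _ hs.1, a₂ _ hs.2.1⟩
  · exact fun s hs t hT hst hts =>
      ⟨b₁ _ hs.1 _ hT.1 hst.1 hts.1, b₂ _ hs.2.1 _ hT.2.1 hst.2 hts.2⟩
  · exact fun s hs t hT r hr hst htr => ⟨c₁ _ hs.1 _ hT.1 _ hr.1 hst.1 htr.1,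
      c₂ _ hs.2.1 _ hT.2.1 _ hr.2.1 hst.2 htr.2⟩
  · intro s hs t hT hcl
    exact ⟨e₁ _ hs.1 _ hT.1
        (map_mem_closure (f := fun r : W => r.1.1) hF.continuous_fst hcl
          fun r hr => ⟨hr.1.1, hr.2.1⟩),
      e₂ _ hs.2.1 _ hT.2.1
        (map_mem_closure (f := fun r : W => r.1.2) hF.continuous_snd hcl
          fun r hr => ⟨hr.1.2.1, hr.2.2⟩)⟩
  · intro s hs t hT hne hle
    have ts := (ht s.1.1 s.1.2 s.2).2
    have tt := (ht t.1.1 t.1.2 t.2).2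
    have ns := (ht.tangentTransverse s.2).sdim_le hX hY hZ
    have nt := (ht.tangentTransverse t.2).sdim_le hX hY hZ
    have ls1 := hX.sdim_le s.1.1
    have ls2 := hY.sdim_le s.1.2
    have ls3 := hZ.sdim_le (g s.1.1)
    have lt1 := hX.sdim_le t.1.1
    have lt2 := hY.sdim_le t.1.2
    have lt3 := hZ.sdim_le (g t.1.1)
    rw [hd₁ _ hs.1, hd₂ _ hs.2.1, hs.2.2] at ts
    rw [hd₁ _ hT.1, hd₂ _ hT.2.1, hT.2.2] at tt
    rw [hd₁ _ hs.1] at ls1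
    rw [hd₁ _ hT.1] at lt1
    rw [hd₂ _ hs.2.1] at ls2
    rw [hd₂ _ hT.2.1] at lt2
    rw [hs.2.2] at ls3
    rw [hT.2.2] at lt3
    have k1 : (X.sdim s.1.1 = X.sdim t.1.1 ∧ Z.sdim (g s.1.1) = Z.sdim (g t.1.1)) ∨ _ :=
      (em (X.rel s.1.1 t.1.1)).imp
        (fun hr => ⟨hX.sdim_rel _ _ hr, hZ.sdim_rel _ _ (hg.map_rel _ _ hr)⟩)
        (fun hr => m₁ _ hs.1 _ hT.1 hr hle.1)
    have k2 : (Y.sdim s.1.2 = Y.sdim t.1.2 ∧ Z.sdim (g s.1.1) = Z.sdim (g t.1.1)) ∨ _ :=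
      (em (Y.rel s.1.2 t.1.2)).imp
        (fun hr => ⟨hY.sdim_rel _ _ hr, by
          rw [s.2, t.2]; exact hZ.sdim_rel _ _ (hh.map_rel _ _ hr)⟩)
        (fun hr => m₂ _ hs.2.1 _ hT.2.1 hr hle.2)
    have k3 : (((X.sdim s.1.1 : ℤ) = X.dim w.1.1 - 1 ∨ (X.sdim s.1.1 : ℤ) = X.dim w.1.1) ∧
        X.sdim t.1.1 < X.sdim s.1.1 ∨
        (X.sdim s.1.1 : ℤ) ≤ X.dim w.1.1 - 2 ∧ (X.sdim t.1.1 : ℤ) ≤ X.dim w.1.1 - 2) ∨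
        (((Y.sdim s.1.2 : ℤ) = Y.dim w.1.2 - 1 ∨ (Y.sdim s.1.2 : ℤ) = Y.dim w.1.2) ∧
        Y.sdim t.1.2 < Y.sdim s.1.2 ∨
        (Y.sdim s.1.2 : ℤ) ≤ Y.dim w.1.2 - 2 ∧ (Y.sdim t.1.2 : ℤ) ≤ Y.dim w.1.2 - 2) := by
      by_cases hr : X.rel s.1.1 t.1.1
      · exact Or.inr (m₂ _ hs.2.1 _ hT.2.1 (fun hr2 => hne ⟨hr, hr2⟩) hle.2)
      · exact Or.inl (m₁ _ hs.1 _ hT.1 hr hle.1)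
    change (((X.sdim s.1.1 + Y.sdim s.1.2 - Z.sdim (g s.1.1) : ℕ) : ℤ) =
          X.dim w.1.1 + Y.dim w.1.2 - Z.dim (g w.1.1) - 1 ∨
        ((X.sdim s.1.1 + Y.sdim s.1.2 - Z.sdim (g s.1.1) : ℕ) : ℤ) =
          X.dim w.1.1 + Y.dim w.1.2 - Z.dim (g w.1.1)) ∧
        X.sdim t.1.1 + Y.sdim t.1.2 - Z.sdim (g t.1.1) <
          X.sdim s.1.1 + Y.sdim s.1.2 - Z.sdim (g s.1.1) ∨
      ((X.sdim s.1.1 + Y.sdim s.1.2 - Z.sdim (g s.1.1) : ℕ) : ℤ) ≤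
          X.dim w.1.1 + Y.dim w.1.2 - Z.dim (g w.1.1) - 2 ∧
        ((X.sdim t.1.1 + Y.sdim t.1.2 - Z.sdim (g t.1.1) : ℕ) : ℤ) ≤
          X.dim w.1.1 + Y.dim w.1.2 - Z.dim (g w.1.1) - 2
    generalize X.sdim s.1.1 = xs at *
    generalize X.sdim t.1.1 = xt at *
    generalize Y.sdim s.1.2 = ys at *
    generalize Y.sdim t.1.2 = yt at *
    generalize Z.sdim (g s.1.1) = zs at *
    generalize Z.sdim (g t.1.1) = zt at *
    generalize X.dim w.1.1 = l at *
    generalize Y.dim w.1.2 = m at *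
    generalize Z.dim (g w.1.1) = n at *
    clear hne hle hr₁ a₁ b₁ c₁ e₁ m₁ hr₂ a₂ b₂ c₂ e₂ m₂ hF hs hT hd₁ hd₂ hzc
    rcases ts with ts | ts | ts | ts | ts <;> rcases tt with tt | tt | tt | tt | tt <;>
      rcases k1 with k1 | k1 <;> omega

theorem isSMan_pullback (hX : X.IsSMan) (hY : Y.IsSMan) (hZ : Z.IsSMan)
    (hg : IsSmooth X Z g) (hh : IsSmooth Y Z h) (ht : IsTransverseSMan X Y Z g h) :
    (PreSMan.pullback X Y Z g h).IsSMan := by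
  have hF := isFibre_pullback hZ hg hh
  refine hF.isSMan hX hY hZ hg hh (fun w => ht.tangentTransverse w.2) ?_ ?_ ?_
    (hasLocalOrder_pullback hX hY hZ hg hh ht)
  · intro w w' hr
    rw [hX.dim_rel _ _ hr.1, hY.dim_rel _ _ hr.2, hZ.dim_rel _ _ (hg.map_rel _ _ hr.1)]
  · exact ((hX.dim_locallyConstant.comp_continuous hF.continuous_fst).add
      (hY.dim_locallyConstant.comp_continuous hF.continuous_snd)).sub
      (hZ.dim_locallyConstant.comp_continuous (hg.continuous.comp hF.continuous_fst))
  · intro w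
    have ns := (ht.tangentTransverse w.2).sdim_le hX hY hZ
    have t := (ht _ _ w.2).2
    push_cast [ns]
    omega

theorem smooth_pullback_fst (hX : X.IsSMan) (hY : Y.IsSMan) (hZ : Z.IsSMan)
    (hg : IsSmooth X Z g) (hh : IsSmooth Y Z h) :
    IsSmooth (PreSMan.pullback X Y Z g h) X (fun w => w.1.1) :=
  (isFibre_pullback hZ hg hh).smooth_fst hX hY _

theorem smooth_pullback_snd (hX : X.IsSMan) (hY : Y.IsSMan) (hZ : Z.IsSMan)
    (hg : IsSmooth X Z g) (hh : IsSmooth Y Z h) :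
    IsSmooth (PreSMan.pullback X Y Z g h) Y (fun w => w.1.2) :=
  (isFibre_pullback hZ hg hh).smooth_snd hX hY _

theorem smooth_pullback_lift (hX : X.IsSMan) (hY : Y.IsSMan) (hZ : Z.IsSMan)
    (hg : IsSmooth X Z g) (hh : IsSmooth Y Z h) {T : PreSMan.{u}} (hT : T.IsSMan)
    {φ : T → PreSMan.pullback X Y Z g h} (h1 : IsSmooth T X (fun t => (φ t).1.1))
    (h2 : IsSmooth T Y (fun t => (φ t).1.2)) : IsSmooth T (PreSMan.pullback X Y Z g h) φ :=
  (isFibre_pullback hZ hg hh).smooth_lift hX hY _ hT h1 h2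

end Pullback

/-! ### Topological preliminaries -/

section Topology

variable {X Y : Type*} [TopologicalSpace X] [TopologicalSpace Y]

/-- A locally injective continuous map from a locally compact space to a Hausdorff space is locally an
embedding with locally closed image. -/
theorem exists_isEmbedding_isLocallyClosed [LocallyCompactSpace X] [T2Space Y] {f : X → Y}
    (hf : Continuous f) (x : X) (hinj : ∃ U ∈ 𝓝 x, InjOn f U) :
    ∃ V : Set X, IsOpen V ∧ x ∈ V ∧ IsEmbedding (fun v : V => f v) ∧ IsLocallyClosed (f '' V) := by
  obtain ⟨U, hU, hinj⟩ := hinj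
  obtain ⟨K, hK, hKU, hKc⟩ := local_compact_nhds hU
  have hKi := hinj.mono hKU
  have : CompactSpace K := isCompact_iff_compactSpace.1 hKc
  have hemb : IsClosedEmbedding (fun v : K => f v) :=
    (hf.comp continuous_subtype_val).isClosedEmbedding (injOn_iff_injective.1 hKi)
  refine ⟨interior K, isOpen_interior, mem_interior_iff_mem_nhds.2 hK,
    hemb.isEmbedding.comp (IsEmbedding.inclusion interior_subset), ?_⟩
  have e : f '' interior K = f '' K ∩ (f '' (K \ interior K))ᶜ := by
    ext y
    constructor
    · rintro ⟨v, hv, rfl⟩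
      refine ⟨mem_image_of_mem _ (interior_subset hv), ?_⟩
      rintro ⟨v', ⟨hv', hn⟩, he⟩
      exact hn (hKi hv' (interior_subset hv) he ▸ hv)
    · rintro ⟨⟨v, hv, rfl⟩, hn⟩
      by_contra h
      exact hn ⟨v, ⟨hv, fun hi => h (mem_image_of_mem _ hi)⟩, rfl⟩
  rw [e]
  exact (hKc.image hf).isClosed.isLocallyClosed.inter
    ((hKc.diff isOpen_interior).image hf).isClosed.isOpen_compl.isLocallyClosed

theorem isLocalHomeomorph_of_locally_injective {f : X → Y} (hf : Continuous f)
    (hinj : ∀ x, ∃ U ∈ 𝓝 x, InjOn f U) (ho : ∀ x, 𝓝 (f x) ≤ map f (𝓝 x)) :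
    IsLocalHomeomorph f := by
  have ho' : IsOpenMap f := isOpenMap_iff_nhds_le.2 ho
  rw [isLocalHomeomorph_iff_isOpenEmbedding_restrict]
  intro x
  obtain ⟨U, hU, hi⟩ := hinj x
  obtain ⟨V, hVU, hV, hxV⟩ := mem_nhds_iff.1 hU
  exact ⟨V, hV.mem_nhds hxV, .of_continuous_injective_isOpenMap
    (hf.comp continuous_subtype_val) (injOn_iff_injective.1 (hi.mono hVU)) (ho'.domRestrict hV)⟩

theorem IsLocalHomeomorph.exists_injOn {f : X → Y} (hf : IsLocalHomeomorph f) (x : X) :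
    ∃ U ∈ 𝓝 x, InjOn f U := by
  obtain ⟨U, hU, h⟩ := isLocalHomeomorph_iff_isOpenEmbedding_restrict.1 hf x
  exact ⟨U, hU, injOn_iff_injective.2 h.injective⟩

theorem isProperMap_imageFactorization {f : X → Y} {S : Set X}
    (h : IsEmbedding (fun u : S => f u)) :
    IsProperMap (fun u : S => (⟨f u, mem_image_of_mem f u.2⟩ : f '' S)) := by
  have h1 : IsEmbedding (fun u : S => (⟨f u, mem_image_of_mem f u.2⟩ : f '' S)) :=
    IsEmbedding.of_comp (h.continuous.subtype_mk _) continuous_subtype_val h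
  refine IsClosedEmbedding.isProperMap ⟨h1, ?_⟩
  rw [show (range fun u : S => (⟨f u, mem_image_of_mem f u.2⟩ : f '' S)) = univ from
    eq_univ_of_forall fun ⟨_, u, hu, e⟩ => ⟨⟨u, hu⟩, Subtype.ext e⟩]
  exact isClosed_univ

theorem bijective_of_injective_of_eq {p q : ℕ} (hpq : p = q) {f : E p →L[ℝ] E q}
    (hf : ∀ v, f v = 0 → v = 0) : Function.Bijective f := by
  subst hpq
  have h1 : Function.Injective f := (injective_iff_map_eq_zero f).2 hf
  exact ⟨h1, LinearMap.injective_iff_surjective (f := f.toLinearMap).1 h1⟩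

end Topology

/-! ### The strata and the fibres of the corners of an s-manifold with corners -/

namespace PreSManC.IsSManC

variable {M : PreSManC.{u}}

/-- The projection is injective on each stratum of `C(X)`: as `D` is a union of fibre products of strata
and contains the diagonal, it contains all pairs of points of one stratum in one fibre. -/
theorem eq_of_rel (hM : M.IsSManC) {u u' : M.C} (hr : M.C.rel u u')
    (hp : M.proj u = M.proj u') : u = u' := by
  have hD : (u, u') ∈ M.D := hM.D_strata u u u u' (hM.D_refl u) (M.C.rel.refl' u) hr hp
  refine hM.D_level u u' hD ?_
  rw [codim, codim, hp, hM.corners_isSMan.dim_rel _ _ hr]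

theorem sdim_proj (hM : M.IsSManC) (u : M.C) : M.X.sdim (M.proj u) = M.C.sdim u := by
  obtain ⟨a, ha, hau⟩ := hM.corners_isSMan.exists_chart u
  obtain ⟨b, hb, hbu⟩ := hM.isSMan.exists_chart (M.proj u)
  have := (hM.proj_covering _ (M.C.stratum_mem_strata u)).2.2 u (M.C.mem_stratum_self u) _ _ a ha b
    hb hau hbu
  have e := LinearEquiv.finrank_eq (LinearEquiv.ofBijective (tangentMap M.proj a b u).toLinearMap this)
  simpa using e.symm

theorem tangentMap_proj_bijective (hM : M.IsSManC) {p q : ℕ} {a : Chart M.C p}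
    (ha : a ∈ M.C.charts p) {b : Chart M.X q} (hb : b ∈ M.X.charts q) {u : M.C} (hu : u ∈ a.source)
    (hu' : M.proj u ∈ b.source) : Function.Bijective (tangentMap M.proj a b u) :=
  (hM.proj_covering _ (M.C.stratum_mem_strata u)).2.2 u (M.C.mem_stratum_self u) _ _ a ha b hb hu hu'

theorem exists_of_rel_proj (hM : M.IsSManC) {u : M.C} {x : M.X} (hx : M.X.rel (M.proj u) x) :
    ∃ u', M.C.rel u u' ∧ M.proj u' = x := by
  have h := (hM.proj_covering _ (M.C.stratum_mem_strata u)).1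
  rw [PreSMan.strata_eq_range] at h
  obtain ⟨y, hy⟩ := h
  have h1 : M.proj u ∈ M.X.stratum y := hy ▸ mem_image_of_mem _ (M.C.mem_stratum_self u)
  have h2 : x ∈ M.X.stratum y := M.X.rel.trans' (M.X.rel.symm' hx) h1
  rw [hy] at h2
  obtain ⟨u', hu', rfl⟩ := h2
  exact ⟨u', M.C.rel.symm' hu', rfl⟩

theorem isEmbedding_proj_stratum (hM : M.IsSManC) (u₀ : M.C) :
    IsEmbedding (fun u : M.C.stratum u₀ => M.proj u) := by
  have h := (hM.proj_covering _ (M.C.stratum_mem_strata u₀)).2.1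
  have hinj : Function.Injective (fun u : M.C.stratum u₀ =>
      (⟨M.proj u, mem_image_of_mem M.proj u.2⟩ : M.proj '' M.C.stratum u₀)) := fun u u' he =>
    Subtype.ext (hM.eq_of_rel (M.C.rel.trans' u.2 (M.C.rel.symm' u'.2)) (congrArg Subtype.val he))
  exact IsEmbedding.subtypeVal.comp
    (IsClosedEmbedding.of_continuous_injective_isClosedMap h.continuous hinj h.isClosedMap).isEmbedding

theorem exists_nhds_stratum (hM : M.IsSManC) {u₀ : M.C} {U : Set M.C} (hU : U ∈ 𝓝 u₀) :
    ∃ O ∈ 𝓝 (M.proj u₀), ∀ u, M.C.rel u u₀ → M.proj u ∈ O → u ∈ U := by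
  have h := (hM.isEmbedding_proj_stratum u₀).isInducing.nhds_eq_comap ⟨u₀, M.C.mem_stratum_self u₀⟩
  have h2 : (Subtype.val : M.C.stratum u₀ → M.C) ⁻¹' U ∈ 𝓝 ⟨u₀, M.C.mem_stratum_self u₀⟩ :=
    continuous_subtype_val.continuousAt.preimage_mem_nhds hU
  rw [h, Filter.mem_comap] at h2
  obtain ⟨O, hO, hOU⟩ := h2
  exact ⟨O, hO, fun u hu hp => @hOU ⟨u, hu⟩ hp⟩

theorem codim_rel (hM : M.IsSManC) {u u' : M.C} (hr : M.C.rel u u') : M.codim u = M.codim u' := by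
  rw [codim, codim, hM.corners_isSMan.dim_rel _ _ hr,
    hM.isSMan.dim_rel _ _ (hM.proj_smooth.map_rel _ _ hr)]

theorem isLocallyConstant_codim (hM : M.IsSManC) : IsLocallyConstant M.codim :=
  (hM.isSMan.dim_locallyConstant.comp_continuous hM.proj_smooth.continuous).sub
    hM.corners_isSMan.dim_locallyConstant

theorem lub_unique (hM : M.IsSManC) {S : Set M.C} {u v : M.C} (hu : M.IsLub S u)
    (hv : M.IsLub S v) : u = v :=
  hM.D_antisymm _ _ (hu.2 v hv.1) (hv.2 u hu.1)

theorem glb_unique (hM : M.IsSManC) {S : Set M.C} {u v : M.C} (hu : M.IsGlb S u)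
    (hv : M.IsGlb S v) : u = v :=
  hM.D_antisymm _ _ (hv.2 u hu.1) (hu.2 v hv.1)

/-- The element of `C_0(X)` is the least element of its fibre. -/
theorem mem_D_of_codim_zero (hM : M.IsSManC) {u v : M.C} (hu : M.codim u = 0)
    (hp : M.proj u = M.proj v) : (u, v) ∈ M.D := by
  obtain ⟨b, hb, -⟩ := hM.exists_glb (M.proj v) {u, v} ⟨u, by simp⟩ (by
    rintro w (rfl | rfl)
    · exact hp
    · rfl)
  have h1 := hb u (by simp)
  have h2 : M.codim b ≤ M.codim u := hM.D_codim _ h1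
  have h3 := hM.codim_nonneg b
  have : b = u := hM.D_level _ _ h1 (by omega)
  exact this ▸ hb v (by simp)

theorem eq_of_codim_zero (hM : M.IsSManC) {u v : M.C} (hu : M.codim u = 0) (hv : M.codim v = 0)
    (hp : M.proj u = M.proj v) : u = v :=
  hM.D_level _ _ (hM.mem_D_of_codim_zero hu hp) (by rw [hu, hv])

theorem mem_interior_iff (hM : M.IsSManC) {u : M.C} :
    u ∈ M.interior ↔ ∀ v, (u, v) ∈ M.D → v = u := by
  constructor
  · intro hu v hv
    have := hM.D_codim _ hv
    by_contra hne
    refine hu ⟨v, hv, lt_of_le_of_ne this fun he => hne (hM.D_level _ _ hv he).symm⟩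
  · rintro h ⟨v, hv, hlt⟩
    rw [h v hv] at hlt
    exact lt_irrefl _ hlt

/-- The interior `C(X)°` consists of the greatest elements of the fibres. -/
theorem mem_D_of_mem_interior (hM : M.IsSManC) {u v : M.C} (hu : u ∈ M.interior)
    (hp : M.proj u = M.proj v) : (v, u) ∈ M.D := by
  obtain ⟨b, hb, -⟩ := hM.exists_lub (M.proj v) {u, v} ⟨u, by simp⟩ (by
    rintro w (rfl | rfl)
    · exact hp
    · rfl)
  have h1 := hM.mem_interior_iff.1 hu b (hb u (by simp))
  exact h1 ▸ hb v (by simp)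

theorem exists_mem_interior (hM : M.IsSManC) (u : M.C) : ∃ v ∈ M.interior, (u, v) ∈ M.D := by
  obtain ⟨b, hb, -⟩ := hM.exists_lub (M.proj u) (M.proj ⁻¹' {M.proj u}) ⟨u, rfl⟩ subset_rfl
  refine ⟨b, hM.mem_interior_iff.2 fun v hv => ?_, hb u rfl⟩
  have h1 : M.proj v = M.proj u := by
    rw [← M.D_proj _ hv, ← M.D_proj _ (hb u rfl)]
  exact hM.D_antisymm _ _ (hb v h1) hv

/-! ### The s-manifold `D(X)` -/

/-- `D(X)` is a part of the fibre product `C(X) ×_X C(X)`: it is closed, and open in the fibre product. -/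
theorem isFibre_D (hM : M.IsSManC) :
    IsFibre M.C M.C M.X M.proj M.proj (W := M.D) (fun p => p.1.1) (fun p => p.1.2) where
  isEmbedding := IsEmbedding.subtypeVal
  comm p := M.D_proj _ p.2
  isClosed_range := by
    have := hM.isSMan.hausdorff
    have hcl : IsClosed {p : M.C × M.C | M.proj p.1 = M.proj p.2} :=
      isClosed_eq (hM.proj_smooth.continuous.comp continuous_fst)
        (hM.proj_smooth.continuous.comp continuous_snd)
    have h1 := hcl.isClosedEmbedding_subtypeVal.isClosedMap _ hM.D_clopen.1
    convert! h1 using 1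
    ext p
    constructor
    · rintro ⟨w, rfl⟩
      exact ⟨⟨w.1, M.D_proj _ w.2⟩, w.2, rfl⟩
    · rintro ⟨w, hw, rfl⟩
      exact ⟨⟨w.1, hw⟩, rfl⟩
  exists_open := by
    obtain ⟨O, hO, he⟩ := isOpen_induced_iff.1 hM.D_clopen.2
    refine ⟨O, hO, fun w => ?_, fun u v huv hp => ?_⟩
    · have : (⟨w.1, M.D_proj _ w.2⟩ : {p : M.C × M.C // M.proj p.1 = M.proj p.2}) ∈
        {p : {p : M.C × M.C // M.proj p.1 = M.proj p.2} | p.1 ∈ M.D} := w.2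
      rw [← he] at this
      exact this
    · have : (⟨(u, v), hp⟩ : {p : M.C × M.C // M.proj p.1 = M.proj p.2}) ∈ Subtype.val ⁻¹' O := huv
      rw [he] at this
      exact ⟨⟨(u, v), this⟩, rfl, rfl⟩

theorem tangentTransverse_proj (hM : M.IsSManC) (u v : M.C) :
    TangentTransverse M.C M.C M.X M.proj M.proj u v := by
  intro p q r a ha b hb c hc hu hv hx t
  obtain ⟨w, hw⟩ := (hM.tangentMap_proj_bijective ha hc hu hx).2 t
  exact ⟨w, 0, by rw [hw, map_zero, add_zero]⟩

theorem sdim_D (hM : M.IsSManC) (p : M.DSMan) : M.DSMan.sdim p = M.C.sdim p.1.2 := by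
  change M.C.sdim p.1.1 + M.C.sdim p.1.2 - M.X.sdim (M.proj p.1.1) = _
  rw [hM.sdim_proj]
  omega

/-- A stratum of `D(X)` is locally the whole preimage of the stratum of `C(X)` to which it is mapped by the
second projection, because this projection is locally injective and each stratum of `D(X)` is mapped
homeomorphically to a stratum of `C(X)`. -/
theorem eventually_rel_fst (hM : M.IsSManC) (p : M.D) :
    ∀ᶠ p' : M.D in 𝓝 p, M.C.rel p'.1.2 p.1.2 → M.C.rel p'.1.1 p.1.1 := by
  obtain ⟨N, hN, hinj⟩ := IsLocalHomeomorph.exists_injOn hM.D_localHomeomorph p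
  have hN₀ := hN
  rw [nhds_subtype_eq_comap, nhds_prod_eq] at hN₀
  obtain ⟨N', hN', hN'N⟩ := Filter.mem_comap.1 hN₀
  obtain ⟨U₁, hU₁, U₂, hU₂, hU⟩ := Filter.mem_prod_iff.1 hN'
  obtain ⟨O, hO, hOU⟩ := hM.exists_nhds_stratum hU₁
  have hc2 : Continuous (fun p : M.D => p.1.2) := by fun_prop
  rw [M.D_proj _ p.2] at hO
  filter_upwards [hN, hc2.continuousAt.preimage_mem_nhds hU₂, (hM.proj_smooth.continuous.comp
      hc2).continuousAt.preimage_mem_nhds hO] with p' h1 h2 h3 hr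
  have hr' : M.X.rel (M.proj p.1.1) (M.proj p'.1.2) := by
    rw [M.D_proj _ p.2]
    exact hM.proj_smooth.map_rel _ _ (M.C.rel.symm' hr)
  obtain ⟨u, hu, hup⟩ := hM.exists_of_rel_proj hr'
  have hD : (u, p'.1.2) ∈ M.D := hM.D_strata _ _ _ _ p.2 hu (M.C.rel.symm' hr) hup
  have huU : u ∈ U₁ := hOU u (M.C.rel.symm' hu) (by rw [hup]; exact h3)
  have hmem : (⟨(u, p'.1.2), hD⟩ : M.D) ∈ N := hN'N (hU ⟨huU, h2⟩)
  have := hinj hmem h1 rfl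
  rw [← this]
  exact M.C.rel.symm' hu

/-- The strata of `D(X)` are ordered as the strata of `C(X)` containing their second components. As
different strata of `D(X)` may lie over one stratum of `C(X)`, these are declared incomparable. -/
theorem hasLocalOrder_D (hM : M.IsSManC) (p : M.DSMan) : M.DSMan.HasLocalOrder p := by
  obtain ⟨V₁, -, hV₁, hw₁, -, hf₁, -⟩ := hM.corners_isSMan.hasLocalOrder p.1.1
  obtain ⟨V₂, le, hV₂, hw₂, hd, hf₂, hr, a, b, c, e, m⟩ := hM.corners_isSMan.hasLocalOrder p.1.2
  have hF := hM.isFibre_D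
  refine ⟨{s : M.D | s.1.1 ∈ V₁ ∧ s.1.2 ∈ V₂},
    fun s t : M.D => le s.1.2 t.1.2 ∧ (M.C.rel s.1.2 t.1.2 → M.C.rel s.1.1 t.1.1),
    (hV₁.preimage hF.continuous_fst).inter (hV₂.preimage hF.continuous_snd), ⟨hw₁, hw₂⟩,
    fun s hs => hd _ hs.2, ?_, ?_, ?_, ?_, ?_, ?_, ?_⟩
  · refine ((hf₁.prod hf₂).image fun P : Set M.C × Set M.C =>
      {s : M.D | s.1.1 ∈ P.1 ∧ s.1.2 ∈ P.2}).subset ?_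
    rintro _ ⟨s, hs, rfl⟩
    exact ⟨(M.C.stratum s.1.1, M.C.stratum s.1.2),
      ⟨mem_image_of_mem _ hs.1, mem_image_of_mem _ hs.2⟩, rfl⟩
  · intro s s' t t' hs ht hst
    refine ⟨hr _ _ _ _ hs.2 ht.2 hst.1, fun hr' => ?_⟩
    have h2 := hst.2 (M.C.rel.trans' (M.C.rel.trans' hs.2 hr') (M.C.rel.symm' ht.2))
    exact M.C.rel.trans' (M.C.rel.trans' (M.C.rel.symm' hs.1) h2) ht.1
  · exact fun s hs => ⟨a _ hs.2, fun _ => M.C.rel.refl' _⟩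
  · intro s hs t ht hst hts
    have h2 := b _ hs.2 _ ht.2 hst.1 hts.1
    exact ⟨hst.2 h2, h2⟩
  · intro s hs t ht r hr' hst htr
    refine ⟨c _ hs.2 _ ht.2 _ hr'.2 hst.1 htr.1, fun hsr => ?_⟩
    have h1 := hr _ _ _ _ (M.C.rel.refl' s.1.2) (M.C.rel.symm' hsr)
      (c _ hs.2 _ ht.2 _ hr'.2 hst.1 htr.1)
    have h2 : M.C.rel s.1.2 t.1.2 :=
      b _ hs.2 _ ht.2 hst.1 (hr _ _ _ _ (M.C.rel.refl' _) (M.C.rel.symm' hsr) htr.1)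
    exact M.C.rel.trans' (hst.2 h2) (htr.2 (M.C.rel.trans' (M.C.rel.symm' h2) hsr))
  · intro s hs t ht hcl
    refine ⟨e _ hs.2 _ ht.2 (map_mem_closure (f := fun r : M.D => r.1.2) hF.continuous_snd hcl
      fun r hr => ⟨hr.1.2, hr.2.2⟩), fun hst => ?_⟩
    have hev : ∃ᶠ r : M.D in 𝓝 t, r ∈ {s : M.D | s.1.1 ∈ V₁ ∧ s.1.2 ∈ V₂} ∩ M.DSMan.stratum s :=
      mem_closure_iff_frequently.1 hcl
    obtain ⟨r, hr1, hr2⟩ := (hev.and_eventually (hM.eventually_rel_fst t)).exists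
    exact M.C.rel.trans' (M.C.rel.symm' hr1.2.1) (hr2 (M.C.rel.trans' hr1.2.2 hst))
  · intro s hs t ht hne hle
    have h2 : ¬ M.C.rel s.1.2 t.1.2 := fun h2 => hne ⟨hle.2 h2, h2⟩
    have := m _ hs.2 _ ht.2 h2 hle.1
    rw [hM.sdim_D, hM.sdim_D]
    exact this

theorem isSMan_D (hM : M.IsSManC) : M.DSMan.IsSMan := by
  have hF := hM.isFibre_D
  have hC := hM.corners_isSMan
  refine hF.isSMan hC hC hM.isSMan hM.proj_smooth hM.proj_smooth
    (fun _ => hM.tangentTransverse_proj _ _) ?_ ?_ ?_ hM.hasLocalOrder_D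
  · exact fun w w' hr => hC.dim_rel _ _ hr.2
  · exact hC.dim_locallyConstant.comp_continuous hF.continuous_snd
  · intro p
    have h1 := hM.sdim_D p
    have h2 := hC.sdim_le p.1.2
    change M.C.sdim p.1.1 + M.C.sdim p.1.2 - M.X.sdim (M.proj p.1.1) = _ at h1
    rw [h1]
    exact h2

theorem smooth_D_fst (hM : M.IsSManC) : IsSmooth M.DSMan M.C (fun p => p.1.1) :=
  hM.isFibre_D.smooth_fst hM.corners_isSMan hM.corners_isSMan _

theorem smooth_D_snd (hM : M.IsSManC) : IsSmooth M.DSMan M.C (fun p => p.1.2) :=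
  hM.isFibre_D.smooth_snd hM.corners_isSMan hM.corners_isSMan _

theorem smooth_D_lift (hM : M.IsSManC) {T : PreSMan.{u}} (hT : T.IsSMan) {φ : T → M.DSMan}
    (h1 : IsSmooth T M.C (fun t => (φ t).1.1)) (h2 : IsSmooth T M.C (fun t => (φ t).1.2)) :
    IsSmooth T M.DSMan φ :=
  hM.isFibre_D.smooth_lift hM.corners_isSMan hM.corners_isSMan _ hT h1 h2

/-- A tangent vector of `D(X)` is determined by either of its components. -/
theorem tangentMap_D_eq_zero_iff (hM : M.IsSManC) {p q r : ℕ} {a : Chart M.DSMan p}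
    (ha : a ∈ M.DSMan.charts p) {b : Chart M.C q} (hb : b ∈ M.C.charts q) {c : Chart M.C r}
    (hc : c ∈ M.C.charts r) {w : M.DSMan} (hw : w ∈ a.source) (hwb : w.1.1 ∈ b.source)
    (hwc : w.1.2 ∈ c.source) (v : E p) :
    tangentMap (fun w : M.DSMan => w.1.1) a b w v = 0 ↔
      tangentMap (fun w : M.DSMan => w.1.2) a c w v = 0 := by
  obtain ⟨d, hd, hdx⟩ := hM.isSMan.exists_chart (M.proj w.1.1)
  have hdx' : M.proj w.1.2 ∈ d.source := M.D_proj _ w.2 ▸ hdx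
  have e1 := tangentMap_comp_apply hM.isSMan_D hM.corners_isSMan hM.isSMan hM.proj_smooth
    hM.smooth_D_fst ha hb hd hw hwb hdx v
  have e2 := tangentMap_comp_apply hM.isSMan_D hM.corners_isSMan hM.isSMan hM.proj_smooth
    hM.smooth_D_snd ha hc hd hw hwc hdx' v
  have e : (fun w : M.DSMan => M.proj w.1.1) = fun w => M.proj w.1.2 :=
    funext fun w => M.D_proj _ w.2
  rw [e, e2] at e1
  have b1 := (injective_iff_map_eq_zero _).1 (hM.tangentMap_proj_bijective hb hd hwb hdx).1
  have b2 := (injective_iff_map_eq_zero _).1 (hM.tangentMap_proj_bijective hc hd hwc hdx').1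
  constructor
  · intro h
    rw [h, map_zero] at e1
    exact b2 _ e1
  · intro h
    rw [h, map_zero] at e1
    exact b1 _ e1.symm

theorem etale_D_snd (hM : M.IsSManC) : IsEtale M.DSMan M.C (fun p => p.1.2) :=
  { hM.smooth_D_snd with
    sdim_eq := fun p => (hM.sdim_D p).symm
    dim_eq := fun _ => rfl
    bijective := by
      intro w p q a ha c hc hw hwc
      obtain ⟨b, hb, hwb⟩ := hM.corners_isSMan.exists_chart w.1.1
      refine bijective_of_injective_of_eq ?_ fun v hv => ?_
      · rw [← (hM.isSMan_D.isStratumChart p a ha).sdim_eq w hw, hM.sdim_D,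
          (hM.corners_isSMan.isStratumChart q c hc).sdim_eq _ hwc]
      · exact ha.2.2.2 _ b hb _ c hc w hw hwb hwc v
          ((hM.tangentMap_D_eq_zero_iff ha hb hc hw hwb hwc v).2 hv) hv }

/-- The inverse of `C_0(X) → X`. -/
theorem exists_zero_section (hM : M.IsSManC) : ∃ s : M.X → M.C, IsEtale M.X M.C s ∧
    (∀ x, M.codim (s x) = 0) ∧ (∀ x, M.proj (s x) = x) ∧
    ∀ u, M.codim u = 0 → s (M.proj u) = u := by
  obtain ⟨s, hs, h1, h2⟩ := hM.zero_iso
  refine ⟨s, { hs with sdim_eq := ?_, dim_eq := ?_, bijective := ?_ }, fun x => (h1 x).1,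
    fun x => (h1 x).2, h2⟩
  · intro x
    rw [← hM.sdim_proj, (h1 x).2]
  · intro x
    have := (h1 x).1
    rw [codim, (h1 x).2] at this
    omega
  · intro x p q a ha b hb hx hsx
    obtain ⟨c, hc, hcx⟩ := hM.isSMan.exists_chart x
    have hcx' : M.proj (s x) ∈ c.source := (h1 x).2.symm ▸ hcx
    have e := tangentMap_comp hM.isSMan hM.corners_isSMan hM.isSMan hM.proj_smooth hs ha hb hc hx hsx
      hcx'
    have e' : M.proj ∘ s = fun x => x := funext fun x => (h1 x).2
    rw [e'] at e
    have k1 := tangentMap_id_bijective hM.isSMan ha hc hx hcx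
    rw [e, ContinuousLinearMap.coe_comp] at k1
    exact (Function.Bijective.of_comp_iff'
      (hM.tangentMap_proj_bijective hb hc hsx hcx') _).1 k1

end PreSManC.IsSManC

/-! ### The fibre product of s-manifolds with corners -/

section Pullback

variable {M N P : PreSManC.{u}} {g : SCMap M P} {h : SCMap N P}

theorem codim_pullback (w : (pullback g h).C) : (pullback g h).codim w =
    M.codim w.1.1 + N.codim w.1.2 - P.codim (g.corner w.1.1) := by
  change (M.X.dim (M.proj w.1.1) + N.X.dim (N.proj w.1.2) - P.X.dim (g.base (M.proj w.1.1))) -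
    (M.C.dim w.1.1 + N.C.dim w.1.2 - P.C.dim (g.corner w.1.1)) = _
  simp only [PreSManC.codim, g.comm]
  ring

theorem IsTransverse.codim_le (ht : IsTransverse g h) (w : (pullback g h).C) :
    P.codim (g.corner w.1.1) ≤ M.codim w.1.1 ∧ P.codim (g.corner w.1.1) ≤ N.codim w.1.2 := by
  refine ⟨ht.left_bNormal.codim_le _, ?_⟩
  rw [w.2]
  exact ht.right_bNormal.codim_le _

theorem codim_pullback_eq_zero_iff (hM : M.IsSManC) (hN : N.IsSManC) (hP : P.IsSManC)
    (ht : IsTransverse g h) (w : (pullback g h).C) :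
    (pullback g h).codim w = 0 ↔ M.codim w.1.1 = 0 ∧ N.codim w.1.2 = 0 := by
  rw [codim_pullback]
  have h1 := ht.codim_le w
  have h2 := hM.codim_nonneg w.1.1
  have h3 := hN.codim_nonneg w.1.2
  have h4 := hP.codim_nonneg (g.corner w.1.1)
  omega

theorem codim_le_of_mem_pullback_D (ht : IsTransverse g h)
    (p : (pullback g h).C × (pullback g h).C)
    (hp : p ∈ (pullback g h).D) :
    M.codim p.2.1.1 - M.codim p.1.1.1 ≤
        (pullback g h).codim p.2 - (pullback g h).codim p.1 ∧
      N.codim p.2.1.2 - N.codim p.1.1.2 ≤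
        (pullback g h).codim p.2 - (pullback g h).codim p.1 := by
  have h1 := ht.left_bNormal.codim_D _ hp.1
  have h2 := ht.right_bNormal.codim_D _ hp.2
  simp only [← p.1.2, ← p.2.2] at h1 h2
  simp only [codim_pullback]
  omega

/-- A nonempty subset of a fibre of `C(W)` has a least upper bound, and this is formed
componentwise. -/
theorem exists_lub_pullback (hM : M.IsSManC) (hN : N.IsSManC) (hP : P.IsSManC)
    (ht : IsTransverse g h) (x : (pullback g h).X) (S : Set (pullback g h).C) (hS : S.Nonempty)
    (hx : S ⊆ (pullback g h).proj ⁻¹' {x}) : ∃ w, (pullback g h).IsLub S w ∧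
      M.IsLub ((fun w : (pullback g h).C => w.1.1) '' S) w.1.1 ∧
      N.IsLub ((fun w : (pullback g h).C => w.1.2) '' S) w.1.2 := by
  have h1 : (fun w : (pullback g h).C => w.1.1) '' S ⊆ M.proj ⁻¹' {x.1.1} := by
    rintro _ ⟨w, hw, rfl⟩
    exact congrArg (fun x : (pullback g h).X => x.1.1) (hx hw)
  have h2 : (fun w : (pullback g h).C => w.1.2) '' S ⊆ N.proj ⁻¹' {x.1.2} := by
    rintro _ ⟨w, hw, rfl⟩
    exact congrArg (fun x : (pullback g h).X => x.1.2) (hx hw)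
  obtain ⟨u, hu⟩ := hM.exists_lub _ _ (hS.image _) h1
  obtain ⟨v, hv⟩ := hN.exists_lub _ _ (hS.image _) h2
  have k1 := ht.left_bNormal.map_lub _ _ (hS.image _) h1 u hu
  have k2 := ht.right_bNormal.map_lub _ _ (hS.image _) h2 v hv
  rw [image_image] at k1 k2
  have e : (fun w : (pullback g h).C => g.corner w.1.1) = fun w => h.corner w.1.2 :=
    funext fun w => w.2
  rw [e] at k1
  exact ⟨⟨(u, v), hP.lub_unique k1 k2⟩, ⟨fun s hs => ⟨hu.1 _ (mem_image_of_mem _ hs),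
    hv.1 _ (mem_image_of_mem _ hs)⟩, fun t htt => ⟨hu.2 _ (forall_mem_image.2 fun s hs =>
      (htt s hs).1), hv.2 _ (forall_mem_image.2 fun s hs => (htt s hs).2)⟩⟩, hu, hv⟩

theorem exists_glb_pullback (hM : M.IsSManC) (hN : N.IsSManC) (hP : P.IsSManC)
    (ht : IsTransverse g h) (x : (pullback g h).X) (S : Set (pullback g h).C) (hS : S.Nonempty)
    (hx : S ⊆ (pullback g h).proj ⁻¹' {x}) : ∃ w, (pullback g h).IsGlb S w ∧
      M.IsGlb ((fun w : (pullback g h).C => w.1.1) '' S) w.1.1 ∧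
      N.IsGlb ((fun w : (pullback g h).C => w.1.2) '' S) w.1.2 := by
  have h1 : (fun w : (pullback g h).C => w.1.1) '' S ⊆ M.proj ⁻¹' {x.1.1} := by
    rintro _ ⟨w, hw, rfl⟩
    exact congrArg (fun x : (pullback g h).X => x.1.1) (hx hw)
  have h2 : (fun w : (pullback g h).C => w.1.2) '' S ⊆ N.proj ⁻¹' {x.1.2} := by
    rintro _ ⟨w, hw, rfl⟩
    exact congrArg (fun x : (pullback g h).X => x.1.2) (hx hw)
  obtain ⟨u, hu⟩ := hM.exists_glb _ _ (hS.image _) h1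
  obtain ⟨v, hv⟩ := hN.exists_glb _ _ (hS.image _) h2
  have k1 := ht.left_bNormal.map_glb _ _ (hS.image _) h1 u hu
  have k2 := ht.right_bNormal.map_glb _ _ (hS.image _) h2 v hv
  rw [image_image] at k1 k2
  have e : (fun w : (pullback g h).C => g.corner w.1.1) = fun w => h.corner w.1.2 :=
    funext fun w => w.2
  rw [e] at k1
  exact ⟨⟨(u, v), hP.glb_unique k1 k2⟩, ⟨fun s hs => ⟨hu.1 _ (mem_image_of_mem _ hs),
    hv.1 _ (mem_image_of_mem _ hs)⟩, fun t htt => ⟨hu.2 _ (forall_mem_image.2 fun s hs =>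
      (htt s hs).1), hv.2 _ (forall_mem_image.2 fun s hs => (htt s hs).2)⟩⟩, hu, hv⟩

variable (hM : M.IsSManC) (hN : N.IsSManC) (hP : P.IsSManC) (ht : IsTransverse g h)

/-- The component in `D(X)` of an element of `D(W)`, for `W = X ×_Z Y`. -/
def pullbackDFst (p : (pullback g h).D) : M.D := ⟨(p.1.1.1.1, p.1.2.1.1), p.2.1⟩

/-- The component in `D(Y)` of an element of `D(W)`, for `W = X ×_Z Y`. -/
def pullbackDSnd (p : (pullback g h).D) : N.D := ⟨(p.1.1.1.2, p.1.2.1.2), p.2.2⟩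

theorem continuous_pullbackDFst : Continuous (pullbackDFst (g := g) (h := h)) := by
  have : Continuous fun p : (pullback g h).C × (pullback g h).C => (p.1.1.1, p.2.1.1) :=
    (continuous_fst.comp (continuous_subtype_val.comp continuous_fst)).prodMk
      (continuous_fst.comp (continuous_subtype_val.comp continuous_snd))
  exact (this.comp continuous_subtype_val).subtype_mk _

theorem continuous_pullbackDSnd : Continuous (pullbackDSnd (g := g) (h := h)) := by
  have : Continuous fun p : (pullback g h).C × (pullback g h).C => (p.1.1.2, p.2.1.2) :=
    (continuous_snd.comp (continuous_subtype_val.comp continuous_fst)).prodMk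
      (continuous_snd.comp (continuous_subtype_val.comp continuous_snd))
  exact (this.comp continuous_subtype_val).subtype_mk _

include hP ht

theorem isClosedEmbedding_pullbackD :
    IsClosedEmbedding (fun p : (pullback g h).D => (pullbackDFst p, pullbackDSnd p)) := by
  have := hP.corners_isSMan.hausdorff
  have hg := ht.left_bNormal.corner_smooth.continuous
  have hh := ht.right_bNormal.corner_smooth.continuous
  constructor
  · have i1 : IsEmbedding (fun p : (pullback g h).D =>
        (((p.1.1.1.1, p.1.1.1.2), (p.1.2.1.1, p.1.2.1.2)) : (M.C × N.C) × (M.C × N.C))) :=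
      (IsEmbedding.subtypeVal.prodMap IsEmbedding.subtypeVal).comp IsEmbedding.subtypeVal
    have i2 := (Homeomorph.prodProdProdComm M.C N.C M.C N.C).isEmbedding.comp i1
    exact IsEmbedding.of_comp (continuous_pullbackDFst.prodMk continuous_pullbackDSnd)
      (IsEmbedding.subtypeVal.prodMap IsEmbedding.subtypeVal).continuous i2
  · have hcl : IsClosed {q : M.D × N.D | g.corner q.1.1.1 = h.corner q.2.1.1 ∧
        g.corner q.1.1.2 = h.corner q.2.1.2} :=
      (isClosed_eq (by fun_prop) (by fun_prop)).inter (isClosed_eq (by fun_prop) (by fun_prop))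
    convert! hcl using 1
    ext q
    constructor
    · rintro ⟨p, rfl⟩
      exact ⟨p.1.1.2, p.1.2.2⟩
    · rintro ⟨h1, h2⟩
      exact ⟨⟨(⟨(q.1.1.1, q.2.1.1), h1⟩, ⟨(q.1.1.2, q.2.1.2), h2⟩), q.1.2, q.2.2⟩, rfl⟩

include hM hN

theorem isSMan_pullback_X : (pullback g h).X.IsSMan :=
  isSMan_pullback hM.isSMan hN.isSMan hP.isSMan ht.left_bNormal.base_smooth
    ht.right_bNormal.base_smooth ht.base

theorem isSMan_pullback_C : (pullback g h).C.IsSMan :=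
  isSMan_pullback hM.corners_isSMan hN.corners_isSMan hP.corners_isSMan
    ht.left_bNormal.corner_smooth ht.right_bNormal.corner_smooth ht.corner

theorem smooth_pullbackFst_base : IsSmooth (pullback g h).X M.X (fun w => w.1.1) :=
  smooth_pullback_fst hM.isSMan hN.isSMan hP.isSMan ht.left_bNormal.base_smooth
    ht.right_bNormal.base_smooth

theorem smooth_pullbackSnd_base : IsSmooth (pullback g h).X N.X (fun w => w.1.2) :=
  smooth_pullback_snd hM.isSMan hN.isSMan hP.isSMan ht.left_bNormal.base_smooth
    ht.right_bNormal.base_smooth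

theorem smooth_pullbackFst_corner : IsSmooth (pullback g h).C M.C (fun w => w.1.1) :=
  smooth_pullback_fst hM.corners_isSMan hN.corners_isSMan hP.corners_isSMan
    ht.left_bNormal.corner_smooth ht.right_bNormal.corner_smooth

theorem smooth_pullbackSnd_corner : IsSmooth (pullback g h).C N.C (fun w => w.1.2) :=
  smooth_pullback_snd hM.corners_isSMan hN.corners_isSMan hP.corners_isSMan
    ht.left_bNormal.corner_smooth ht.right_bNormal.corner_smooth

theorem smooth_lift_X {T : PreSMan.{u}} (hT : T.IsSMan) {φ : T → (pullback g h).X}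
    (h1 : IsSmooth T M.X (fun t => (φ t).1.1)) (h2 : IsSmooth T N.X (fun t => (φ t).1.2)) :
    IsSmooth T (pullback g h).X φ :=
  smooth_pullback_lift hM.isSMan hN.isSMan hP.isSMan ht.left_bNormal.base_smooth
    ht.right_bNormal.base_smooth hT h1 h2

theorem smooth_lift_C {T : PreSMan.{u}} (hT : T.IsSMan) {φ : T → (pullback g h).C}
    (h1 : IsSmooth T M.C (fun t => (φ t).1.1)) (h2 : IsSmooth T N.C (fun t => (φ t).1.2)) :
    IsSmooth T (pullback g h).C φ :=
  smooth_pullback_lift hM.corners_isSMan hN.corners_isSMan hP.corners_isSMan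
    ht.left_bNormal.corner_smooth ht.right_bNormal.corner_smooth hT h1 h2

theorem smooth_pullback_proj : IsSmooth (pullback g h).C (pullback g h).X (pullback g h).proj :=
  smooth_lift_X hM hN hP ht (isSMan_pullback_C hM hN hP ht)
    (hM.proj_smooth.comp (isSMan_pullback_C hM hN hP ht) hM.corners_isSMan hM.isSMan
      (smooth_pullbackFst_corner hM hN hP ht))
    (hN.proj_smooth.comp (isSMan_pullback_C hM hN hP ht) hN.corners_isSMan hN.isSMan
      (smooth_pullbackSnd_corner hM hN hP ht))

theorem isProperMap_pullback_proj : IsProperMap (pullback g h).proj := by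
  have hF := isFibre_pullback hP.corners_isSMan ht.left_bNormal.corner_smooth
    ht.right_bNormal.corner_smooth
  have h1 := (hM.proj_proper.prodMap hN.proj_proper).comp
    (IsClosedEmbedding.mk hF.isEmbedding hF.isClosed_range).isProperMap
  exact isProperMap_of_comp_of_inj (smooth_pullback_proj hM hN hP ht).continuous
    continuous_subtype_val h1 Subtype.val_injective

theorem injOn_pullback_proj (w : (pullback g h).C) :
    ∃ U ∈ 𝓝 w, InjOn (pullback g h).proj U := by
  obtain ⟨U, hU, hwU, hUi, -⟩ := hM.proj_locallyClosedEmbedding w.1.1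
  obtain ⟨V, hV, hwV, hVi, -⟩ := hN.proj_locallyClosedEmbedding w.1.2
  have c1 := (smooth_pullbackFst_corner hM hN hP ht).continuous
  have c2 := (smooth_pullbackSnd_corner hM hN hP ht).continuous
  refine ⟨(fun w : (pullback g h).C => w.1.1) ⁻¹' U ∩ (fun w : (pullback g h).C => w.1.2) ⁻¹' V,
    ((hU.preimage c1).inter (hV.preimage c2)).mem_nhds ⟨hwU, hwV⟩, ?_⟩
  intro s hs t hT he
  have e1 : M.proj s.1.1 = M.proj t.1.1 := congrArg (fun x : (pullback g h).X => x.1.1) he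
  have e2 : N.proj s.1.2 = N.proj t.1.2 := congrArg (fun x : (pullback g h).X => x.1.2) he
  exact Subtype.ext (Prod.ext (injOn_iff_injective.2 hUi.injective hs.1 hT.1 e1)
    (injOn_iff_injective.2 hVi.injective hs.2 hT.2 e2))

theorem pullback_zero_iso : ∃ s : (pullback g h).X → (pullback g h).C,
    IsSmooth (pullback g h).X (pullback g h).C s ∧
    (∀ x, (pullback g h).codim (s x) = 0 ∧ (pullback g h).proj (s x) = x) ∧
    ∀ u, (pullback g h).codim u = 0 → s ((pullback g h).proj u) = u := by
  obtain ⟨s, hs, hs1, hs2, hs3⟩ := hM.exists_zero_section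
  obtain ⟨t, hT, ht1, ht2, ht3⟩ := hN.exists_zero_section
  have key : ∀ x : (pullback g h).X, g.corner (s x.1.1) = h.corner (t x.1.2) := by
    intro x
    have k1 := ht.left_bNormal.codim_le (s x.1.1)
    have k2 := ht.right_bNormal.codim_le (t x.1.2)
    have k3 := hP.codim_nonneg (g.corner (s x.1.1))
    have k4 := hP.codim_nonneg (h.corner (t x.1.2))
    rw [hs1] at k1
    rw [ht1] at k2
    exact hP.eq_of_codim_zero (by omega) (by omega) (by rw [g.comm, h.comm, hs2, ht2]; exact x.2)
  have hX := isSMan_pullback_X hM hN hP ht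
  refine ⟨fun x => ⟨(s x.1.1, t x.1.2), key x⟩, smooth_lift_C hM hN hP ht hX
    (hs.toIsSmooth.comp hX hM.isSMan hM.corners_isSMan (smooth_pullbackFst_base hM hN hP ht))
    (hT.toIsSmooth.comp hX hN.isSMan hN.corners_isSMan (smooth_pullbackSnd_base hM hN hP ht)),
    fun x => ⟨(codim_pullback_eq_zero_iff hM hN hP ht _).2 ⟨hs1 _, ht1 _⟩,
      Subtype.ext (Prod.ext (hs2 _) (ht2 _))⟩, fun w hw => ?_⟩
  obtain ⟨h1, h2⟩ := (codim_pullback_eq_zero_iff hM hN hP ht w).1 hw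
  exact Subtype.ext (Prod.ext (hs3 _ h1) (ht3 _ h2))

/-- Each stratum of `C(W)` is mapped onto a stratum of `W` by a proper local diffeomorphism: it is a
fibre product of strata, and the projections of the factors are injective on strata. -/
theorem pullback_proj_covering (S : Set (pullback g h).C) (hS : S ∈ (pullback g h).C.strata) :
    (pullback g h).proj '' S ∈ (pullback g h).X.strata ∧
    IsProperMap (fun u : S => (⟨(pullback g h).proj u, mem_image_of_mem _ u.2⟩ :
      (pullback g h).proj '' S)) ∧
    ∀ u ∈ S, ∀ p q, ∀ a ∈ (pullback g h).C.charts p, ∀ b ∈ (pullback g h).X.charts q,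
      u ∈ a.source → (pullback g h).proj u ∈ b.source →
      Function.Bijective (tangentMap (pullback g h).proj a b u) := by
  obtain ⟨w, rfl⟩ : ∃ w, S = (pullback g h).C.stratum w := hS
  refine ⟨?_, isProperMap_imageFactorization ?_, ?_⟩
  · refine ⟨(pullback g h).proj w, Subset.antisymm ?_ ?_⟩
    · rintro _ ⟨w', hw', rfl⟩
      exact (smooth_pullback_proj hM hN hP ht).map_rel _ _ hw'
    · intro x hx
      obtain ⟨u, hu, hux⟩ := hM.exists_of_rel_proj (M.X.rel.symm' hx.1)
      obtain ⟨v, hv, hvx⟩ := hN.exists_of_rel_proj (N.X.rel.symm' hx.2)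
      have key : g.corner u = h.corner v := by
        apply hP.eq_of_rel
        · exact P.C.rel.trans' (P.C.rel.symm' (ht.left_bNormal.corner_smooth.map_rel _ _ hu))
            (w.2 ▸ ht.right_bNormal.corner_smooth.map_rel _ _ hv)
        · rw [g.comm, h.comm, hux, hvx]
          exact x.2
      exact ⟨⟨(u, v), key⟩, ⟨M.C.rel.symm' hu, N.C.rel.symm' hv⟩,
        Subtype.ext (Prod.ext hux hvx)⟩
  · have i1 : IsEmbedding (fun u : (pullback g h).C.stratum w =>
        ((⟨u.1.1.1, u.2.1⟩, ⟨u.1.1.2, u.2.2⟩) : M.C.stratum w.1.1 × N.C.stratum w.1.2)) := by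
      have c1 := (smooth_pullbackFst_corner hM hN hP ht).continuous
      have c2 := (smooth_pullbackSnd_corner hM hN hP ht).continuous
      refine IsEmbedding.of_comp ?_ (IsEmbedding.subtypeVal.prodMap IsEmbedding.subtypeVal).continuous
        (IsEmbedding.subtypeVal.comp IsEmbedding.subtypeVal)
      exact ((c1.comp continuous_subtype_val).subtype_mk _).prodMk
        ((c2.comp continuous_subtype_val).subtype_mk _)
    have i2 := ((hM.isEmbedding_proj_stratum w.1.1).prodMap
      (hN.isEmbedding_proj_stratum w.1.2)).comp i1
    exact IsEmbedding.of_comp ((smooth_pullback_proj hM hN hP ht).continuous.comp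
      continuous_subtype_val) continuous_subtype_val i2
  · intro u _ p q a ha b hb hua hub
    have hC := isSMan_pullback_C hM hN hP ht
    have hX := isSMan_pullback_X hM hN hP ht
    have hpr := smooth_pullback_proj hM hN hP ht
    have f1 := smooth_pullbackFst_corner hM hN hP ht
    have f2 := smooth_pullbackSnd_corner hM hN hP ht
    have e1 := smooth_pullbackFst_base hM hN hP ht
    have e2 := smooth_pullbackSnd_base hM hN hP ht
    refine bijective_of_injective_of_eq ?_ fun v hv => ?_
    · rw [← (hC.isStratumChart p a ha).sdim_eq u hua, ← (hX.isStratumChart q b hb).sdim_eq _ hub]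
      change M.C.sdim u.1.1 + N.C.sdim u.1.2 - P.C.sdim (g.corner u.1.1) =
        M.X.sdim (M.proj u.1.1) + N.X.sdim (N.proj u.1.2) - P.X.sdim (g.base (M.proj u.1.1))
      rw [← g.comm, hM.sdim_proj, hN.sdim_proj, hP.sdim_proj]
    · obtain ⟨c, hc, huc⟩ := hM.corners_isSMan.exists_chart u.1.1
      obtain ⟨d, hd, hud⟩ := hN.corners_isSMan.exists_chart u.1.2
      obtain ⟨c', hc', huc'⟩ := hM.isSMan.exists_chart (M.proj u.1.1)
      obtain ⟨d', hd', hud'⟩ := hN.isSMan.exists_chart (N.proj u.1.2)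
      refine ha.2.2.2 _ c hc _ d hd u hua huc hud v ?_ ?_
      · apply (injective_iff_map_eq_zero _).1 (hM.tangentMap_proj_bijective hc hc' huc huc').1
        refine (tangentMap_comp_apply hC hM.corners_isSMan hM.isSMan hM.proj_smooth f1 ha hc hc' hua
          huc huc' v).symm.trans ?_
        refine (tangentMap_comp_apply hC hX hM.isSMan e1 hpr ha hb hc' hua hub huc' v).trans ?_
        rw [hv, map_zero]
      · apply (injective_iff_map_eq_zero _).1 (hN.tangentMap_proj_bijective hd hd' hud hud').1
        refine (tangentMap_comp_apply hC hN.corners_isSMan hN.isSMan hN.proj_smooth f2 ha hd hd' hua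
          hud hud' v).symm.trans ?_
        refine (tangentMap_comp_apply hC hX hN.isSMan e2 hpr ha hb hd' hua hub hud' v).trans ?_
        rw [hv, map_zero]

theorem isClopen_pullback_D : IsClopen {p : {p : (pullback g h).C × (pullback g h).C //
    (pullback g h).proj p.1 = (pullback g h).proj p.2} | p.1 ∈ (pullback g h).D} := by
  have c1 := (smooth_pullbackFst_corner hM hN hP ht).continuous
  have c2 := (smooth_pullbackSnd_corner hM hN hP ht).continuous
  let T := {p : (pullback g h).C × (pullback g h).C //
    (pullback g h).proj p.1 = (pullback g h).proj p.2}
  let φ : T → {p : M.C × M.C // M.proj p.1 = M.proj p.2} := fun p =>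
    ⟨(p.1.1.1.1, p.1.2.1.1), congrArg (fun x : (pullback g h).X => x.1.1) p.2⟩
  let ψ : T → {p : N.C × N.C // N.proj p.1 = N.proj p.2} := fun p =>
    ⟨(p.1.1.1.2, p.1.2.1.2), congrArg (fun x : (pullback g h).X => x.1.2) p.2⟩
  have hφ : Continuous φ := Continuous.subtype_mk
    ((c1.comp (continuous_fst.comp continuous_subtype_val)).prodMk
      (c1.comp (continuous_snd.comp continuous_subtype_val))) _
  have hψ : Continuous ψ := Continuous.subtype_mk
    ((c2.comp (continuous_fst.comp continuous_subtype_val)).prodMk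
      (c2.comp (continuous_snd.comp continuous_subtype_val))) _
  exact (hM.D_clopen.preimage hφ).inter (hN.D_clopen.preimage hψ)

theorem isProperMap_pullback_D : IsProperMap (fun p : (pullback g h).D => p.1.2) := by
  have h1 := (hM.D_proper.prodMap hN.D_proper).comp
    (isClosedEmbedding_pullbackD hP ht).isProperMap
  exact isProperMap_of_comp_of_inj (continuous_snd.comp continuous_subtype_val)
    continuous_subtype_val h1 Subtype.val_injective

/-- The local inverses of the second projections of `D(X)` and of `D(Y)` have the same image in `D(Z)`, as
`D(Z) → C(Z)` is locally injective; so they define a local inverse of that of `D(W)`. -/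
theorem isLocalHomeomorph_pullback_D :
    IsLocalHomeomorph (fun p : (pullback g h).D => p.1.2) := by
  have hδ := (isClosedEmbedding_pullbackD hP ht).isInducing
  have hg := ht.left_bNormal.corner_smooth.continuous
  have hh := ht.right_bNormal.corner_smooth.continuous
  refine isLocalHomeomorph_of_locally_injective (continuous_snd.comp continuous_subtype_val) ?_ ?_
  · intro p
    obtain ⟨U, hU, hUi⟩ := IsLocalHomeomorph.exists_injOn hM.D_localHomeomorph (pullbackDFst p)
    obtain ⟨V, hV, hVi⟩ := IsLocalHomeomorph.exists_injOn hN.D_localHomeomorph (pullbackDSnd p)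
    refine ⟨_, Filter.inter_mem (continuous_pullbackDFst.continuousAt.preimage_mem_nhds hU)
      (continuous_pullbackDSnd.continuousAt.preimage_mem_nhds hV), ?_⟩
    intro s hs t hT he
    have e1 := hUi hs.1 hT.1 (congrArg (fun x : (pullback g h).C => x.1.1) he)
    have e2 := hVi hs.2 hT.2 (congrArg (fun x : (pullback g h).C => x.1.2) he)
    exact (isClosedEmbedding_pullbackD hP ht).injective (Prod.ext e1 e2)
  · intro p U hU
    rw [Filter.mem_map, hδ.nhds_eq_comap, nhds_prod_eq] at hU
    obtain ⟨N', hN', hsub⟩ := Filter.mem_comap.1 hU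
    obtain ⟨U₁, hU₁, U₂, hU₂, hU₁₂⟩ := Filter.mem_prod_iff.1 hN'
    let γ : M.D → P.D := fun q => ⟨(g.corner q.1.1, g.corner q.1.2), g.map_D _ q.2⟩
    let η : N.D → P.D := fun q => ⟨(h.corner q.1.1, h.corner q.1.2), h.map_D _ q.2⟩
    have hγ : Continuous γ := Continuous.subtype_mk (by fun_prop) _
    have hη : Continuous η := Continuous.subtype_mk (by fun_prop) _
    have hγη : γ (pullbackDFst p) = η (pullbackDSnd p) := Subtype.ext (Prod.ext p.1.1.2 p.1.2.2)
    obtain ⟨V, hV, hVi⟩ := IsLocalHomeomorph.exists_injOn hP.D_localHomeomorph (γ (pullbackDFst p))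
    have n1 := Filter.inter_mem hU₁ (hγ.continuousAt.preimage_mem_nhds hV)
    have n2 := Filter.inter_mem hU₂ (hη.continuousAt.preimage_mem_nhds (hγη ▸ hV))
    have m1 := Filter.image_mem_map (m := fun q : M.D => q.1.2) n1
    have m2 := Filter.image_mem_map (m := fun q : N.D => q.1.2) n2
    rw [hM.D_localHomeomorph.map_nhds_eq] at m1
    rw [hN.D_localHomeomorph.map_nhds_eq] at m2
    have c1 := (smooth_pullbackFst_corner hM hN hP ht).continuous
    have c2 := (smooth_pullbackSnd_corner hM hN hP ht).continuous
    filter_upwards [c1.continuousAt.preimage_mem_nhds m1, c2.continuousAt.preimage_mem_nhds m2]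
      with w hw1 hw2
    obtain ⟨q₁, ⟨hq₁, hq₁'⟩, e₁⟩ := hw1
    obtain ⟨q₂, ⟨hq₂, hq₂'⟩, e₂⟩ := hw2
    have e₁' : q₁.1.2 = w.1.1 := e₁
    have e₂' : q₂.1.2 = w.1.2 := e₂
    have e₃ : g.corner q₁.1.2 = h.corner q₂.1.2 := by rw [e₁', e₂', w.2]
    have e₄ := congrArg (fun q : P.D => q.1.1) (hVi hq₁' hq₂' e₃)
    have hmem : (⟨(⟨(q₁.1.1, q₂.1.1), e₄⟩, ⟨(q₁.1.2, q₂.1.2), e₃⟩), q₁.2, q₂.2⟩ :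
        (pullback g h).D) ∈ (fun p : (pullback g h).D => p.1.2) ⁻¹' U := hsub (hU₁₂ ⟨hq₁, hq₂⟩)
    have : (⟨(q₁.1.2, q₂.1.2), e₃⟩ : (pullback g h).C) = w := Subtype.ext (Prod.ext e₁' e₂')
    exact this ▸ hmem

/-- The fibre product of transverse b-normal morphisms is an s-manifold with corners. -/
theorem isSManC_pullback : (pullback g h).IsSManC where
  isSMan := isSMan_pullback_X hM hN hP ht
  corners_isSMan := isSMan_pullback_C hM hN hP ht
  codim_nonneg w := by
    have := ht.codim_le w
    have := hM.codim_nonneg w.1.1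
    rw [codim_pullback]
    omega
  proj_smooth := smooth_pullback_proj hM hN hP ht
  proj_proper := isProperMap_pullback_proj hM hN hP ht
  proj_locallyClosedEmbedding w := by
    have := (isSMan_pullback_C hM hN hP ht).locallyCompact
    have := (isSMan_pullback_X hM hN hP ht).hausdorff
    exact exists_isEmbedding_isLocallyClosed (smooth_pullback_proj hM hN hP ht).continuous w
      (injOn_pullback_proj hM hN hP ht w)
  zero_iso := pullback_zero_iso hM hN hP ht
  proj_covering := pullback_proj_covering hM hN hP ht
  D_codim p hp := by
    have h1 := codim_le_of_mem_pullback_D ht p hp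
    have h2 := hM.D_codim _ hp.1
    simp only at h2
    omega
  D_clopen := isClopen_pullback_D hM hN hP ht
  D_strata u v u' v' hD hu hv hp :=
    ⟨hM.D_strata _ _ _ _ hD.1 hu.1 hv.1 (congrArg (fun x : (pullback g h).X => x.1.1) hp),
      hN.D_strata _ _ _ _ hD.2 hu.2 hv.2 (congrArg (fun x : (pullback g h).X => x.1.2) hp)⟩
  D_proper := isProperMap_pullback_D hM hN hP ht
  D_localHomeomorph := isLocalHomeomorph_pullback_D hM hN hP ht
  D_refl u := ⟨hM.D_refl _, hN.D_refl _⟩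
  D_antisymm u v huv hvu := Subtype.ext (Prod.ext (hM.D_antisymm _ _ huv.1 hvu.1)
    (hN.D_antisymm _ _ huv.2 hvu.2))
  D_trans u v w huv hvw := ⟨hM.D_trans _ _ _ huv.1 hvw.1, hN.D_trans _ _ _ huv.2 hvw.2⟩
  D_level u v hD hc := by
    have h1 := codim_le_of_mem_pullback_D ht _ hD
    have h2 := hM.D_codim _ hD.1
    have h3 := hN.D_codim _ hD.2
    simp only at h1 h2 h3
    exact Subtype.ext (Prod.ext (hM.D_level _ _ hD.1 (by omega)) (hN.D_level _ _ hD.2 (by omega)))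
  exists_lub x S hS hx := (exists_lub_pullback hM hN hP ht x S hS hx).imp fun _ h => h.1
  exists_glb x S hS hx := (exists_glb_pullback hM hN hP ht x S hS hx).imp fun _ h => h.1

/-- The greatest elements of the fibres of `C(W)` are the pairs of greatest elements, since `C(g)` and
`C(h)` preserve greatest elements. -/
theorem mem_interior_pullback_iff (w : (pullback g h).C) :
    w ∈ (pullback g h).interior ↔ w.1.1 ∈ M.interior ∧ w.1.2 ∈ N.interior := by
  have hW := isSManC_pullback hM hN hP ht
  constructor
  · intro hw
    obtain ⟨u, hu, hwu⟩ := hM.exists_mem_interior w.1.1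
    obtain ⟨v, hv, hwv⟩ := hN.exists_mem_interior w.1.2
    have gu := ht.left_bNormal.map_interior u hu
    have hv' := ht.right_bNormal.map_interior v hv
    have e : P.proj (g.corner u) = P.proj (h.corner v) := by
      rw [g.comm, h.comm, ← M.D_proj _ hwu, ← N.D_proj _ hwv, ← g.comm, ← h.comm, w.2]
    have key : g.corner u = h.corner v := hP.D_antisymm _ _
      (hP.mem_D_of_mem_interior hv' e.symm) (hP.mem_D_of_mem_interior gu e)
    have := hW.mem_interior_iff.1 hw ⟨(u, v), key⟩ ⟨hwu, hwv⟩
    rw [← this]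
    exact ⟨hu, hv⟩
  · rintro ⟨h1, h2⟩
    refine hW.mem_interior_iff.2 fun w' hw' => Subtype.ext (Prod.ext ?_ ?_)
    · exact hM.mem_interior_iff.1 h1 _ hw'.1
    · exact hN.mem_interior_iff.1 h2 _ hw'.2

theorem isBNormal_pullbackFst : (pullbackFst g h).IsBNormal where
  base_smooth := smooth_pullbackFst_base hM hN hP ht
  corner_smooth := smooth_pullbackFst_corner hM hN hP ht
  map_interior w hw := ((mem_interior_pullback_iff hM hN hP ht w).1 hw).1
  map_lub x S hS hx w hw := by
    obtain ⟨w', h1, h2, -⟩ := exists_lub_pullback hM hN hP ht x S hS hx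
    rw [(isSManC_pullback hM hN hP ht).lub_unique hw h1]
    exact h2
  map_glb x S hS hx w hw := by
    obtain ⟨w', h1, h2, -⟩ := exists_glb_pullback hM hN hP ht x S hS hx
    rw [(isSManC_pullback hM hN hP ht).glb_unique hw h1]
    exact h2
  codim_le w := by
    have h1 := ht.codim_le w
    rw [codim_pullback]
    change M.codim w.1.1 ≤ _
    omega
  codim_D p hp := by
    have h1 := ht.codim_le p.1
    have h2 := (codim_le_of_mem_pullback_D ht p hp).1
    have h3 := hM.D_codim _ hp.1
    change M.codim p.1.1.1 ≤ _ ∧ 0 ≤ M.codim p.2.1.1 - M.codim p.1.1.1 ∧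
      M.codim p.2.1.1 - M.codim p.1.1.1 ≤ _
    refine ⟨?_, by simp only at h3; omega, h2⟩
    rw [codim_pullback]
    omega

theorem isBNormal_pullbackSnd : (pullbackSnd g h).IsBNormal where
  base_smooth := smooth_pullbackSnd_base hM hN hP ht
  corner_smooth := smooth_pullbackSnd_corner hM hN hP ht
  map_interior w hw := ((mem_interior_pullback_iff hM hN hP ht w).1 hw).2
  map_lub x S hS hx w hw := by
    obtain ⟨w', h1, -, h2⟩ := exists_lub_pullback hM hN hP ht x S hS hx
    rw [(isSManC_pullback hM hN hP ht).lub_unique hw h1]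
    exact h2
  map_glb x S hS hx w hw := by
    obtain ⟨w', h1, -, h2⟩ := exists_glb_pullback hM hN hP ht x S hS hx
    rw [(isSManC_pullback hM hN hP ht).glb_unique hw h1]
    exact h2
  codim_le w := by
    have h1 := ht.codim_le w
    rw [codim_pullback]
    change N.codim w.1.2 ≤ _
    omega
  codim_D p hp := by
    have h1 := ht.codim_le p.1
    have h2 := (codim_le_of_mem_pullback_D ht p hp).2
    have h3 := hN.D_codim _ hp.2
    change N.codim p.1.1.2 ≤ _ ∧ 0 ≤ N.codim p.2.1.2 - N.codim p.1.1.2 ∧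
      N.codim p.2.1.2 - N.codim p.1.1.2 ≤ _
    refine ⟨?_, by simp only at h3; omega, h2⟩
    rw [codim_pullback]
    omega

end Pullback

theorem SCMap.IsBNormal.isInterior {M N : PreSManC.{u}} {f : SCMap M N} (hf : f.IsBNormal)
    (hN : N.IsSManC) : f.IsInterior :=
  { hf.toIsMorphism with
    map_zero := fun u hu => by
      have h1 := hf.codim_le u
      have h2 := hN.codim_nonneg (f.corner u)
      omega }

theorem pullback_comm {M N P : PreSManC.{u}} (g : SCMap M P) (h : SCMap N P) :
    g.comp (pullbackFst g h) = h.comp (pullbackSnd g h) :=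
  SCMap.ext (funext fun w => w.2) (funext fun w => w.2)

section Lift

variable {M N P T : PreSManC.{u}} {g : SCMap M P} {h : SCMap N P}

/-- The map to the fibre product with given components. -/
def pullbackLift (e : SCMap T M) (f : SCMap T N) (hef : g.comp e = h.comp f) :
    SCMap T (pullback g h) where
  base t := ⟨(e.base t, f.base t), congrFun (congrArg SCMap.base hef) t⟩
  corner t := ⟨(e.corner t, f.corner t), congrFun (congrArg SCMap.corner hef) t⟩
  comm t := Subtype.ext (Prod.ext (e.comm t) (f.comm t))
  map_D p hp := ⟨e.map_D p hp, f.map_D p hp⟩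

theorem isMorphism_pullbackLift (hM : M.IsSManC) (hN : N.IsSManC) (hP : P.IsSManC)
    (ht : IsTransverse g h) (hT : T.IsSManC) {e : SCMap T M} {f : SCMap T N}
    (hef : g.comp e = h.comp f) (he : e.IsMorphism) (hf : f.IsMorphism) :
    (pullbackLift e f hef).IsMorphism where
  base_smooth := smooth_lift_X hM hN hP ht hT.isSMan he.base_smooth hf.base_smooth
  corner_smooth := smooth_lift_C hM hN hP ht hT.corners_isSMan he.corner_smooth hf.corner_smooth
  map_interior t htt := (mem_interior_pullback_iff hM hN hP ht _).2
    ⟨he.map_interior t htt, hf.map_interior t htt⟩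

theorem pullback_map_ext {b b' : SCMap T (pullback g h)}
    (h1 : (pullbackFst g h).comp b = (pullbackFst g h).comp b')
    (h2 : (pullbackSnd g h).comp b = (pullbackSnd g h).comp b') : b = b' :=
  SCMap.ext
    (funext fun t => Subtype.ext (Prod.ext (congrFun (congrArg SCMap.base h1) t)
      (congrFun (congrArg SCMap.base h2) t)))
    (funext fun t => Subtype.ext (Prod.ext (congrFun (congrArg SCMap.corner h1) t)
      (congrFun (congrArg SCMap.corner h2) t)))

theorem isCartesian_pullback (hM : M.IsSManC) (hN : N.IsSManC) (hP : P.IsSManC)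
    (ht : IsTransverse g h) {Obj : PreSManC.{u} → Prop} (hObj : ∀ T, Obj T → T.IsSManC)
    (h1 : Obj (pullback g h)) (h2 : Obj M) (h3 : Obj N) (h4 : Obj P) :
    IsCartesian Obj SCMap.IsMorphism (pullbackFst g h) (pullbackSnd g h) g h where
  obj := ⟨h1, h2, h3, h4⟩
  mor := ⟨(isBNormal_pullbackFst hM hN hP ht).toIsMorphism,
    (isBNormal_pullbackSnd hM hN hP ht).toIsMorphism, ht.left_bNormal.toIsMorphism,
    ht.right_bNormal.toIsMorphism⟩
  comm := pullback_comm g h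
  lift T e f hT he hf hef := ⟨pullbackLift e f hef,
    ⟨isMorphism_pullbackLift hM hN hP ht (hObj T hT) hef he hf, rfl, rfl⟩,
    fun _ hb => pullback_map_ext hb.2.1 hb.2.2⟩

theorem isCartesian_pullback_interior (hM : M.IsSManC) (hN : N.IsSManC) (hP : P.IsSManC)
    (ht : IsTransverse g h) {Obj : PreSManC.{u} → Prop} (hObj : ∀ T, Obj T → T.IsSManC)
    (h1 : Obj (pullback g h)) (h2 : Obj M) (h3 : Obj N) (h4 : Obj P) :
    IsCartesian Obj SCMap.IsInterior (pullbackFst g h) (pullbackSnd g h) g h where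
  obj := ⟨h1, h2, h3, h4⟩
  mor := ⟨(isBNormal_pullbackFst hM hN hP ht).isInterior hM,
    (isBNormal_pullbackSnd hM hN hP ht).isInterior hN, ht.left_bNormal.isInterior hP,
    ht.right_bNormal.isInterior hP⟩
  comm := pullback_comm g h
  lift T e f hT he hf hef := ⟨pullbackLift e f hef,
    ⟨{ isMorphism_pullbackLift hM hN hP ht (hObj T hT) hef he.toIsMorphism hf.toIsMorphism with
        map_zero := fun t htt => (codim_pullback_eq_zero_iff hM hN hP ht _).2
          ⟨he.map_zero t htt, hf.map_zero t htt⟩ }, rfl, rfl⟩,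
    fun _ hb => pullback_map_ext hb.2.1 hb.2.2⟩

end Lift

/-! ### Corners -/

section Corners

variable {M : PreSManC.{u}}

theorem codim_corners (p : (corners M).C) :
    (corners M).codim p = M.codim p.1.2 - M.codim p.1.1 := by
  change M.C.dim p.1.1 - M.C.dim p.1.2 = _
  rw [PreSManC.codim, PreSManC.codim, M.D_proj _ p.2]
  ring

/-- Least upper bounds in the fibre of `C(C(X))` over `v` are formed in `C(X)`. -/
theorem exists_isLub_corners (hM : M.IsSManC) {v : M.C} {S : Set (corners M).C} (hS : S.Nonempty)
    (hv : S ⊆ (corners M).proj ⁻¹' {v}) {w : M.C}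
    (hw : M.IsLub ((fun p : (corners M).C => p.1.2) '' S) w) :
    ∃ hD : (v, w) ∈ M.D, (corners M).IsLub S ⟨(v, w), hD⟩ := by
  obtain ⟨s, hs⟩ := hS
  have hvs : ∀ s ∈ S, s.1.1 = v := fun s hs => hv hs
  have hsD : (v, s.1.2) ∈ M.D := by
    rw [← hvs s hs]
    exact s.2
  refine ⟨hM.D_trans _ _ _ hsD (hw.1 _ (mem_image_of_mem _ hs)), fun t ht =>
    ⟨hvs t ht, hw.1 _ (mem_image_of_mem _ ht)⟩, fun q hq => ⟨?_, ?_⟩⟩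
  · exact (hvs s hs).symm.trans (hq s hs).1
  · exact hw.2 _ (forall_mem_image.2 fun t ht => (hq t ht).2)

/-- Greatest lower bounds in the fibre of `C(C(X))` over `v` are formed in `C(X)`. -/
theorem exists_isGlb_corners {v : M.C} {S : Set (corners M).C} (hS : S.Nonempty)
    (hv : S ⊆ (corners M).proj ⁻¹' {v}) {w : M.C}
    (hw : M.IsGlb ((fun p : (corners M).C => p.1.2) '' S) w) :
    ∃ hD : (v, w) ∈ M.D, (corners M).IsGlb S ⟨(v, w), hD⟩ := by
  obtain ⟨s, hs⟩ := hS
  have hvs : ∀ s ∈ S, s.1.1 = v := fun s hs => hv hs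
  refine ⟨hw.2 _ (forall_mem_image.2 fun t ht => ?_), fun t ht =>
    ⟨(hvs t ht).symm, hw.1 _ (mem_image_of_mem _ ht)⟩, fun q hq => ⟨?_, ?_⟩⟩
  · rw [← hvs t ht]
    exact t.2
  · exact (hq s hs).1.trans (hvs s hs)
  · exact hw.2 _ (forall_mem_image.2 fun t ht => (hq t ht).2)

theorem proj_image_snd_corners {v : M.C} {S : Set (corners M).C}
    (hv : S ⊆ (corners M).proj ⁻¹' {v}) :
    (fun p : (corners M).C => p.1.2) '' S ⊆ M.proj ⁻¹' {M.proj v} := by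
  rintro _ ⟨s, hs, rfl⟩
  have h1 : s.1.1 = v := hv hs
  exact (M.D_proj _ s.2).symm.trans (congrArg M.proj h1)

theorem corners_antisymm (hM : M.IsSManC) {p q : (corners M).C} (h1 : (p, q) ∈ (corners M).D)
    (h2 : (q, p) ∈ (corners M).D) : p = q :=
  Subtype.ext (Prod.ext h1.1 (hM.D_antisymm _ _ h1.2 h2.2))

theorem isLub_snd_of_isLub_corners (hM : M.IsSManC) {v : M.C} {S : Set (corners M).C}
    (hS : S.Nonempty) (hv : S ⊆ (corners M).proj ⁻¹' {v}) {p : (corners M).C}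
    (hp : (corners M).IsLub S p) : M.IsLub ((fun p : (corners M).C => p.1.2) '' S) p.1.2 := by
  obtain ⟨w, hw⟩ := hM.exists_lub _ _ (hS.image _) (proj_image_snd_corners hv)
  obtain ⟨hD, hq⟩ := exists_isLub_corners hM hS hv hw
  rw [corners_antisymm hM (hp.2 _ hq.1) (hq.2 _ hp.1)]
  exact hw

theorem isGlb_snd_of_isGlb_corners (hM : M.IsSManC) {v : M.C} {S : Set (corners M).C}
    (hS : S.Nonempty) (hv : S ⊆ (corners M).proj ⁻¹' {v}) {p : (corners M).C}
    (hp : (corners M).IsGlb S p) : M.IsGlb ((fun p : (corners M).C => p.1.2) '' S) p.1.2 := by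
  obtain ⟨w, hw⟩ := hM.exists_glb _ _ (hS.image _) (proj_image_snd_corners hv)
  obtain ⟨hD, hq⟩ := exists_isGlb_corners hS hv hw
  rw [corners_antisymm hM (hq.2 _ hp.1) (hp.2 _ hq.1)]
  exact hw

theorem isProperMap_D_fst (hM : M.IsSManC) : IsProperMap (fun p : M.D => p.1.1) := by
  have hF := hM.isFibre_D
  have := hM.corners_isSMan.hausdorff
  have := hM.corners_isSMan.locallyCompact
  refine isProperMap_iff_isCompact_preimage.2 ⟨hF.continuous_fst, fun K hK => ?_⟩
  have h1 := hK.prod (hM.proj_proper.isCompact_preimage (hK.image hM.proj_smooth.continuous))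
  have h2 := (IsClosedEmbedding.mk hF.isEmbedding hF.isClosed_range).isCompact_preimage h1
  convert! h2 using 1
  ext p
  exact ⟨fun hp => ⟨hp, p.1.1, hp, M.D_proj _ p.2⟩, fun hp => hp.1⟩

theorem isClosed_corners_D (hM : M.IsSManC) : IsClosed (corners M).D := by
  have := hM.corners_isSMan.hausdorff
  have h1 : IsClosed M.D := by
    have := hM.isFibre_D.isClosed_range
    convert! this using 1
    ext p
    exact ⟨fun hp => ⟨⟨p, hp⟩, rfl⟩, fun ⟨q, hq⟩ => hq ▸ q.2⟩
  have c1 := hM.isFibre_D.continuous_fst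
  have c2 := hM.isFibre_D.continuous_snd
  exact (isClosed_eq (c1.comp continuous_fst) (c1.comp continuous_snd)).inter
    (h1.preimage ((c2.comp continuous_fst).prodMk (c2.comp continuous_snd)))

theorem corners_proj_covering (hM : M.IsSManC) (S : Set (corners M).C)
    (hS : S ∈ (corners M).C.strata) :
    (corners M).proj '' S ∈ (corners M).X.strata ∧
    IsProperMap (fun u : S => (⟨(corners M).proj u, mem_image_of_mem _ u.2⟩ :
      (corners M).proj '' S)) ∧
    ∀ u ∈ S, ∀ p q, ∀ a ∈ (corners M).C.charts p, ∀ b ∈ (corners M).X.charts q,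
      u ∈ a.source → (corners M).proj u ∈ b.source →
      Function.Bijective (tangentMap (corners M).proj a b u) := by
  obtain ⟨w, rfl⟩ : ∃ w, S = (corners M).C.stratum w := hS
  have hF := hM.isFibre_D
  refine ⟨⟨w.1.1, Subset.antisymm ?_ ?_⟩, isProperMap_imageFactorization ?_, ?_⟩
  · rintro _ ⟨w', hw', rfl⟩
    exact hw'.1
  · intro u hu
    have h1 : M.X.rel (M.proj w.1.2) (M.proj u) := by
      rw [← M.D_proj _ w.2]
      exact hM.proj_smooth.map_rel _ _ (M.C.rel.symm' hu)
    obtain ⟨v, hv, hvu⟩ := hM.exists_of_rel_proj h1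
    have hD : (u, v) ∈ M.D := hM.D_strata _ _ _ _ w.2 (M.C.rel.symm' hu) hv hvu.symm
    exact ⟨⟨(u, v), hD⟩, ⟨hu, M.C.rel.symm' hv⟩, rfl⟩
  · have i1 : IsEmbedding (fun u : (corners M).C.stratum w =>
        ((⟨u.1.1.1, u.2.1⟩, ⟨u.1.1.2, u.2.2⟩) : M.C.stratum w.1.1 × M.C.stratum w.1.2)) := by
      refine IsEmbedding.of_comp ?_ (IsEmbedding.subtypeVal.prodMap IsEmbedding.subtypeVal).continuous
        (IsEmbedding.subtypeVal.comp IsEmbedding.subtypeVal)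
      exact ((hF.continuous_fst.comp continuous_subtype_val).subtype_mk _).prodMk
        ((hF.continuous_snd.comp continuous_subtype_val).subtype_mk _)
    have i2 := ((hM.isEmbedding_proj_stratum w.1.1).prodMap
      (hM.isEmbedding_proj_stratum w.1.2)).comp i1
    -- both components of this embedding in `X × X` are determined by the first projection
    have i3 : IsEmbedding ((fun u : M.C => (M.proj u, M.proj u)) ∘
        fun u : (corners M).C.stratum w => u.1.1.1) := by
      convert! i2 using 1
      exact funext fun u => Prod.ext rfl (M.D_proj _ u.1.2)
    exact IsEmbedding.of_comp (hF.continuous_fst.comp continuous_subtype_val)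
      (hM.proj_smooth.continuous.prodMk hM.proj_smooth.continuous) i3
  · intro u _ p q a ha b hb hua hub
    obtain ⟨c, hc, huc⟩ := hM.corners_isSMan.exists_chart u.1.2
    refine bijective_of_injective_of_eq ?_ fun v hv => ?_
    · rw [← (hM.isSMan_D.isStratumChart p a ha).sdim_eq u hua,
        ← (hM.corners_isSMan.isStratumChart q b hb).sdim_eq _ hub]
      refine (hM.sdim_D u).trans ?_
      rw [← hM.sdim_proj, ← M.D_proj _ u.2, hM.sdim_proj]
      rfl
    · exact ha.2.2.2 _ b hb _ c hc u hua hub huc v hv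
        ((hM.tangentMap_D_eq_zero_iff ha hb hc hua hub huc v).1 hv)

theorem isClopen_corners_D (hM : M.IsSManC) : IsClopen {p : {p : (corners M).C × (corners M).C //
    (corners M).proj p.1 = (corners M).proj p.2} | p.1 ∈ (corners M).D} := by
  let T := {p : (corners M).C × (corners M).C // (corners M).proj p.1 = (corners M).proj p.2}
  have hp : ∀ p : T, M.proj p.1.1.1.2 = M.proj p.1.2.1.2 := fun p => by
    have h1 : p.1.1.1.1 = p.1.2.1.1 := p.2
    rw [← M.D_proj _ p.1.1.2, ← M.D_proj _ p.1.2.2]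
    exact congrArg M.proj h1
  let φ : T → {p : M.C × M.C // M.proj p.1 = M.proj p.2} := fun p =>
    ⟨(p.1.1.1.2, p.1.2.1.2), hp p⟩
  have c2 : Continuous (fun p : (corners M).C => p.1.2) := hM.isFibre_D.continuous_snd
  have hφ : Continuous φ := Continuous.subtype_mk
    ((c2.comp (continuous_fst.comp continuous_subtype_val)).prodMk
      (c2.comp (continuous_snd.comp continuous_subtype_val))) _
  convert! hM.D_clopen.preimage hφ using 1
  ext p
  exact ⟨fun h => h.2, fun h => ⟨p.2, h⟩⟩

theorem isProperMap_corners_D (hM : M.IsSManC) :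
    IsProperMap (fun p : (corners M).D => p.1.2) := by
  have : T2Space (corners M).C := hM.isSMan_D.hausdorff
  have : LocallyCompactSpace (corners M).C := hM.isSMan_D.locallyCompact
  refine isProperMap_iff_isCompact_preimage.2
    ⟨continuous_snd.comp continuous_subtype_val, fun K hK => ?_⟩
  have h1 := ((isProperMap_D_fst hM).isCompact_preimage
    (hK.image hM.isFibre_D.continuous_fst)).prod hK
  have h2 := (isClosed_corners_D hM).isClosedEmbedding_subtypeVal.isCompact_preimage h1
  convert! h2 using 1
  ext p
  exact ⟨fun hp => ⟨⟨p.1.2, hp, p.2.1.symm⟩, hp⟩, fun hp => hp.2⟩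

/-- An element `((u, v), (u, w))` of the corners of corners is determined by `u` and `(v, w) ∈ D(X)`, and
`(u, w)` is given; so local injectivity and the local inverses come from `D(X) → C(X)`. -/
theorem isLocalHomeomorph_corners_D (hM : M.IsSManC) :
    IsLocalHomeomorph (fun p : (corners M).D => p.1.2) := by
  have hF := hM.isFibre_D
  let ρ : (corners M).D → M.D := fun p => ⟨(p.1.1.1.2, p.1.2.1.2), p.2.2⟩
  have c2 : Continuous (fun p : (corners M).C => p.1.2) := hF.continuous_snd
  have hρ : Continuous ρ := Continuous.subtype_mk
    ((c2.comp (continuous_fst.comp continuous_subtype_val)).prodMk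
      (c2.comp (continuous_snd.comp continuous_subtype_val))) _
  refine isLocalHomeomorph_of_locally_injective (continuous_snd.comp continuous_subtype_val) ?_ ?_
  · intro p
    obtain ⟨U, hU, hUi⟩ := IsLocalHomeomorph.exists_injOn hM.D_localHomeomorph (ρ p)
    refine ⟨_, hρ.continuousAt.preimage_mem_nhds hU, fun s hs t ht he => ?_⟩
    have e0 : s.1.2 = t.1.2 := he
    have e1' : (ρ s).1.2 = (ρ t).1.2 := by
      change s.1.2.1.2 = t.1.2.1.2
      rw [e0]
    have e1 : ρ s = ρ t := hUi hs ht e1'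
    have e2 : s.1.1.1.2 = t.1.1.1.2 := congrArg (fun q : M.D => q.1.1) e1
    have e3 : s.1.1.1.1 = t.1.1.1.1 := by
      have h1 : s.1.1.1.1 = s.1.2.1.1 := s.2.1
      have h2 : t.1.1.1.1 = t.1.2.1.1 := t.2.1
      rw [h1, h2, e0]
    exact Subtype.ext (Prod.ext (Subtype.ext (Prod.ext e3 e2)) e0)
  · intro p U hU
    rw [Filter.mem_map, nhds_subtype_eq_comap, nhds_prod_eq] at hU
    obtain ⟨N, hN, hsub⟩ := Filter.mem_comap.1 hU
    obtain ⟨A, hA, B, hB, hAB⟩ := Filter.mem_prod_iff.1 hN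
    obtain ⟨A', hA', hAsub⟩ := mem_nhds_subtype _ _ _ |>.1 hA
    obtain ⟨O, hO, hOp, hOD⟩ := hF.exists_open
    have h1 := Filter.inter_mem hA' (hO.mem_nhds (hOp p.1.1))
    rw [nhds_prod_eq] at h1
    obtain ⟨U₁, hU₁, U₂, hU₂, hU₁₂⟩ := Filter.mem_prod_iff.1 h1
    have n1 := (hF.continuous_fst.continuousAt (x := ρ p)).preimage_mem_nhds hU₂
    have m1 := Filter.image_mem_map (m := fun q : M.D => q.1.2) n1
    rw [hM.D_localHomeomorph.map_nhds_eq] at m1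
    have hU₁' : U₁ ∈ 𝓝 p.1.2.1.1 := by
      have h2 : p.1.1.1.1 = p.1.2.1.1 := p.2.1
      exact h2 ▸ hU₁
    filter_upwards [hF.continuous_fst.continuousAt.preimage_mem_nhds hU₁',
      hF.continuous_snd.continuousAt.preimage_mem_nhds (m1 : _ ∈ 𝓝 p.1.2.1.2), hB] with w w1 w2 w3
    obtain ⟨q, hq, hqw⟩ := w2
    have hqw' : q.1.2 = w.1.2 := hqw
    have hmem := hU₁₂ (show (w.1.1, q.1.1) ∈ U₁ ×ˢ U₂ from ⟨w1, hq⟩)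
    obtain ⟨r, hr1, hr2⟩ := hOD _ _ hmem.2
      (by rw [M.D_proj _ w.2, M.D_proj _ q.2]; exact congrArg M.proj hqw'.symm)
    have hrA : r ∈ A := hAsub (show (r.1.1, r.1.2) ∈ A' by rw [hr1, hr2]; exact hmem.1)
    have hrD : (r, w) ∈ (corners M).D := ⟨hr1, by
      change (r.1.2, w.1.2) ∈ M.D
      rw [hr2, ← hqw']
      exact q.2⟩
    exact hsub (show (⟨(r, w), hrD⟩ : (corners M).D) ∈ _ from hAB ⟨hrA, w3⟩)

/-- The corners of an s-manifold with corners are an s-manifold with corners of mixed dimension. -/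
theorem isSManC_corners (hM : M.IsSManC) : (corners M).IsSManC where
  isSMan := hM.corners_isSMan
  corners_isSMan := hM.isSMan_D
  codim_nonneg p := by
    have := hM.D_codim _ p.2
    rw [codim_corners]
    omega
  proj_smooth := hM.smooth_D_fst
  proj_proper := isProperMap_D_fst hM
  proj_locallyClosedEmbedding p := by
    have := hM.isSMan_D.locallyCompact
    have := hM.corners_isSMan.hausdorff
    obtain ⟨V, hV, hpV, hVi, -⟩ := hM.proj_locallyClosedEmbedding p.1.2
    refine exists_isEmbedding_isLocallyClosed hM.smooth_D_fst.continuous p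
      ⟨_, (hV.preimage hM.isFibre_D.continuous_snd).mem_nhds hpV, fun s hs t ht he => ?_⟩
    have he' : s.1.1 = t.1.1 := he
    refine Subtype.ext (Prod.ext he' (injOn_iff_injective.2 hVi.injective hs ht ?_))
    rw [← M.D_proj _ s.2, ← M.D_proj _ t.2, he']
  zero_iso := by
    refine ⟨fun v => ⟨(v, v), hM.D_refl v⟩, hM.smooth_D_lift hM.corners_isSMan
      (.id hM.corners_isSMan) (.id hM.corners_isSMan), fun v => ⟨?_, rfl⟩, fun p hp => ?_⟩
    · exact (codim_corners _).trans (sub_self _)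
    · rw [codim_corners] at hp
      exact Subtype.ext (Prod.ext rfl (hM.D_level _ _ p.2
        (show M.codim p.1.1 = M.codim p.1.2 by omega)))
  proj_covering := corners_proj_covering hM
  D_codim P hP := by
    have h1 := hM.D_codim _ hP.2
    have h2 : P.1.1.1 = P.2.1.1 := hP.1
    rw [codim_corners, codim_corners, h2]
    exact sub_le_sub_right h1 _
  D_clopen := isClopen_corners_D hM
  D_strata p q p' q' hD hp hq he := by
    refine ⟨he, hM.D_strata _ _ _ _ hD.2 hp.2 hq.2 ?_⟩
    have he' : p'.1.1 = q'.1.1 := he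
    rw [← M.D_proj _ p'.2, ← M.D_proj _ q'.2, he']
  D_proper := isProperMap_corners_D hM
  D_localHomeomorph := isLocalHomeomorph_corners_D hM
  D_refl p := ⟨rfl, hM.D_refl _⟩
  D_antisymm p q hpq hqp := corners_antisymm hM hpq hqp
  D_trans p q r hpq hqr := ⟨hpq.1.trans hqr.1, hM.D_trans _ _ _ hpq.2 hqr.2⟩
  D_level p q hD hc := by
    have h1 : p.1.1 = q.1.1 := hD.1
    rw [codim_corners, codim_corners, h1] at hc
    exact Subtype.ext (Prod.ext h1 (hM.D_level _ _ hD.2 (by omega)))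
  exists_lub v S hS hv := by
    obtain ⟨w, hw⟩ := hM.exists_lub _ _ (hS.image _) (proj_image_snd_corners hv)
    obtain ⟨hD, hq⟩ := exists_isLub_corners hM hS hv hw
    exact ⟨_, hq⟩
  exists_glb v S hS hv := by
    obtain ⟨w, hw⟩ := hM.exists_glb _ _ (hS.image _) (proj_image_snd_corners hv)
    obtain ⟨hD, hq⟩ := exists_isGlb_corners hS hv hw
    exact ⟨_, hq⟩

theorem mem_interior_corners_iff (hM : M.IsSManC) (p : (corners M).C) :
    p ∈ (corners M).interior ↔ p.1.2 ∈ M.interior := by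
  rw [(isSManC_corners hM).mem_interior_iff, hM.mem_interior_iff]
  constructor
  · intro h w hw
    have := h ⟨(p.1.1, w), hM.D_trans _ _ _ p.2 hw⟩ ⟨rfl, hw⟩
    exact congrArg (fun q : (corners M).C => q.1.2) this
  · intro h q hq
    exact Subtype.ext (Prod.ext hq.1.symm (h _ hq.2))

end Corners

section CornersMap

variable {M N P : PreSManC.{u}}

theorem smooth_cornersMap_corner (hM : M.IsSManC) (hN : N.IsSManC) {f : SCMap M N}
    (hf : f.IsMorphism) : IsSmooth (corners M).C (corners N).C (cornersMap f).corner :=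
  hN.smooth_D_lift hM.isSMan_D
    (hf.corner_smooth.comp hM.isSMan_D hM.corners_isSMan hN.corners_isSMan hM.smooth_D_fst)
    (hf.corner_smooth.comp hM.isSMan_D hM.corners_isSMan hN.corners_isSMan hM.smooth_D_snd)

theorem isBNormal_cornersMap (hM : M.IsSManC) (hN : N.IsSManC) {f : SCMap M N}
    (hf : f.IsBNormal) : (cornersMap f).IsBNormal where
  base_smooth := hf.corner_smooth
  corner_smooth := smooth_cornersMap_corner hM hN hf.toIsMorphism
  map_interior p hp := (mem_interior_corners_iff hN _).2
    (hf.map_interior _ ((mem_interior_corners_iff hM p).1 hp))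
  map_lub v S hS hv p hp := by
    have h1 := hf.map_lub _ _ (hS.image _) (proj_image_snd_corners hv) _
      (isLub_snd_of_isLub_corners hM hS hv hp)
    have h2 : (cornersMap f).corner '' S ⊆ (corners N).proj ⁻¹' {f.corner v} := by
      rintro _ ⟨s, hs, rfl⟩
      exact congrArg f.corner (hv hs)
    obtain ⟨s, hs⟩ := hS
    have h3 : (fun q : (corners N).C => q.1.2) '' ((cornersMap f).corner '' S) =
        f.corner '' ((fun q : (corners M).C => q.1.2) '' S) := by
      rw [image_image, image_image]
      rfl
    obtain ⟨hD, hq⟩ := exists_isLub_corners hN ⟨_, mem_image_of_mem _ hs⟩ h2 (h3 ▸ h1)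
    have h4 : v = p.1.1 := (hv hs).symm.trans (hp.1 s hs).1
    have h5 : (cornersMap f).corner p = ⟨(f.corner v, f.corner p.1.2), hD⟩ :=
      Subtype.ext (Prod.ext (congrArg f.corner h4.symm) rfl)
    rwa [h5]
  map_glb v S hS hv p hp := by
    have h1 := hf.map_glb _ _ (hS.image _) (proj_image_snd_corners hv) _
      (isGlb_snd_of_isGlb_corners hM hS hv hp)
    have h2 : (cornersMap f).corner '' S ⊆ (corners N).proj ⁻¹' {f.corner v} := by
      rintro _ ⟨s, hs, rfl⟩
      exact congrArg f.corner (hv hs)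
    obtain ⟨s, hs⟩ := hS
    have h3 : (fun q : (corners N).C => q.1.2) '' ((cornersMap f).corner '' S) =
        f.corner '' ((fun q : (corners M).C => q.1.2) '' S) := by
      rw [image_image, image_image]
      rfl
    obtain ⟨hD, hq⟩ := exists_isGlb_corners ⟨_, mem_image_of_mem _ hs⟩ h2 (h3 ▸ h1)
    have h4 : p.1.1 = v := (hp.1 s hs).1.trans (hv hs)
    have h5 : (cornersMap f).corner p = ⟨(f.corner v, f.corner p.1.2), hD⟩ :=
      Subtype.ext (Prod.ext (congrArg f.corner h4) rfl)
    rwa [h5]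
  codim_le p := by
    have h1 := hf.codim_D _ p.2
    rw [codim_corners, codim_corners]
    exact h1.2.2
  codim_D P hP := by
    have h1 := hf.codim_D _ P.1.2
    have h2 := hf.codim_D _ hP.2
    have h3 : P.1.1.1 = P.2.1.1 := hP.1
    simp only [codim_corners]
    simp only at h1 h2
    change N.codim (f.corner P.1.1.2) - N.codim (f.corner P.1.1.1) ≤ _ ∧
      0 ≤ N.codim (f.corner P.2.1.2) - N.codim (f.corner P.2.1.1) -
        (N.codim (f.corner P.1.1.2) - N.codim (f.corner P.1.1.1)) ∧
      N.codim (f.corner P.2.1.2) - N.codim (f.corner P.2.1.1) -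
        (N.codim (f.corner P.1.1.2) - N.codim (f.corner P.1.1.1)) ≤ _
    rw [← h3]
    omega

variable {g : SCMap M P} {h : SCMap N P}

/-- The maps `D(X) → C(X)` are étale and take the corner maps of `C(g)` and `C(h)` to `C(g)` and `C(h)`,
so the corner maps inherit transversality. -/
theorem isTransverse_cornersMap (hM : M.IsSManC) (hN : N.IsSManC) (hP : P.IsSManC)
    (ht : IsTransverse g h) : IsTransverse (cornersMap g) (cornersMap h) where
  left_bNormal := isBNormal_cornersMap hM hP ht.left_bNormal
  right_bNormal := isBNormal_cornersMap hN hP ht.right_bNormal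
  base := ht.corner
  corner := IsTransverseSMan.of_etale hM.corners_isSMan hN.corners_isSMan hP.corners_isSMan
    hM.isSMan_D hN.isSMan_D hP.isSMan_D ht.left_bNormal.corner_smooth ht.right_bNormal.corner_smooth
    (smooth_cornersMap_corner hM hP ht.left_bNormal.toIsMorphism)
    (smooth_cornersMap_corner hN hP ht.right_bNormal.toIsMorphism)
    hM.etale_D_snd hN.etale_D_snd hP.etale_D_snd (fun _ => rfl) (fun _ => rfl) ht.corner

/-! ### The square of corners -/

/-- The map to the corners of the fibre product with given components. -/
def cornersLift {T : PreSManC.{u}} (e : SCMap T (corners M)) (f : SCMap T (corners N))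
    (hef : (cornersMap g).comp e = (cornersMap h).comp f) : SCMap T (corners (pullback g h)) where
  base t := ⟨(e.base t, f.base t), congrFun (congrArg SCMap.base hef) t⟩
  corner t := ⟨(⟨((e.corner t).1.1, (f.corner t).1.1), congrArg (fun q : P.D => q.1.1)
      (congrFun (congrArg SCMap.corner hef) t)⟩,
    ⟨((e.corner t).1.2, (f.corner t).1.2), congrArg (fun q : P.D => q.1.2)
      (congrFun (congrArg SCMap.corner hef) t)⟩), (e.corner t).2, (f.corner t).2⟩
  comm t := Subtype.ext (Prod.ext (e.comm t) (f.comm t))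
  map_D p hp := ⟨Subtype.ext (Prod.ext (e.map_D p hp).1 (f.map_D p hp).1),
    (e.map_D p hp).2, (f.map_D p hp).2⟩

theorem isMorphism_cornersLift (hM : M.IsSManC) (hN : N.IsSManC) (hP : P.IsSManC)
    (ht : IsTransverse g h) {T : PreSManC.{u}} (hT : T.IsSManC) {e : SCMap T (corners M)}
    {f : SCMap T (corners N)} (hef : (cornersMap g).comp e = (cornersMap h).comp f)
    (he : e.IsMorphism) (hf : f.IsMorphism) : (cornersLift e f hef).IsMorphism where
  base_smooth := smooth_lift_C hM hN hP ht hT.isSMan he.base_smooth hf.base_smooth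
  corner_smooth := by
    have hTC := hT.corners_isSMan
    have hMC := hM.corners_isSMan
    have hNC := hN.corners_isSMan
    exact (isSManC_pullback hM hN hP ht).smooth_D_lift hTC
      (smooth_lift_C hM hN hP ht hTC (hM.smooth_D_fst.comp hTC hM.isSMan_D hMC he.corner_smooth)
        (hN.smooth_D_fst.comp hTC hN.isSMan_D hNC hf.corner_smooth))
      (smooth_lift_C hM hN hP ht hTC (hM.smooth_D_snd.comp hTC hM.isSMan_D hMC he.corner_smooth)
        (hN.smooth_D_snd.comp hTC hN.isSMan_D hNC hf.corner_smooth))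
  map_interior t htt := (mem_interior_corners_iff (isSManC_pullback hM hN hP ht) _).2
    ((mem_interior_pullback_iff hM hN hP ht _).2
      ⟨(mem_interior_corners_iff hM _).1 (he.map_interior t htt),
        (mem_interior_corners_iff hN _).1 (hf.map_interior t htt)⟩)

theorem cornersMap_comm : (cornersMap g).comp (cornersMap (pullbackFst g h)) =
    (cornersMap h).comp (cornersMap (pullbackSnd g h)) :=
  SCMap.ext (funext fun w => w.2)
    (funext fun p => Subtype.ext (Prod.ext p.1.1.2 p.1.2.2))

theorem corners_pullback_map_ext {T : PreSManC.{u}} {b b' : SCMap T (corners (pullback g h))}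
    (h1 : (cornersMap (pullbackFst g h)).comp b = (cornersMap (pullbackFst g h)).comp b')
    (h2 : (cornersMap (pullbackSnd g h)).comp b = (cornersMap (pullbackSnd g h)).comp b') :
    b = b' := by
  have k1 := fun t => congrFun (congrArg SCMap.base h1) t
  have k2 := fun t => congrFun (congrArg SCMap.base h2) t
  have k3 : ∀ t, ((b.corner t).1.1.1.1, (b.corner t).1.2.1.1) =
      ((b'.corner t).1.1.1.1, (b'.corner t).1.2.1.1) := fun t =>
    congrArg Subtype.val (congrFun (congrArg SCMap.corner h1) t)
  have k4 : ∀ t, ((b.corner t).1.1.1.2, (b.corner t).1.2.1.2) =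
      ((b'.corner t).1.1.1.2, (b'.corner t).1.2.1.2) := fun t =>
    congrArg Subtype.val (congrFun (congrArg SCMap.corner h2) t)
  refine SCMap.ext (funext fun t => Subtype.ext (Prod.ext (k1 t) (k2 t)))
    (funext fun t => Subtype.ext (Prod.ext ?_ ?_))
  · exact Subtype.ext (Prod.ext (Prod.ext_iff.1 (k3 t)).1 (Prod.ext_iff.1 (k4 t)).1)
  · exact Subtype.ext (Prod.ext (Prod.ext_iff.1 (k3 t)).2 (Prod.ext_iff.1 (k4 t)).2)

theorem isCartesianMixed_corners (hM : M.IsSManC) (hN : N.IsSManC) (hP : P.IsSManC)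
    (ht : IsTransverse g h) : IsCartesianMixed (cornersMap (pullbackFst g h))
      (cornersMap (pullbackSnd g h)) (cornersMap g) (cornersMap h) where
  obj := ⟨isSManC_corners (isSManC_pullback hM hN hP ht), isSManC_corners hM, isSManC_corners hN,
    isSManC_corners hP⟩
  mor := by
    have hW := isSManC_pullback hM hN hP ht
    exact ⟨(isBNormal_cornersMap hW hM (isBNormal_pullbackFst hM hN hP ht)).toIsMorphism,
      (isBNormal_cornersMap hW hN (isBNormal_pullbackSnd hM hN hP ht)).toIsMorphism,
      (isBNormal_cornersMap hM hP ht.left_bNormal).toIsMorphism,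
      (isBNormal_cornersMap hN hP ht.right_bNormal).toIsMorphism⟩
  comm := cornersMap_comm
  lift T e f hT he hf hef := ⟨cornersLift e f hef,
    ⟨isMorphism_cornersLift hM hN hP ht hT hef he hf, rfl, rfl⟩,
    fun _ hb => corners_pullback_map_ext hb.2.1 hb.2.2⟩

theorem isCartesianMixedIn_corners (hM : M.IsSManC) (hN : N.IsSManC) (hP : P.IsSManC)
    (ht : IsTransverse g h) : IsCartesianMixedIn (cornersMap (pullbackFst g h))
      (cornersMap (pullbackSnd g h)) (cornersMap g) (cornersMap h) where
  obj := (isCartesianMixed_corners hM hN hP ht).obj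
  mor := by
    have hW := isSManC_pullback hM hN hP ht
    exact ⟨(isBNormal_cornersMap hW hM (isBNormal_pullbackFst hM hN hP ht)).isInterior
        (isSManC_corners hM),
      (isBNormal_cornersMap hW hN (isBNormal_pullbackSnd hM hN hP ht)).isInterior
        (isSManC_corners hN),
      (isBNormal_cornersMap hM hP ht.left_bNormal).isInterior (isSManC_corners hP),
      (isBNormal_cornersMap hN hP ht.right_bNormal).isInterior (isSManC_corners hP)⟩
  comm := cornersMap_comm
  lift T e f hT he hf hef := by
    refine ⟨cornersLift e f hef,
      ⟨{ isMorphism_cornersLift hM hN hP ht hT hef he.toIsMorphism hf.toIsMorphism with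
          map_zero := fun t htt => ?_ }, rfl, rfl⟩,
      fun _ hb => corners_pullback_map_ext hb.2.1 hb.2.2⟩
    have h1 := he.map_zero t htt
    have h2 := hf.map_zero t htt
    rw [codim_corners] at h1 h2
    have e1 := hM.D_level _ _ (e.corner t).2
      (show M.codim (e.corner t).1.1 = M.codim (e.corner t).1.2 by omega)
    have e2 := hN.D_level _ _ (f.corner t).2
      (show N.codim (f.corner t).1.1 = N.codim (f.corner t).1.2 by omega)
    rw [codim_corners, sub_eq_zero]
    exact congrArg _ (Subtype.ext (Prod.ext e1.symm e2.symm))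

end CornersMap

/-! ### Restriction to open subsets -/

section Restrict

variable {X : PreSMan.{u}} {U : Set X}

theorem isStratumChart_restrict (hX : X.IsSMan) (hU : IsOpen U) (p : ℕ)
    (c : Chart (X.restrict U) p) (hc : c ∈ (X.restrict U).charts p) :
    c.IsStratumChart (X.restrict U).rel (X.restrict U).sdim := by
  obtain ⟨a, ha, rfl⟩ := hc
  have h := hX.isStratumChart p a ha
  refine ⟨fun x hx => h.sdim_eq _ hx, fun x hx => ?_, ?_⟩
  · obtain ⟨O, hO, hOa⟩ := h.open_source _ hx
    exact ⟨Subtype.val ⁻¹' O, hO.preimage continuous_subtype_val,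
      congrArg (preimage Subtype.val) hOa⟩
  · let j : (Subtype.val ⁻¹' a.source : Set U) → a.source := fun x => ⟨x.1.1, x.2⟩
    have hj : IsOpenEmbedding j := by
      refine ⟨(IsEmbedding.subtypeVal.comp IsEmbedding.subtypeVal).codRestrict _ _, ?_⟩
      convert! hU.preimage (continuous_subtype_val (p := (· ∈ a.source))) using 1
      ext x
      exact ⟨fun ⟨y, hy⟩ => hy ▸ y.1.2, fun hx => ⟨⟨⟨x.1, hx⟩, x.2⟩, rfl⟩⟩
    exact h.isOpenEmbedding.comp hj

theorem corr_restrict {p : ℕ} (a : Chart X p) :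
    Chart.Corr (X' := X.restrict U) Subtype.val
      (⟨Subtype.val ⁻¹' a.source, fun x => a.map x.1⟩ : Chart (X.restrict U) p) a :=
  ⟨fun _ => Iff.rfl, fun _ _ => rfl⟩

theorem hasLocalOrder_restrict (hX : X.IsSMan) (x : X.restrict U) :
    (X.restrict U).HasLocalOrder x := by
  obtain ⟨V, le, hV, hxV, hdim, hfin, hrel, h1, h2, h3, h4, h5⟩ := hX.hasLocalOrder x.1
  refine ⟨Subtype.val ⁻¹' V, fun s t => le s.1 t.1, hV.preimage continuous_subtype_val, hxV,
    fun y hy => hdim _ hy, ?_, fun s s' t t' hs ht => hrel _ _ _ _ hs ht, fun s hs => h1 _ hs,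
    fun s hs t ht => h2 _ hs _ ht, fun s hs t ht r hr => h3 _ hs _ ht _ hr, ?_,
    fun s hs t ht hne hle => h5 _ hs _ ht hne hle⟩
  · refine (hfin.image (preimage Subtype.val)).subset ?_
    rintro _ ⟨s, hs, rfl⟩
    exact ⟨_, mem_image_of_mem _ hs, rfl⟩
  · intro s hs t ht hcl
    refine h4 _ hs _ ht (closure_mono (image_subset_iff.2 fun y hy => ?_)
      (image_closure_subset_closure_image (continuous_subtype_val (p := (· ∈ U)))
        (mem_image_of_mem _ hcl)))
    exact hy

theorem isSMan_restrict (hX : X.IsSMan) (hU : IsOpen U) : (X.restrict U).IsSMan where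
  locallyCompact := by
    have := hX.locallyCompact
    exact hU.locallyCompactSpace
  hausdorff := by
    have := hX.hausdorff
    exact (inferInstance : T2Space U)
  secondCountable := by
    have := hX.secondCountable
    exact (inferInstance : SecondCountableTopology U)
  locallyClosed := by
    rintro _ ⟨y, rfl⟩
    exact (hX.locallyClosed _ (X.stratum_mem_strata y.1)).preimage
      (continuous_subtype_val (p := (· ∈ U)))
  countable := by
    refine (hX.countable.image (preimage Subtype.val)).mono ?_
    rintro _ ⟨y, rfl⟩
    exact ⟨_, X.stratum_mem_strata y.1, rfl⟩
  sdim_rel _ _ h := hX.sdim_rel _ _ h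
  dim_rel _ _ h := hX.dim_rel _ _ h
  dim_locallyConstant := hX.dim_locallyConstant.comp_continuous
    (continuous_subtype_val (p := (· ∈ U)))
  sdim_le x := hX.sdim_le x.1
  isStratumChart := isStratumChart_restrict hX hU
  exists_chart x := by
    obtain ⟨a, ha, hax⟩ := hX.exists_chart x.1
    exact ⟨_, ⟨a, ha, rfl⟩, hax⟩
  compatible := by
    intro p a' ha' b' hb'
    have h := ((isStratumChart_restrict hX hU p a' ha').contDiffOn_iff
      (isStratumChart_restrict hX hU p b' hb') continuous_id (fun _ _ h => h)).2
    refine h fun x hx hx' => ?_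
    have hE := (isStratumChart_restrict hX hU p a' ha').isOpenEmbedding
    obtain ⟨a, ha, rfl⟩ := ha'
    obtain ⟨b, hb, rfl⟩ := hb'
    exact ((corr_restrict a).smoothAt_iff hE (hX.emb ha) b.map hx).2 (hX.smoothAt_map ha hb hx hx')
  embeds x := by
    obtain ⟨V, N, F, hV, hxV, hF, hFs⟩ := hX.embeds x.1
    refine ⟨Subtype.val ⁻¹' V, N, fun y => F y.1, hV.preimage continuous_subtype_val, hxV,
      ?_, ?_⟩
    · exact hF.comp ((IsEmbedding.subtypeVal.comp IsEmbedding.subtypeVal).codRestrict V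
        (fun y : (Subtype.val ⁻¹' V : Set U) => y.2))
    · intro p a' ha'
      have hE := (isStratumChart_restrict hX hU p a' ha').isOpenEmbedding
      obtain ⟨a, ha, rfl⟩ := ha'
      have hopen : ∀ {Y : PreSMan.{u}} {c : Chart Y p} {O : Set Y} (_ : IsOpen O),
          ∀ y ∈ c.source, y ∈ O → ∀ᶠ y' in 𝓝[c.source] y, y' ∈ O := fun hO y _ hy =>
        mem_nhdsWithin_of_mem_nhds (hO.mem_nhds hy)
      obtain ⟨h1, h2⟩ := hFs p a ha
      refine ⟨(Chart.contDiffOn_iff hE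
        (hopen (Y := X.restrict U) (hV.preimage continuous_subtype_val))).2 fun y hy hyV => ?_,
        fun y hy => ?_⟩
      · exact ((corr_restrict a).smoothAt_iff hE (hX.emb ha) F hy).2
          ((Chart.contDiffOn_iff (hX.emb ha) (hopen hV)).1 h1 _ hy hyV)
      · have h3 := (corr_restrict a).rep_eventuallyEq hE (hX.emb ha) F hy.1
        have h4 := h2 y.1 hy
        rw [← h3.fderiv_eq] at h4
        exact h4
  localOrder x := PreSMan.HasLocalOrder.localOrder (X := X.restrict U)
    (fun _ _ h => hX.sdim_rel _ _ h) (hasLocalOrder_restrict hX x)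

theorem isEtale_restrict_val (hX : X.IsSMan) (hU : IsOpen U) :
    IsEtale (X.restrict U) X Subtype.val where
  toIsSmooth := by
    refine .of_smoothAt (isStratumChart_restrict hX hU) hX.isStratumChart continuous_subtype_val
      (fun _ _ h => h) fun p q a' ha' b hb x hx hx' => ?_
    have hE := (isStratumChart_restrict hX hU p a' ha').isOpenEmbedding
    obtain ⟨a, ha, rfl⟩ := ha'
    exact ((corr_restrict a).smoothAt_iff hE (hX.emb ha) b.map hx).2 (hX.smoothAt_map ha hb hx hx')
  sdim_eq _ := rfl
  dim_eq _ := rfl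
  bijective x p q a' ha' b hb hx hx' := by
    have hE := (isStratumChart_restrict hX hU p a' ha').isOpenEmbedding
    obtain ⟨a, ha, rfl⟩ := ha'
    have h := (corr_restrict a).tangentMap_eq hE (hX.emb ha) (fun x => x) b hx
    have h2 := tangentMap_id_bijective hX ha hb hx hx'
    rw [← h] at h2
    exact h2

theorem smooth_restrict_lift (hX : X.IsSMan) (hU : IsOpen U) {T : PreSMan.{u}}
    (hT : ∀ p, ∀ c ∈ T.charts p, c.IsStratumChart T.rel T.sdim)
    {f : T → X.restrict U} (hf : IsSmooth T X (fun t => (f t).1)) :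
    IsSmooth T (X.restrict U) f := by
  refine .of_smoothAt hT (isStratumChart_restrict hX hU)
    (continuous_induced_rng.2 hf.continuous) hf.map_rel fun p q a ha b' hb' x hx hx' => ?_
  obtain ⟨b, hb, rfl⟩ := hb'
  exact ((hT p a ha).contDiffOn_iff (hX.isStratumChart q b hb) hf.continuous hf.map_rel).1
    (hf.contDiffOn p q a ha b hb) x hx hx'

/-- A map is smooth if its restrictions to the sets of an open cover by unions of strata are. -/
theorem IsSmooth.of_restrict (hX : X.IsSMan) {Y : PreSMan.{u}}
    (hY : ∀ p, ∀ c ∈ Y.charts p, c.IsStratumChart Y.rel Y.sdim) {f : X → Y}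
    (h : ∀ x, ∃ V : Set X, IsOpen V ∧ x ∈ V ∧ (∀ y, X.rel x y → y ∈ V) ∧
      IsSmooth (X.restrict V) Y (fun y => f y.1)) : IsSmooth X Y f := by
  refine .of_smoothAt hX.isStratumChart hY ?_ ?_ ?_
  · refine continuous_iff_continuousAt.2 fun x => ?_
    obtain ⟨V, hV, hxV, -, hf⟩ := h x
    exact (continuousOn_iff_continuous_domRestrict.2 hf.continuous).continuousAt (hV.mem_nhds hxV)
  · intro x y hxy
    obtain ⟨V, -, hxV, hr, hf⟩ := h x
    exact hf.map_rel ⟨x, hxV⟩ ⟨y, hr y hxy⟩ hxy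
  · intro p q a ha b hb x hx hx'
    obtain ⟨V, hV, hxV, -, hf⟩ := h x
    have ha' : (⟨Subtype.val ⁻¹' a.source, fun y => a.map y.1⟩ : Chart (X.restrict V) p) ∈
        (X.restrict V).charts p := ⟨a, ha, rfl⟩
    have hE := isStratumChart_restrict hX hV p _ ha'
    refine ((corr_restrict a).smoothAt_iff hE.isOpenEmbedding (hX.emb ha) (b.map ∘ f)
      (x := (⟨x, hxV⟩ : V)) hx).1 ?_
    exact (hE.contDiffOn_iff (hY q b hb) hf.continuous hf.map_rel).1
      (hf.contDiffOn p q _ ha' b hb) ⟨x, hxV⟩ hx hx'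

end Restrict

section RestrictCorners

variable {M : PreSManC.{u}} {U : Set M.X}

theorem exists_isLub_restrict {S : Set (M.restrict U).C} (hS : S.Nonempty) {w : M.C}
    (hw : M.IsLub (Subtype.val '' S) w) :
    ∃ hU : w ∈ M.proj ⁻¹' U, (M.restrict U).IsLub S ⟨w, hU⟩ := by
  obtain ⟨s, hs⟩ := hS
  have h1 := M.D_proj _ (hw.1 _ (mem_image_of_mem _ hs))
  have h2 : w ∈ M.proj ⁻¹' U := by
    change M.proj w ∈ U
    rw [← h1]
    exact s.2
  exact ⟨h2, fun t ht => hw.1 _ (mem_image_of_mem _ ht),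
    fun v hv => hw.2 _ (forall_mem_image.2 hv)⟩

theorem exists_isGlb_restrict {S : Set (M.restrict U).C} (hS : S.Nonempty) {w : M.C}
    (hw : M.IsGlb (Subtype.val '' S) w) :
    ∃ hU : w ∈ M.proj ⁻¹' U, (M.restrict U).IsGlb S ⟨w, hU⟩ := by
  obtain ⟨s, hs⟩ := hS
  have h1 := M.D_proj _ (hw.1 _ (mem_image_of_mem _ hs))
  have h2 : w ∈ M.proj ⁻¹' U := by
    change M.proj w ∈ U
    rw [h1]
    exact s.2
  exact ⟨h2, fun t ht => hw.1 _ (mem_image_of_mem _ ht),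
    fun v hv => hw.2 _ (forall_mem_image.2 hv)⟩

theorem isSManC_restrict (hM : M.IsSManC) (hU : IsOpen U) : (M.restrict U).IsSManC := by
  have hUC : IsOpen (M.proj ⁻¹' U) := hU.preimage hM.proj_smooth.continuous
  have hX : (M.restrict U).X.IsSMan := isSMan_restrict hM.isSMan hU
  have hC : (M.restrict U).C.IsSMan := isSMan_restrict hM.corners_isSMan hUC
  have eX : IsEtale (M.restrict U).X M.X Subtype.val := isEtale_restrict_val hM.isSMan hU
  have eC : IsEtale (M.restrict U).C M.C Subtype.val :=
    isEtale_restrict_val hM.corners_isSMan hUC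
  have hsm : IsSmooth (M.restrict U).C (M.restrict U).X (M.restrict U).proj :=
    smooth_restrict_lift hM.isSMan hU hC.isStratumChart
      (hM.proj_smooth.comp hC hM.corners_isSMan hM.isSMan eC.toIsSmooth)
  -- the second projection of the restriction is that of `M` over an open set
  let e : (M.restrict U).D ≃ₜ (fun p : M.D => p.1.2) ⁻¹' (M.proj ⁻¹' U) :=
    { toFun := fun p => ⟨⟨(p.1.1.1, p.1.2.1), p.2⟩, p.1.2.2⟩
      invFun := fun q => ⟨(⟨q.1.1.1, by
        change M.proj q.1.1.1 ∈ U
        rw [M.D_proj _ q.1.2]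
        exact q.2⟩, ⟨q.1.1.2, q.2⟩), q.1.2⟩
      left_inv := fun _ => rfl
      right_inv := fun _ => rfl
      continuous_toFun := ((((eC.continuous.comp continuous_fst).prodMk
        (eC.continuous.comp continuous_snd)).comp continuous_subtype_val).subtype_mk _).subtype_mk _
      continuous_invFun := by
        have c := (continuous_subtype_val (p := (· ∈ M.D))).comp
          (continuous_subtype_val (p := (· ∈ (fun p : M.D => p.1.2) ⁻¹' (M.proj ⁻¹' U))))
        exact ((c.fst.subtype_mk _).prodMk (c.snd.subtype_mk _)).subtype_mk _ }
  have hUD : IsOpen ((fun p : M.D => p.1.2) ⁻¹' (M.proj ⁻¹' U)) :=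
    hUC.preimage hM.D_localHomeomorph.continuous
  have hfib : ∀ (x : (M.restrict U).X) (S : Set (M.restrict U).C),
      S ⊆ (M.restrict U).proj ⁻¹' {x} → Subtype.val '' S ⊆ M.proj ⁻¹' {x.1} := by
    rintro x S hS _ ⟨s, hs, rfl⟩
    exact congrArg Subtype.val (hS hs)
  refine
  { isSMan := hX
    corners_isSMan := hC
    codim_nonneg := fun u => hM.codim_nonneg u.1
    proj_smooth := hsm
    proj_proper := hM.proj_proper.restrictPreimage U
    proj_locallyClosedEmbedding := fun u => ?_
    zero_iso := ?_
    proj_covering := ?_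
    D_codim := fun p hp => hM.D_codim _ hp
    D_clopen := ?_
    D_strata := fun u v u' v' hD hu hv he =>
      hM.D_strata _ _ _ _ hD hu hv (congrArg Subtype.val he)
    D_proper := ?_
    D_localHomeomorph := ?_
    D_refl := fun u => hM.D_refl _
    D_antisymm := fun u v h1 h2 => Subtype.ext (hM.D_antisymm _ _ h1 h2)
    D_trans := fun u v w h1 h2 => hM.D_trans _ _ _ h1 h2
    D_level := fun u v h1 h2 => Subtype.ext (hM.D_level _ _ h1 h2)
    exists_lub := fun x S hS hx => ?_
    exists_glb := fun x S hS hx => ?_ }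
  · have := hC.locallyCompact
    have := hX.hausdorff
    obtain ⟨V, hV, huV, hVi, -⟩ := hM.proj_locallyClosedEmbedding u.1
    exact exists_isEmbedding_isLocallyClosed hsm.continuous u
      ⟨_, (hV.preimage eC.continuous).mem_nhds huV, fun s hs t ht he =>
        Subtype.ext (injOn_iff_injective.2 hVi.injective hs ht (congrArg Subtype.val he))⟩
  · obtain ⟨s, hs, hs1, hs2⟩ := hM.zero_iso
    refine ⟨fun x => ⟨s x.1, by
        change M.proj (s x.1) ∈ U
        rw [(hs1 x.1).2]
        exact x.2⟩, smooth_restrict_lift hM.corners_isSMan hUC hX.isStratumChart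
      (hs.comp hX hM.isSMan hM.corners_isSMan eX.toIsSmooth),
      fun x => ⟨(hs1 x.1).1, Subtype.ext (hs1 x.1).2⟩, fun u hu => Subtype.ext (hs2 _ hu)⟩
  · intro S hS
    obtain ⟨w, rfl⟩ : ∃ w, S = (M.restrict U).C.stratum w := hS
    refine ⟨⟨(M.restrict U).proj w, Subset.antisymm ?_ ?_⟩, isProperMap_imageFactorization ?_, ?_⟩
    · rintro _ ⟨w', hw', rfl⟩
      exact hM.proj_smooth.map_rel _ _ hw'
    · intro y hy
      have h1 : M.X.rel (M.proj w.1) y.1 := M.X.rel.symm' hy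
      obtain ⟨v, hv, hvy⟩ := hM.exists_of_rel_proj h1
      exact ⟨⟨v, (hvy.symm ▸ y.2 : M.proj v ∈ U)⟩, M.C.rel.symm' hv, Subtype.ext hvy⟩
    · have c : Continuous (fun u : (M.restrict U).C.stratum w => u.1) := continuous_subtype_val
      refine IsEmbedding.of_comp (hsm.continuous.comp c) (continuous_subtype_val (p := (· ∈ U))) ?_
      have i : IsEmbedding (Subtype.val : (M.restrict U).C → M.C) := IsEmbedding.subtypeVal
      exact (hM.isEmbedding_proj_stratum w.1).comp
        ((i.comp IsEmbedding.subtypeVal).codRestrict _ (fun u => u.2))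
    · intro u _ p q a ha b hb hua hub
      obtain ⟨c, hc, huc⟩ := hM.isSMan.exists_chart (M.proj u.1)
      have h1 := tangentMap_comp hC hX hM.isSMan eX.toIsSmooth hsm ha hb hc hua hub huc
      obtain ⟨d, hd, hud⟩ := hM.corners_isSMan.exists_chart u.1
      have h2 := tangentMap_comp hC hM.corners_isSMan hM.isSMan hM.proj_smooth eC.toIsSmooth
        ha hd hc hua hud huc
      have h3 := (hM.tangentMap_proj_bijective hd hc hud huc).comp
        (eC.bijective _ _ _ a ha d hd hua hud)
      have h4 := congrArg DFunLike.coe (h1.symm.trans h2)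
      rw [ContinuousLinearMap.coe_comp, ContinuousLinearMap.coe_comp] at h4
      rw [← h4] at h3
      exact (Function.Bijective.of_comp_iff' (eX.bijective _ _ _ b hb c hc hub huc) _).1 h3
  · let T := {p : (M.restrict U).C × (M.restrict U).C //
      (M.restrict U).proj p.1 = (M.restrict U).proj p.2}
    let φ : T → {p : M.C × M.C // M.proj p.1 = M.proj p.2} := fun p =>
      ⟨(p.1.1.1, p.1.2.1), congrArg Subtype.val p.2⟩
    have hφ : Continuous φ := Continuous.subtype_mk
      ((eC.continuous.comp (continuous_fst.comp continuous_subtype_val)).prodMk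
        (eC.continuous.comp (continuous_snd.comp continuous_subtype_val))) _
    exact hM.D_clopen.preimage hφ
  · exact (hM.D_proper.restrictPreimage (M.proj ⁻¹' U)).comp e.isProperMap
  · have h1 := (hM.D_localHomeomorph.comp hUD.isOpenEmbedding_subtypeVal.isLocalHomeomorph).comp
      e.isLocalHomeomorph
    exact IsLocalHomeomorph.of_comp (g := Subtype.val) h1
      hUC.isOpenEmbedding_subtypeVal.isLocalHomeomorph (continuous_snd.comp continuous_subtype_val)
  · obtain ⟨w, hw⟩ := hM.exists_lub _ _ (hS.image _) (hfib x S hx)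
    obtain ⟨hD, hq⟩ := exists_isLub_restrict hS hw
    exact ⟨_, hq⟩
  · obtain ⟨w, hw⟩ := hM.exists_glb _ _ (hS.image _) (hfib x S hx)
    obtain ⟨hD, hq⟩ := exists_isGlb_restrict hS hw
    exact ⟨_, hq⟩

end RestrictCorners

/-! ### Open embeddings of s-manifolds with corners -/

/-- `f` identifies `N` with the restriction of `B` to an open union of strata. Smoothness of the inverse
is expressed by the universal property: maps to `N` are smooth if their compositions with `f` are. -/
structure SCMap.IsOpenPart {N B : PreSManC.{u}} (f : SCMap N B) : Prop where
  base_smooth : IsSmooth N.X B.X f.base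
  corner_smooth : IsSmooth N.C B.C f.corner
  base_injective : Function.Injective f.base
  corner_injective : Function.Injective f.corner
  dim_base : ∀ x, B.X.dim (f.base x) = N.X.dim x
  dim_corner : ∀ u, B.C.dim (f.corner u) = N.C.dim u
  isOpen_range : IsOpen (range f.base)
  range_rel : ∀ x y, B.X.rel (f.base x) y → y ∈ range f.base
  mem_D : ∀ u v, (f.corner u, f.corner v) ∈ B.D → (u, v) ∈ N.D
  exists_corner : ∀ x c, B.proj c = f.base x → ∃ u, f.corner u = c
  smooth_base_of_comp : ∀ T : PreSMan.{u}, T.IsSMan → ∀ t : T → N.X,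
    IsSmooth T B.X (fun a => f.base (t a)) → IsSmooth T N.X t
  smooth_corner_of_comp : ∀ T : PreSMan.{u}, T.IsSMan → ∀ t : T → N.C,
    IsSmooth T B.C (fun a => f.corner (t a)) → IsSmooth T N.C t

namespace SCMap.IsOpenPart

variable {N B : PreSManC.{u}} {f : SCMap N B}

theorem codim_eq (hf : f.IsOpenPart) (u : N.C) : B.codim (f.corner u) = N.codim u := by
  rw [PreSManC.codim, PreSManC.codim, f.comm, hf.dim_base, hf.dim_corner]

theorem exists_corner_of_mem_D (hf : f.IsOpenPart) {u : N.C} {c : B.C}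
    (h : (f.corner u, c) ∈ B.D ∨ (c, f.corner u) ∈ B.D) : ∃ v, f.corner v = c := by
  refine hf.exists_corner (N.proj u) c ?_
  rw [← f.comm]
  rcases h with h | h
  · exact (B.D_proj _ h).symm
  · exact B.D_proj _ h

theorem mem_interior_iff (hf : f.IsOpenPart) (u : N.C) :
    f.corner u ∈ B.interior ↔ u ∈ N.interior := by
  constructor
  · rintro h ⟨v, hv, hlt⟩
    exact h ⟨f.corner v, f.map_D _ hv, by rwa [hf.codim_eq, hf.codim_eq]⟩
  · rintro h ⟨c, hc, hlt⟩
    obtain ⟨v, rfl⟩ := hf.exists_corner_of_mem_D (.inl hc)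
    rw [hf.codim_eq, hf.codim_eq] at hlt
    exact h ⟨v, hf.mem_D _ _ hc, hlt⟩

theorem isLub_image (hf : f.IsOpenPart) {S : Set N.C} (hS : S.Nonempty) {u : N.C} :
    B.IsLub (f.corner '' S) (f.corner u) ↔ N.IsLub S u := by
  obtain ⟨s, hs⟩ := hS
  constructor
  · intro h
    refine ⟨fun t ht => hf.mem_D _ _ (h.1 _ (mem_image_of_mem _ ht)), fun v hv =>
      hf.mem_D _ _ (h.2 _ (forall_mem_image.2 fun t ht => f.map_D (t, v) (hv t ht)))⟩
  · intro h
    refine ⟨forall_mem_image.2 fun t ht => f.map_D (t, u) (h.1 t ht), fun c hc => ?_⟩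
    obtain ⟨v, rfl⟩ := hf.exists_corner_of_mem_D (.inl (hc _ (mem_image_of_mem _ hs)))
    exact f.map_D (u, v) (h.2 v fun t ht => hf.mem_D _ _ (hc _ (mem_image_of_mem _ ht)))

theorem isGlb_image (hf : f.IsOpenPart) {S : Set N.C} (hS : S.Nonempty) {u : N.C} :
    B.IsGlb (f.corner '' S) (f.corner u) ↔ N.IsGlb S u := by
  obtain ⟨s, hs⟩ := hS
  constructor
  · intro h
    refine ⟨fun t ht => hf.mem_D _ _ (h.1 _ (mem_image_of_mem _ ht)), fun v hv =>
      hf.mem_D _ _ (h.2 _ (forall_mem_image.2 fun t ht => f.map_D (v, t) (hv t ht)))⟩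
  · intro h
    refine ⟨forall_mem_image.2 fun t ht => f.map_D (u, t) (h.1 t ht), fun c hc => ?_⟩
    obtain ⟨v, rfl⟩ := hf.exists_corner_of_mem_D (.inr (hc _ (mem_image_of_mem _ hs)))
    exact f.map_D (v, u) (h.2 v fun t ht => hf.mem_D _ _ (hc _ (mem_image_of_mem _ ht)))

/-- A map which corresponds under open embeddings to a b-normal morphism is b-normal. -/
theorem isBNormal_of_comp_eq {M M' N' : PreSManC.{u}} {i : SCMap M' M} {j : SCMap N' N}
    {F : SCMap M N} {G : SCMap M' N'} (hi : i.IsOpenPart) (hj : j.IsOpenPart) (hM : M.IsSManC)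
    (hM' : M'.IsSManC) (hN : N.IsSManC) (hF : F.IsBNormal) (e : F.comp i = j.comp G) :
    G.IsBNormal := by
  have e0 : ∀ x, F.base (i.base x) = j.base (G.base x) :=
    fun x => congrFun (congrArg SCMap.base e) x
  have e1 : ∀ u, F.corner (i.corner u) = j.corner (G.corner u) :=
    fun u => congrFun (congrArg SCMap.corner e) u
  have e2 : ∀ S : Set M'.C, j.corner '' (G.corner '' S) = F.corner '' (i.corner '' S) := by
    intro S
    rw [image_image, image_image]
    exact image_congr fun u _ => (e1 u).symm
  have hfib : ∀ (x : M'.X) (S : Set M'.C), S ⊆ M'.proj ⁻¹' {x} →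
      i.corner '' S ⊆ M.proj ⁻¹' {i.base x} := by
    rintro x S hS _ ⟨s, hs, rfl⟩
    exact (i.comm s).trans (congrArg i.base (hS hs))
  refine
  { base_smooth := hj.smooth_base_of_comp _ hM'.isSMan _ ?_
    corner_smooth := hj.smooth_corner_of_comp _ hM'.corners_isSMan _ ?_
    map_interior := fun u hu => ?_
    map_lub := fun x S hS hx u hu => ?_
    map_glb := fun x S hS hx u hu => ?_
    codim_le := fun u => ?_
    codim_D := fun p hp => ?_ }
  · simp only [← e0]
    exact hF.base_smooth.comp hM'.isSMan hM.isSMan hN.isSMan hi.base_smooth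
  · simp only [← e1]
    exact hF.corner_smooth.comp hM'.corners_isSMan hM.corners_isSMan hN.corners_isSMan
      hi.corner_smooth
  · rw [← hj.mem_interior_iff, ← e1]
    exact hF.map_interior _ ((hi.mem_interior_iff u).2 hu)
  · rw [← hj.isLub_image (hS.image _), ← e1, e2]
    exact hF.map_lub _ _ (hS.image _) (hfib x S hx) _ ((hi.isLub_image hS).2 hu)
  · rw [← hj.isGlb_image (hS.image _), ← e1, e2]
    exact hF.map_glb _ _ (hS.image _) (hfib x S hx) _ ((hi.isGlb_image hS).2 hu)
  · rw [← hj.codim_eq, ← e1, ← hi.codim_eq]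
    exact hF.codim_le _
  · rw [← hj.codim_eq, ← hj.codim_eq, ← e1, ← e1, ← hi.codim_eq, ← hi.codim_eq]
    exact hF.codim_D _ (i.map_D p hp)

/-- An open embedding is an isomorphism to the restriction to its image. -/
theorem exists_isIso (hf : f.IsOpenPart) (hB : B.IsSManC)
    (hX : ∀ p, ∀ c ∈ N.X.charts p, c.IsStratumChart N.X.rel N.X.sdim)
    (hC : ∀ p, ∀ c ∈ N.C.charts p, c.IsStratumChart N.C.rel N.C.sdim) {U : Set B.X}
    (hU : range f.base = U) :
    ∃ Φ : SCMap (B.restrict U) N, Φ.IsIso ∧ f.comp Φ = restrictIncl B U := by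
  subst hU
  have hR := isSManC_restrict hB hf.isOpen_range
  have hUC := hf.isOpen_range.preimage hB.proj_smooth.continuous
  have hbase : ∀ x : (B.restrict (range f.base)).X, ∃ y, f.base y = x.1 := fun x => x.2
  choose φ hφ using hbase
  have hcorner : ∀ c : (B.restrict (range f.base)).C, ∃ u, f.corner u = c.1 := fun c =>
    hf.exists_corner _ _ c.2.choose_spec.symm
  choose ψ hψ using hcorner
  let Φ : SCMap (B.restrict (range f.base)) N :=
    { base := φ
      corner := ψ
      comm := fun c => hf.base_injective (by rw [← f.comm, hψ, hφ]; rfl)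
      map_D := fun p hp => hf.mem_D _ _ (by rw [hψ, hψ]; exact hp) }
  let Ψ : SCMap N (B.restrict (range f.base)) :=
    { base := fun x => ⟨f.base x, mem_range_self x⟩
      corner := fun u => ⟨f.corner u, N.proj u, (f.comm u).symm⟩
      comm := fun u => Subtype.ext (f.comm u)
      map_D := fun p hp => f.map_D p hp }
  have i := isEtale_restrict_val hB.isSMan hf.isOpen_range
  have j := isEtale_restrict_val hB.corners_isSMan hUC
  have int : ∀ u : (B.restrict (range f.base)).C, u ∈ (B.restrict (range f.base)).interior ↔
      ψ u ∈ N.interior := by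
    intro u
    rw [← hf.mem_interior_iff, hψ]
    constructor
    · rintro h ⟨v, hv, hlt⟩
      exact h ⟨⟨v, by
        change B.proj v ∈ range f.base
        rw [← B.D_proj _ hv]
        exact u.2⟩, hv, hlt⟩
    · rintro h ⟨v, hv, hlt⟩
      exact h ⟨v.1, hv, hlt⟩
  have hψ' : ∀ u, ψ ⟨f.corner u, N.proj u, (f.comm u).symm⟩ = u := fun u =>
    hf.corner_injective (hψ _)
  refine ⟨Φ, ⟨⟨?_, ?_, fun u hu => (int u).1 hu⟩, ?_, ?_, Ψ, ⟨?_, ?_, fun u hu => ?_⟩, ?_, ?_⟩, ?_⟩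
  · refine hf.smooth_base_of_comp _ hR.isSMan φ ?_
    simp only [hφ]
    exact i.toIsSmooth
  · refine hf.smooth_corner_of_comp _ hR.corners_isSMan ψ ?_
    simp only [hψ]
    exact j.toIsSmooth
  · intro x
    rw [← hf.dim_base]
    exact congrArg B.X.dim (hφ x)
  · intro u
    rw [← hf.dim_corner]
    exact congrArg B.C.dim (hψ u)
  · exact smooth_restrict_lift hB.isSMan hf.isOpen_range hX hf.base_smooth
  · exact smooth_restrict_lift hB.corners_isSMan hUC hC hf.corner_smooth
  · refine (int _).2 ?_
    rwa [hψ']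
  · exact SCMap.ext (funext fun x => Subtype.ext (hφ x)) (funext fun u => Subtype.ext (hψ u))
  · exact SCMap.ext (funext fun x => hf.base_injective (hφ _)) (funext hψ')
  · exact SCMap.ext (funext hφ) (funext hψ)

end SCMap.IsOpenPart

theorem isOpenPart_restrictIncl {M : PreSManC.{u}} (hM : M.IsSManC) {U : Set M.X} (hU : IsOpen U)
    (hr : ∀ x ∈ U, ∀ y, M.X.rel x y → y ∈ U) : (restrictIncl M U).IsOpenPart where
  base_smooth := (isEtale_restrict_val hM.isSMan hU).toIsSmooth
  corner_smooth := (isEtale_restrict_val hM.corners_isSMan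
    (hU.preimage hM.proj_smooth.continuous)).toIsSmooth
  base_injective := Subtype.val_injective
  corner_injective := Subtype.val_injective
  dim_base _ := rfl
  dim_corner _ := rfl
  isOpen_range := by
    convert! hU using 1
    exact Subtype.range_val
  range_rel x y h := ⟨⟨y, hr _ x.2 _ h⟩, rfl⟩
  mem_D _ _ h := h
  exists_corner x c h := ⟨⟨c, by
    change M.proj c ∈ U
    rw [h]
    exact x.2⟩, rfl⟩
  smooth_base_of_comp T hT t ht := smooth_restrict_lift hM.isSMan hU hT.isStratumChart ht
  smooth_corner_of_comp T hT t ht :=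
    smooth_restrict_lift hM.corners_isSMan (hU.preimage hM.proj_smooth.continuous)
      hT.isStratumChart ht

/-! ### Open parts of corners -/

/-- `I` identifies `M'` with the part of the corners of `M` over an open union of strata. The last two
properties follow from this, and say that tangent spaces of `M'` are those of `M`. -/
structure IsCornerPart {M' M : PreSManC.{u}} (I : SCMap M' (corners M)) : Prop
    extends I.IsOpenPart where
  etale_base : IsEtale M'.X M.C I.base
  etale_corner : IsEtale M'.C M.C (fun u => (I.corner u).1.2)

section CornerPart

variable {M N P M' N' P' : PreSManC.{u}}

theorem isCornerPart_restrictIncl (hM : M.IsSManC) {U : Set M.C} (hU : IsOpen U)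
    (hr : ∀ x ∈ U, ∀ y, M.C.rel x y → y ∈ U) : IsCornerPart (restrictIncl (corners M) U) where
  toIsOpenPart := isOpenPart_restrictIncl (isSManC_corners hM) hU hr
  etale_base := isEtale_restrict_val hM.corners_isSMan hU
  etale_corner := by
    have hUC := hU.preimage (isSManC_corners hM).proj_smooth.continuous
    exact hM.etale_D_snd.comp (isSMan_restrict hM.isSMan_D hUC) hM.isSMan_D hM.corners_isSMan
      (isEtale_restrict_val hM.isSMan_D hUC)

/-- An s-manifold with corners is the part `C_0(X)` of its corners. -/
theorem exists_isCornerPart_zero (hM : M.IsSManC) : ∃ I : SCMap M (corners M), IsCornerPart I ∧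
    (∀ x, M.codim (I.base x) = 0) ∧ (∀ x, M.proj (I.base x) = x) ∧
    ∀ u, (I.corner u).1.2 = u := by
  obtain ⟨s, hs, h0, h1, h2⟩ := hM.exists_zero_section
  let I : SCMap M (corners M) :=
    { base := s
      corner := fun u => ⟨(s (M.proj u), u), hM.mem_D_of_codim_zero (h0 _) (h1 _)⟩
      comm := fun _ => rfl
      map_D := fun p hp => ⟨congrArg s (M.D_proj p hp), hp⟩ }
  have hrange : range s = {u | M.codim u = 0} := by
    ext u
    exact ⟨fun ⟨x, hx⟩ => hx ▸ h0 x, fun hu => ⟨_, h2 u hu⟩⟩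
  refine ⟨I, ⟨⟨hs.toIsSmooth, hM.smooth_D_lift hM.corners_isSMan
    (hs.toIsSmooth.comp hM.corners_isSMan hM.isSMan hM.corners_isSMan hM.proj_smooth)
    (.id hM.corners_isSMan), ?_, ?_, hs.dim_eq, fun _ => rfl, ?_, ?_, ?_, ?_, ?_, ?_⟩, hs,
    .id hM.corners_isSMan⟩, h0, h1, fun _ => rfl⟩
  · exact fun x y h => by rw [← h1 x, ← h1 y]; exact congrArg M.proj h
  · exact fun u v h => congrArg (fun q : (corners M).C => q.1.2) h
  · change IsOpen (range s)
    rw [hrange]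
    exact hM.isLocallyConstant_codim.isOpen_fiber 0
  · intro x y h
    change y ∈ range s
    rw [hrange]
    exact (hM.codim_rel h).symm.trans (h0 x)
  · exact fun _ _ h => h.2
  · intro x c h
    have h3 : c.1.1 = s x := h
    refine ⟨c.1.2, Subtype.ext (Prod.ext ?_ rfl)⟩
    change s (M.proj c.1.2) = c.1.1
    rw [← M.D_proj _ c.2, h3, h1]
  · intro T hT t ht
    have h3 := hM.proj_smooth.comp hT hM.corners_isSMan hM.isSMan ht
    have h4 : M.proj ∘ (fun a => I.base (t a)) = t := funext fun a => h1 (t a)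
    rwa [h4] at h3
  · exact fun T hT t ht => hM.smooth_D_snd.comp hT hM.isSMan_D hM.corners_isSMan ht

variable {g : SCMap M P} {h : SCMap N P} {I : SCMap M' (corners M)} {J : SCMap N' (corners N)}
  {K : SCMap P' (corners P)} {G : SCMap M' P'} {H : SCMap N' P'}

/-- Parts of the corner maps of transverse maps are transverse. -/
theorem isTransverse_of_isCornerPart (hM : M.IsSManC) (hN : N.IsSManC) (hP : P.IsSManC)
    (hM' : M'.IsSManC) (hN' : N'.IsSManC) (hP' : P'.IsSManC) (ht : IsTransverse g h)
    (hI : IsCornerPart I) (hJ : IsCornerPart J) (hK : IsCornerPart K)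
    (eG : (cornersMap g).comp I = K.comp G) (eH : (cornersMap h).comp J = K.comp H) :
    IsTransverse G H := by
  have hG := hI.isBNormal_of_comp_eq hK.toIsOpenPart (isSManC_corners hM) hM' (isSManC_corners hP)
    (isBNormal_cornersMap hM hP ht.left_bNormal) eG
  have hH := hJ.isBNormal_of_comp_eq hK.toIsOpenPart (isSManC_corners hN) hN' (isSManC_corners hP)
    (isBNormal_cornersMap hN hP ht.right_bNormal) eH
  refine ⟨hG, hH, ?_, ?_⟩
  · exact IsTransverseSMan.of_etale hM.corners_isSMan hN.corners_isSMan hP.corners_isSMan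
      hM'.isSMan hN'.isSMan hP'.isSMan ht.left_bNormal.corner_smooth ht.right_bNormal.corner_smooth
      hG.base_smooth hH.base_smooth hI.etale_base hJ.etale_base hK.etale_base
      (fun x => congrFun (congrArg SCMap.base eG) x) (fun x => congrFun (congrArg SCMap.base eH) x)
      ht.corner
  · exact IsTransverseSMan.of_etale hM.corners_isSMan hN.corners_isSMan hP.corners_isSMan
      hM'.corners_isSMan hN'.corners_isSMan hP'.corners_isSMan ht.left_bNormal.corner_smooth
      ht.right_bNormal.corner_smooth hG.corner_smooth hH.corner_smooth hI.etale_corner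
      hJ.etale_corner hK.etale_corner
      (fun u => congrArg (fun q : (corners P).C => q.1.2) (congrFun (congrArg SCMap.corner eG) u))
      (fun u => congrArg (fun q : (corners P).C => q.1.2) (congrFun (congrArg SCMap.corner eH) u))
      ht.corner

theorem cornersMap_comp_pullback_eq (eG : (cornersMap g).comp I = K.comp G)
    (eH : (cornersMap h).comp J = K.comp H) :
    (cornersMap g).comp (I.comp (pullbackFst G H)) =
      (cornersMap h).comp (J.comp (pullbackSnd G H)) := by
  change ((cornersMap g).comp I).comp (pullbackFst G H) =
    ((cornersMap h).comp J).comp (pullbackSnd G H)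
  rw [eG, eH]
  change K.comp (G.comp (pullbackFst G H)) = K.comp (H.comp (pullbackSnd G H))
  rw [pullback_comm]

/-- A fibre product of parts of the corners is a part of the corners of the fibre product. -/
theorem isOpenPart_cornersLift (hM : M.IsSManC) (hN : N.IsSManC) (hP : P.IsSManC)
    (hM' : M'.IsSManC) (hN' : N'.IsSManC) (hP' : P'.IsSManC) (ht : IsTransverse g h)
    (hI : IsCornerPart I) (hJ : IsCornerPart J) (hK : IsCornerPart K)
    (eG : (cornersMap g).comp I = K.comp G) (eH : (cornersMap h).comp J = K.comp H) :
    (cornersLift (I.comp (pullbackFst G H)) (J.comp (pullbackSnd G H))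
      (cornersMap_comp_pullback_eq eG eH)).IsOpenPart ∧
    range (cornersLift (I.comp (pullbackFst G H)) (J.comp (pullbackSnd G H))
      (cornersMap_comp_pullback_eq eG eH)).base =
      {w | w.1.1 ∈ range I.base ∧ w.1.2 ∈ range J.base} := by
  have tGH := isTransverse_of_isCornerPart hM hN hP hM' hN' hP' ht hI hJ hK eG eH
  have hW := isSManC_pullback hM hN hP ht
  have hW' := isSManC_pullback hM' hN' hP' tGH
  have g0 : ∀ x, g.corner (I.base x) = K.base (G.base x) :=
    fun x => congrFun (congrArg SCMap.base eG) x
  have h0 : ∀ x, h.corner (J.base x) = K.base (H.base x) :=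
    fun x => congrFun (congrArg SCMap.base eH) x
  have g1 : ∀ u, (cornersMap g).corner (I.corner u) = K.corner (G.corner u) :=
    fun x => congrFun (congrArg SCMap.corner eG) x
  have h1 : ∀ u, (cornersMap h).corner (J.corner u) = K.corner (H.corner u) :=
    fun x => congrFun (congrArg SCMap.corner eH) x
  set L := cornersLift (I.comp (pullbackFst G H)) (J.comp (pullbackSnd G H))
      (cornersMap_comp_pullback_eq eG eH) with hL
  have hrange : range L.base = {w | w.1.1 ∈ range I.base ∧ w.1.2 ∈ range J.base} := by
    ext w
    constructor
    · rintro ⟨x, rfl⟩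
      exact ⟨⟨_, rfl⟩, ⟨_, rfl⟩⟩
    · rintro ⟨⟨x, hx⟩, ⟨y, hy⟩⟩
      have he : G.base x = H.base y := hK.base_injective (by
        rw [← g0, ← h0, hx, hy]
        exact w.2)
      exact ⟨⟨(x, y), he⟩, Subtype.ext (Prod.ext hx hy)⟩
  have s1 : IsSmooth (corners (pullback g h)).X M.C (fun w => w.1.1) :=
    smooth_pullbackFst_corner hM hN hP ht
  have s2 : IsSmooth (corners (pullback g h)).X N.C (fun w => w.1.2) :=
    smooth_pullbackSnd_corner hM hN hP ht
  refine ⟨⟨?_, ?_, ?_, ?_, ?_, ?_, ?_, ?_, ?_, ?_, ?_, ?_⟩, hrange⟩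
  · exact smooth_lift_C hM hN hP ht hW'.isSMan
      (hI.base_smooth.comp hW'.isSMan hM'.isSMan hM.corners_isSMan
        (smooth_pullbackFst_base hM' hN' hP' tGH))
      (hJ.base_smooth.comp hW'.isSMan hN'.isSMan hN.corners_isSMan
        (smooth_pullbackSnd_base hM' hN' hP' tGH))
  · have k1 := hI.corner_smooth.comp hW'.corners_isSMan hM'.corners_isSMan hM.isSMan_D
        (smooth_pullbackFst_corner hM' hN' hP' tGH)
    have k2 := hJ.corner_smooth.comp hW'.corners_isSMan hN'.corners_isSMan hN.isSMan_D
        (smooth_pullbackSnd_corner hM' hN' hP' tGH)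
    exact hW.smooth_D_lift hW'.corners_isSMan
      (smooth_lift_C hM hN hP ht hW'.corners_isSMan
        (hM.smooth_D_fst.comp hW'.corners_isSMan hM.isSMan_D hM.corners_isSMan k1)
        (hN.smooth_D_fst.comp hW'.corners_isSMan hN.isSMan_D hN.corners_isSMan k2))
      (smooth_lift_C hM hN hP ht hW'.corners_isSMan
        (hM.smooth_D_snd.comp hW'.corners_isSMan hM.isSMan_D hM.corners_isSMan k1)
        (hN.smooth_D_snd.comp hW'.corners_isSMan hN.isSMan_D hN.corners_isSMan k2))
  · intro x y e
    have e' := Prod.ext_iff.1 (congrArg Subtype.val e)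
    exact Subtype.ext (Prod.ext (hI.base_injective e'.1) (hJ.base_injective e'.2))
  · intro x y e
    have e' := Prod.ext_iff.1 (congrArg Subtype.val e)
    have e1 := Prod.ext_iff.1 (congrArg Subtype.val e'.1)
    have e2 := Prod.ext_iff.1 (congrArg Subtype.val e'.2)
    exact Subtype.ext (Prod.ext (hI.corner_injective (Subtype.ext (Prod.ext e1.1 e2.1)))
      (hJ.corner_injective (Subtype.ext (Prod.ext e1.2 e2.2))))
  · intro w
    change M.C.dim (I.base w.1.1) + N.C.dim (J.base w.1.2) - P.C.dim (g.corner (I.base w.1.1)) = _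
    rw [g0, hI.etale_base.dim_eq, hJ.etale_base.dim_eq, hK.etale_base.dim_eq]
    rfl
  · intro w
    change M.C.dim (I.corner w.1.1).1.2 + N.C.dim (J.corner w.1.2).1.2 -
      P.C.dim (g.corner (I.corner w.1.1).1.2) = _
    have e := congrArg (fun q : (corners P).C => q.1.2) (g1 w.1.1)
    have e' : g.corner (I.corner w.1.1).1.2 = (K.corner (G.corner w.1.1)).1.2 := e
    rw [e', hI.etale_corner.dim_eq, hJ.etale_corner.dim_eq, hK.etale_corner.dim_eq]
    rfl
  · rw [hrange]
    exact (hI.isOpen_range.preimage s1.continuous).inter (hJ.isOpen_range.preimage s2.continuous)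
  · intro x w hw
    rw [hrange]
    exact ⟨hI.range_rel x.1.1 _ hw.1, hJ.range_rel x.1.2 _ hw.2⟩
  · intro u v hD
    have e1 := Prod.ext_iff.1 (congrArg Subtype.val hD.1)
    exact ⟨hI.mem_D _ _ ⟨e1.1, hD.2.1⟩, hJ.mem_D _ _ ⟨e1.2, hD.2.2⟩⟩
  · intro x c hc
    have e1 := Prod.ext_iff.1 (congrArg Subtype.val hc)
    obtain ⟨u, hu⟩ := hI.exists_corner x.1.1 ⟨(c.1.1.1.1, c.1.2.1.1), c.2.1⟩ e1.1
    obtain ⟨v, hv⟩ := hJ.exists_corner x.1.2 ⟨(c.1.1.1.2, c.1.2.1.2), c.2.2⟩ e1.2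
    have he : G.corner u = H.corner v := hK.corner_injective (by
      rw [← g1, ← h1, hu, hv]
      exact Subtype.ext (Prod.ext c.1.1.2 c.1.2.2))
    have hu' := Prod.ext_iff.1 (congrArg Subtype.val hu)
    have hv' := Prod.ext_iff.1 (congrArg Subtype.val hv)
    exact ⟨⟨(u, v), he⟩, Subtype.ext (Prod.ext (Subtype.ext (Prod.ext hu'.1 hv'.1))
      (Subtype.ext (Prod.ext hu'.2 hv'.2)))⟩
  · intro T hT t htt
    exact smooth_lift_X hM' hN' hP' tGH hT
      (hI.smooth_base_of_comp T hT _ (s1.comp hT hW.corners_isSMan hM.corners_isSMan htt))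
      (hJ.smooth_base_of_comp T hT _ (s2.comp hT hW.corners_isSMan hN.corners_isSMan htt))
  · intro T hT t htt
    have k1 := hW.smooth_D_fst.comp hT hW.isSMan_D hW.corners_isSMan htt
    have k2 := hW.smooth_D_snd.comp hT hW.isSMan_D hW.corners_isSMan htt
    exact smooth_lift_C hM' hN' hP' tGH hT
      (hI.smooth_corner_of_comp T hT _ (hM.smooth_D_lift hT
        (s1.comp hT hW.corners_isSMan hM.corners_isSMan k1)
        (s1.comp hT hW.corners_isSMan hM.corners_isSMan k2)))
      (hJ.smooth_corner_of_comp T hT _ (hN.smooth_D_lift hT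
        (s2.comp hT hW.corners_isSMan hN.corners_isSMan k1)
        (s2.comp hT hW.corners_isSMan hN.corners_isSMan k2)))

end CornerPart

/-! ### Disjoint unions -/

section Sum

variable {X Y Z : PreSMan.{u}}

theorem isStratumChart_inl {p : ℕ} {a : Chart X p} (h : a.IsStratumChart X.rel X.sdim) :
    (⟨Sum.inl '' a.source, Sum.elim a.map (fun _ => 0)⟩ : Chart (X.sum Y) p).IsStratumChart
      (X.sum Y).rel (X.sum Y).sdim := by
  refine ⟨?_, ?_, ?_⟩
  · rintro _ ⟨x, hx, rfl⟩
    exact h.sdim_eq x hx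
  · rintro _ ⟨x, hx, rfl⟩
    obtain ⟨O, hO, hOa⟩ := h.open_source x hx
    refine ⟨Sum.inl '' O, isOpenMap_inl _ hO, Subset.antisymm ?_ ?_⟩
    · rintro _ ⟨y, hy, rfl⟩
      have hy' : y ∈ O ∩ {y | X.rel x y} := hOa ▸ hy
      exact ⟨⟨y, hy'.1, rfl⟩, .inl hy'.2⟩
    · rintro _ ⟨⟨y, hy, rfl⟩, hr⟩
      cases hr with
      | inl hr => exact ⟨y, hOa ▸ (⟨hy, hr⟩ : y ∈ O ∩ {y | X.rel x y}), rfl⟩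
  · let e := (IsEmbedding.inl (X := X) (Y := Y)).homeomorphImage a.source
    have h1 := h.isOpenEmbedding.comp e.symm.isOpenEmbedding
    convert! h1 using 1
    funext y
    obtain ⟨x, rfl⟩ := e.surjective y
    change _ = a.map (e.symm (e x))
    rw [e.symm_apply_apply]
    rfl

theorem isStratumChart_inr {p : ℕ} {a : Chart Y p} (h : a.IsStratumChart Y.rel Y.sdim) :
    (⟨Sum.inr '' a.source, Sum.elim (fun _ => 0) a.map⟩ : Chart (X.sum Y) p).IsStratumChart
      (X.sum Y).rel (X.sum Y).sdim := by
  refine ⟨?_, ?_, ?_⟩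
  · rintro _ ⟨x, hx, rfl⟩
    exact h.sdim_eq x hx
  · rintro _ ⟨x, hx, rfl⟩
    obtain ⟨O, hO, hOa⟩ := h.open_source x hx
    refine ⟨Sum.inr '' O, isOpenMap_inr _ hO, Subset.antisymm ?_ ?_⟩
    · rintro _ ⟨y, hy, rfl⟩
      have hy' : y ∈ O ∩ {y | Y.rel x y} := hOa ▸ hy
      exact ⟨⟨y, hy'.1, rfl⟩, .inr hy'.2⟩
    · rintro _ ⟨⟨y, hy, rfl⟩, hr⟩
      cases hr with
      | inr hr => exact ⟨y, hOa ▸ (⟨hy, hr⟩ : y ∈ O ∩ {y | Y.rel x y}), rfl⟩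
  · let e := (IsEmbedding.inr (X := X) (Y := Y)).homeomorphImage a.source
    have h1 := h.isOpenEmbedding.comp e.symm.isOpenEmbedding
    convert! h1 using 1
    funext y
    obtain ⟨x, rfl⟩ := e.surjective y
    change _ = a.map (e.symm (e x))
    rw [e.symm_apply_apply]
    rfl

theorem isStratumChart_sum (hX : ∀ p, ∀ c ∈ X.charts p, c.IsStratumChart X.rel X.sdim)
    (hY : ∀ p, ∀ c ∈ Y.charts p, c.IsStratumChart Y.rel Y.sdim) (p : ℕ)
    (c : Chart (X.sum Y) p) (hc : c ∈ (X.sum Y).charts p) :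
    c.IsStratumChart (X.sum Y).rel (X.sum Y).sdim := by
  rcases hc with ⟨a, ha, rfl⟩ | ⟨a, ha, rfl⟩
  · exact isStratumChart_inl (hX p a ha)
  · exact isStratumChart_inr (hY p a ha)

theorem smooth_sumElim (hX : ∀ p, ∀ c ∈ X.charts p, c.IsStratumChart X.rel X.sdim)
    (hY : ∀ p, ∀ c ∈ Y.charts p, c.IsStratumChart Y.rel Y.sdim)
    (hZ : ∀ p, ∀ c ∈ Z.charts p, c.IsStratumChart Z.rel Z.sdim) {f : X → Z} {g : Y → Z}
    (hf : IsSmooth X Z f) (hg : IsSmooth Y Z g) : IsSmooth (X.sum Y) Z (Sum.elim f g) := by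
  refine .of_smoothAt (isStratumChart_sum hX hY) hZ (hf.continuous.sumElim hg.continuous) ?_ ?_
  · rintro _ _ (h | h)
    · exact hf.map_rel _ _ h
    · exact hg.map_rel _ _ h
  · rintro p q _ (⟨a, ha, rfl⟩ | ⟨a, ha, rfl⟩) b hb _ ⟨x, hx, rfl⟩ hx'
    · have hj : Chart.Corr (Sum.inl : X → X.sum Y) a
          ⟨Sum.inl '' a.source, Sum.elim a.map (fun _ => 0)⟩ :=
        ⟨fun x => (Sum.inl_injective.mem_set_image).symm, fun _ _ => rfl⟩
      refine (hj.smoothAt_iff (hX p a ha).isOpenEmbedding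
        (isStratumChart_inl (hX p a ha)).isOpenEmbedding (b.map ∘ Sum.elim f g) hx).1 ?_
      exact ((hX p a ha).contDiffOn_iff (hZ q b hb) hf.continuous hf.map_rel).1
        (hf.contDiffOn p q a ha b hb) x hx hx'
    · have hj : Chart.Corr (Sum.inr : Y → X.sum Y) a
          ⟨Sum.inr '' a.source, Sum.elim (fun _ => 0) a.map⟩ :=
        ⟨fun x => (Sum.inr_injective.mem_set_image).symm, fun _ _ => rfl⟩
      refine (hj.smoothAt_iff (hY p a ha).isOpenEmbedding
        (isStratumChart_inr (hY p a ha)).isOpenEmbedding (b.map ∘ Sum.elim f g) hx).1 ?_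
      exact ((hY p a ha).contDiffOn_iff (hZ q b hb) hg.continuous hg.map_rel).1
        (hg.contDiffOn p q a ha b hb) x hx hx'

theorem smooth_inl_comp (hX : ∀ p, ∀ c ∈ X.charts p, c.IsStratumChart X.rel X.sdim)
    (hY : ∀ p, ∀ c ∈ Y.charts p, c.IsStratumChart Y.rel Y.sdim)
    (hZ : ∀ p, ∀ c ∈ Z.charts p, c.IsStratumChart Z.rel Z.sdim) {f : Z → X}
    (hf : IsSmooth Z X f) : IsSmooth Z (X.sum Y) (fun z => Sum.inl (f z)) := by
  refine .of_smoothAt hZ (isStratumChart_sum hX hY) (continuous_inl.comp hf.continuous)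
    (fun _ _ h => .inl (hf.map_rel _ _ h)) ?_
  rintro p q a ha _ (⟨b, hb, rfl⟩ | ⟨b, hb, rfl⟩) z hz ⟨x, hx, e⟩
  · rw [Sum.inl.injEq] at e
    subst e
    exact ((hZ p a ha).contDiffOn_iff (hX q b hb) hf.continuous hf.map_rel).1
      (hf.contDiffOn p q a ha b hb) z hz hx
  · cases e

theorem smooth_inr_comp (hX : ∀ p, ∀ c ∈ X.charts p, c.IsStratumChart X.rel X.sdim)
    (hY : ∀ p, ∀ c ∈ Y.charts p, c.IsStratumChart Y.rel Y.sdim)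
    (hZ : ∀ p, ∀ c ∈ Z.charts p, c.IsStratumChart Z.rel Z.sdim) {f : Z → Y}
    (hf : IsSmooth Z Y f) : IsSmooth Z (X.sum Y) (fun z => Sum.inr (f z)) := by
  refine .of_smoothAt hZ (isStratumChart_sum hX hY) (continuous_inr.comp hf.continuous)
    (fun _ _ h => .inr (hf.map_rel _ _ h)) ?_
  rintro p q a ha _ (⟨b, hb, rfl⟩ | ⟨b, hb, rfl⟩) z hz ⟨x, hx, e⟩
  · cases e
  · rw [Sum.inr.injEq] at e
    subst e
    exact ((hZ p a ha).contDiffOn_iff (hY q b hb) hf.continuous hf.map_rel).1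
      (hf.contDiffOn p q a ha b hb) z hz hx

/-- If `F ∘ t` is smooth, then `t` is smooth where it takes values in the image of a map `i` such that
`F ∘ i` reflects smoothness. -/
theorem exists_smooth_restrict_of_comp {T W : PreSMan.{u}} (hT : T.IsSMan) (hZ : Z.IsSMan)
    {i : X → W} (hi : ∀ T : PreSMan.{u}, T.IsSMan → ∀ t : T → X, IsSmooth T X t →
      IsSmooth T W (fun a => i (t a))) {F : W → Z}
    (hF : ∀ T : PreSMan.{u}, T.IsSMan → ∀ t : T → X,
      IsSmooth T Z (fun a => F (i (t a))) → IsSmooth T X t)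
    (ho : IsOpen (range fun x => F (i x)))
    (hr : ∀ x z, Z.rel (F (i x)) z → z ∈ range fun x => F (i x))
    (hW : ∀ w, F w ∈ range (fun x => F (i x)) → w ∈ range i) {t : T → W}
    (ht : IsSmooth T Z (fun a => F (t a))) {a : T} {x : X} (ha : t a = i x) :
    ∃ V : Set T, IsOpen V ∧ a ∈ V ∧ (∀ b, T.rel a b → b ∈ V) ∧
      IsSmooth (T.restrict V) W (fun b => t b.1) := by
  have hV : IsOpen ((fun a => F (t a)) ⁻¹' range fun x => F (i x)) := ho.preimage ht.continuous
  refine ⟨_, hV, ⟨x, congrArg F ha.symm⟩, fun b hb => hr x _ ?_, ?_⟩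
  · rw [← ha]
    exact ht.map_rel _ _ hb
  · have hex : ∀ b : T.restrict ((fun a => F (t a)) ⁻¹' range fun x => F (i x)),
        ∃ x, i x = t b.1 := fun b => hW _ b.2
    choose s hs using hex
    have hT' := isSMan_restrict hT hV
    have h1 := ht.comp hT' hT hZ (isEtale_restrict_val hT hV).toIsSmooth
    have e : (fun b : T.restrict ((fun a => F (t a)) ⁻¹' range fun x => F (i x)) => t b.1) =
        fun b => i (s b) := funext fun b => (hs b).symm
    have e2 : (fun b : T.restrict ((fun a => F (t a)) ⁻¹' range fun x => F (i x)) => F (t b.1)) =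
        fun b => F (i (s b)) := funext fun b => congrArg F (hs b).symm
    rw [e]
    exact hi _ hT' s (hF _ hT' s (e2 ▸ h1))

/-- A map to a disjoint union is smooth if its composition with a map whose restrictions to both parts
reflect smoothness, and have disjoint open unions of strata as images, is smooth. -/
theorem smooth_sum_of_comp {T : PreSMan.{u}} (hT : T.IsSMan) (hZ : Z.IsSMan)
    (hX : ∀ p, ∀ c ∈ X.charts p, c.IsStratumChart X.rel X.sdim)
    (hY : ∀ p, ∀ c ∈ Y.charts p, c.IsStratumChart Y.rel Y.sdim) {f : X → Z} {g : Y → Z}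
    (hf : ∀ T : PreSMan.{u}, T.IsSMan → ∀ t : T → X,
      IsSmooth T Z (fun a => f (t a)) → IsSmooth T X t)
    (hg : ∀ T : PreSMan.{u}, T.IsSMan → ∀ t : T → Y,
      IsSmooth T Z (fun a => g (t a)) → IsSmooth T Y t)
    (hfo : IsOpen (range f)) (hfr : ∀ x z, Z.rel (f x) z → z ∈ range f)
    (hgo : IsOpen (range g)) (hgr : ∀ y z, Z.rel (g y) z → z ∈ range g)
    (hfg : Disjoint (range f) (range g)) {t : T → X.sum Y}
    (ht : IsSmooth T Z (fun a => Sum.elim f g (t a))) : IsSmooth T (X.sum Y) t := by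
  refine .of_restrict hT (isStratumChart_sum hX hY) fun a => ?_
  rcases ha : t a with x | y
  · refine exists_smooth_restrict_of_comp (W := X.sum Y) (i := Sum.inl) (F := Sum.elim f g) hT hZ
      (fun T hT t ht => smooth_inl_comp hX hY hT.isStratumChart ht) hf hfo hfr ?_ ht ha
    rintro (x | y) h
    · exact ⟨x, rfl⟩
    · exact (disjoint_left.1 hfg h ⟨y, rfl⟩).elim
  · refine exists_smooth_restrict_of_comp (W := X.sum Y) (i := Sum.inr) (F := Sum.elim f g) hT hZ
      (fun T hT t ht => smooth_inr_comp hX hY hT.isStratumChart ht) hg hgo hgr ?_ ht ha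
    rintro (x | y) h
    · exact (disjoint_right.1 hfg h ⟨x, rfl⟩).elim
    · exact ⟨y, rfl⟩

end Sum

section SumCorners

variable {M N B : PreSManC.{u}}

theorem SCMap.IsOpenPart.range_corner {f : SCMap M B} (hf : f.IsOpenPart) :
    range f.corner = B.proj ⁻¹' range f.base := by
  ext c
  constructor
  · rintro ⟨u, rfl⟩
    exact ⟨M.proj u, (f.comm u).symm⟩
  · rintro ⟨x, hx⟩
    exact hf.exists_corner x c hx.symm

theorem isOpenPart_sumElim {f : SCMap M B} {g : SCMap N B} (hB : B.IsSManC)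
    (hMX : ∀ p, ∀ c ∈ M.X.charts p, c.IsStratumChart M.X.rel M.X.sdim)
    (hMC : ∀ p, ∀ c ∈ M.C.charts p, c.IsStratumChart M.C.rel M.C.sdim)
    (hNX : ∀ p, ∀ c ∈ N.X.charts p, c.IsStratumChart N.X.rel N.X.sdim)
    (hNC : ∀ p, ∀ c ∈ N.C.charts p, c.IsStratumChart N.C.rel N.C.sdim)
    (hf : f.IsOpenPart) (hg : g.IsOpenPart) (hfg : Disjoint (range f.base) (range g.base)) :
    (f.sumElim g).IsOpenPart := by
  have hfg' : Disjoint (range f.corner) (range g.corner) := by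
    rw [hf.range_corner, hg.range_corner]
    exact hfg.preimage _
  have hpr := hB.proj_smooth
  have hfo : IsOpen (range f.corner) := hf.range_corner ▸ hf.isOpen_range.preimage hpr.continuous
  have hgo : IsOpen (range g.corner) := hg.range_corner ▸ hg.isOpen_range.preimage hpr.continuous
  have hfr : ∀ u c, B.C.rel (f.corner u) c → c ∈ range f.corner := by
    intro u c h
    rw [hf.range_corner]
    exact hf.range_rel (M.proj u) _ (f.comm u ▸ hpr.map_rel _ _ h)
  have hgr : ∀ u c, B.C.rel (g.corner u) c → c ∈ range g.corner := by
    intro u c h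
    rw [hg.range_corner]
    exact hg.range_rel (N.proj u) _ (g.comm u ▸ hpr.map_rel _ _ h)
  have hD : ∀ u v, ((f.corner u, g.corner v) ∈ B.D ∨ (g.corner v, f.corner u) ∈ B.D) → False := by
    intro u v h
    have h1 : B.proj (f.corner u) = B.proj (g.corner v) :=
      h.elim (fun h => B.D_proj _ h) (fun h => (B.D_proj _ h).symm)
    rw [f.comm, g.comm] at h1
    exact disjoint_left.1 hfg ⟨_, rfl⟩ ⟨_, h1.symm⟩
  refine
  { base_smooth := smooth_sumElim hMX hNX hB.isSMan.isStratumChart hf.base_smooth hg.base_smooth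
    corner_smooth := smooth_sumElim hMC hNC hB.corners_isSMan.isStratumChart hf.corner_smooth
      hg.corner_smooth
    base_injective := hf.base_injective.sumElim hg.base_injective fun x y h =>
      disjoint_left.1 hfg ⟨x, rfl⟩ ⟨y, h.symm⟩
    corner_injective := hf.corner_injective.sumElim hg.corner_injective fun x y h =>
      disjoint_left.1 hfg' ⟨x, rfl⟩ ⟨y, h.symm⟩
    dim_base := Sum.rec hf.dim_base hg.dim_base
    dim_corner := Sum.rec hf.dim_corner hg.dim_corner
    isOpen_range := ?_
    range_rel := ?_
    mem_D := ?_
    exists_corner := ?_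
    smooth_base_of_comp := fun T hT t ht => smooth_sum_of_comp hT hB.isSMan hMX hNX
      hf.smooth_base_of_comp hg.smooth_base_of_comp hf.isOpen_range hf.range_rel hg.isOpen_range
      hg.range_rel hfg ht
    smooth_corner_of_comp := fun T hT t ht => smooth_sum_of_comp hT hB.corners_isSMan hMC hNC
      hf.smooth_corner_of_comp hg.smooth_corner_of_comp hfo hfr hgo hgr hfg' ht }
  · change IsOpen (range (Sum.elim f.base g.base))
    rw [Sum.elim_range]
    exact hf.isOpen_range.union hg.isOpen_range
  · rintro (x | y) z h
    · obtain ⟨w, rfl⟩ := hf.range_rel x z h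
      exact ⟨Sum.inl w, rfl⟩
    · obtain ⟨w, rfl⟩ := hg.range_rel y z h
      exact ⟨Sum.inr w, rfl⟩
  · rintro (u | u) (v | v) h
    · exact .inl ⟨(u, v), hf.mem_D _ _ h, rfl⟩
    · exact (hD u v (.inl h)).elim
    · exact (hD v u (.inr h)).elim
    · exact .inr ⟨(u, v), hg.mem_D _ _ h, rfl⟩
  · rintro (x | y) c h
    · obtain ⟨w, rfl⟩ := hf.exists_corner x c h
      exact ⟨Sum.inl w, rfl⟩
    · obtain ⟨w, rfl⟩ := hg.exists_corner y c h
      exact ⟨Sum.inr w, rfl⟩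

end SumCorners

/-! ### The boundary of a fibre product -/

section Boundary

variable {M N P T : PreSManC.{u}}

theorem isSManC_boundary (hM : M.IsSManC) : (boundary M).IsSManC :=
  isSManC_restrict (isSManC_corners hM) (hM.isLocallyConstant_codim.isOpen_fiber 1)

theorem hasDim_restrict_corners {n : ℤ} (hn : M.HasDim n) {U : Set M.C}
    (hU : ∀ u ∈ U, M.codim u = 1) : ((corners M).restrict U).HasDim (n - 1) := by
  intro u
  have h1 : M.X.dim (M.proj u.1) - M.C.dim u.1 = 1 := hU u.1 u.2
  have h2 : M.X.dim (M.proj u.1) = n := hn _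
  change M.C.dim u.1 = n - 1
  omega

theorem isOpen_boundary_part (hM : M.IsSManC) (hN : N.IsSManC) {f : SCMap M N}
    (hf : f.IsMorphism) (k : ℤ) : IsOpen {u | M.codim u = 1 ∧ N.codim (f.corner u) = k} :=
  (hM.isLocallyConstant_codim.isOpen_fiber 1).inter
    ((hN.isLocallyConstant_codim.isOpen_fiber k).preimage hf.corner_smooth.continuous)

theorem isCornerPart_boundary_part (hM : M.IsSManC) (hN : N.IsSManC) {f : SCMap M N}
    (hf : f.IsMorphism) (k : ℤ) :
    IsCornerPart (restrictIncl (corners M) {u | M.codim u = 1 ∧ N.codim (f.corner u) = k}) := by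
  refine isCornerPart_restrictIncl hM (isOpen_boundary_part hM hN hf k) fun u hu v huv => ⟨?_, ?_⟩
  · exact (hM.codim_rel huv).symm.trans hu.1
  · exact (hN.codim_rel (hf.corner_smooth.map_rel _ _ huv)).symm.trans hu.2

/-- The first component of the corner map of a map to the corners is determined by its base. -/
theorem map_corners_ext {a b : SCMap T (corners N)} (h0 : ∀ x, a.base x = b.base x)
    (h1 : ∀ u, (a.corner u).1.2 = (b.corner u).1.2) : a = b :=
  SCMap.ext (funext h0) (funext fun u => Subtype.ext (Prod.ext
    ((a.comm u).trans ((h0 _).trans (b.comm u).symm)) (h1 u)))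

/-- For interior `f`, the map `f` is the restriction of `C(f)` to `M = C_0(M)`. -/
theorem cornersMap_comp_zero (hN : N.IsSManC) {f : SCMap M N} (hf : f.IsInterior)
    {I : SCMap M (corners M)} (hI0 : ∀ x, M.codim (I.base x) = 0)
    (hI1 : ∀ x, M.proj (I.base x) = x) (hI2 : ∀ u, (I.corner u).1.2 = u)
    {K : SCMap N (corners N)} (hK0 : ∀ x, N.codim (K.base x) = 0)
    (hK1 : ∀ x, N.proj (K.base x) = x) (hK2 : ∀ u, (K.corner u).1.2 = u) :
    (cornersMap f).comp I = K.comp f := by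
  refine map_corners_ext (fun x => ?_) fun u => ?_
  · exact hN.eq_of_codim_zero (hf.map_zero _ (hI0 x)) (hK0 _)
      ((f.comm _).trans ((congrArg f.base (hI1 x)).trans (hK1 _).symm))
  · exact (congrArg f.corner (hI2 u)).trans (hK2 _).symm

/-- `∂₀f` is the restriction of `C(f)` to `∂₀M`, as a map to `N = C_0(N)`. -/
theorem cornersMap_comp_boundary₀ (hN : N.IsSManC) {f : SCMap M N}
    {K : SCMap N (corners N)} (hK0 : ∀ x, N.codim (K.base x) = 0)
    (hK1 : ∀ x, N.proj (K.base x) = x) (hK2 : ∀ u, (K.corner u).1.2 = u) :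
    (cornersMap f).comp (restrictIncl (corners M) {u | M.codim u = 1 ∧ N.codim (f.corner u) = 0}) =
      K.comp (boundary₀Map f) := by
  refine map_corners_ext (fun x => ?_) fun u => (hK2 _).symm
  exact hN.eq_of_codim_zero x.2.2 (hK0 _) ((f.comm _).trans (hK1 _).symm)

theorem comp_sumElim {Q : PreSManC.{u}} (k : SCMap P Q) (a : SCMap M P) (b : SCMap N P) :
    k.comp (a.sumElim b) = (k.comp a).sumElim (k.comp b) :=
  SCMap.ext (funext (Sum.rec (fun _ => rfl) fun _ => rfl))
    (funext (Sum.rec (fun _ => rfl) fun _ => rfl))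

end Boundary

section BoundaryPullback

variable {M N P : PreSManC.{u}} {g : SCMap M P} {h : SCMap N P}

theorem isTransverse_boundary₀_left (hM : M.IsSManC) (hN : N.IsSManC) (hP : P.IsSManC)
    (ht : IsTransverse g h) : IsTransverse (boundary₀Map g) h := by
  obtain ⟨J, hJ, hJ0, hJ1, hJ2⟩ := exists_isCornerPart_zero hN
  obtain ⟨K, hK, hK0, hK1, hK2⟩ := exists_isCornerPart_zero hP
  have hg := ht.left_bNormal.toIsMorphism
  exact isTransverse_of_isCornerPart hM hN hP
    (isSManC_restrict (isSManC_corners hM) (isOpen_boundary_part hM hP hg 0)) hN hP ht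
    (isCornerPart_boundary_part hM hP hg 0) hJ hK (cornersMap_comp_boundary₀ hP hK0 hK1 hK2)
    (cornersMap_comp_zero hP (ht.right_bNormal.isInterior hP) hJ0 hJ1 hJ2 hK0 hK1 hK2)

theorem isTransverse_boundary₀_right (hM : M.IsSManC) (hN : N.IsSManC) (hP : P.IsSManC)
    (ht : IsTransverse g h) : IsTransverse g (boundary₀Map h) := by
  obtain ⟨I, hI, hI0, hI1, hI2⟩ := exists_isCornerPart_zero hM
  obtain ⟨K, hK, hK0, hK1, hK2⟩ := exists_isCornerPart_zero hP
  have hh := ht.right_bNormal.toIsMorphism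
  exact isTransverse_of_isCornerPart hM hN hP hM
    (isSManC_restrict (isSManC_corners hN) (isOpen_boundary_part hN hP hh 0)) hP ht hI
    (isCornerPart_boundary_part hN hP hh 0) hK
    (cornersMap_comp_zero hP (ht.left_bNormal.isInterior hP) hI0 hI1 hI2 hK0 hK1 hK2)
    (cornersMap_comp_boundary₀ hP hK0 hK1 hK2)

theorem isCornerPart_boundary (hM : M.IsSManC) :
    IsCornerPart (restrictIncl (corners M) {u | M.codim u = 1}) :=
  isCornerPart_restrictIncl hM (hM.isLocallyConstant_codim.isOpen_fiber 1)
    fun _ hu _ huv => (hM.codim_rel huv).symm.trans hu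

theorem isTransverse_boundary₁ (hM : M.IsSManC) (hN : N.IsSManC) (hP : P.IsSManC)
    (ht : IsTransverse g h) : IsTransverse (boundary₁Map g) (boundary₁Map h) := by
  have hg := ht.left_bNormal.toIsMorphism
  have hh := ht.right_bNormal.toIsMorphism
  exact isTransverse_of_isCornerPart hM hN hP
    (isSManC_restrict (isSManC_corners hM) (isOpen_boundary_part hM hP hg 1))
    (isSManC_restrict (isSManC_corners hN) (isOpen_boundary_part hN hP hh 1)) (isSManC_boundary hP)
    ht (isCornerPart_boundary_part hM hP hg 1) (isCornerPart_boundary_part hN hP hh 1)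
    (isCornerPart_boundary hP) rfl rfl

/-- The boundary of a fibre product is the disjoint union of three fibre products of boundaries: in
`codim (u, v) = codim u + codim v - codim (g u)` the last term is at most each of the first two, so
the codimension is `1` only if the three terms are `1, 0, 0`, or `0, 1, 0`, or `1, 1, 1`. -/
theorem exists_isIso_boundary_pullback (hM : M.IsSManC) (hN : N.IsSManC) (hP : P.IsSManC)
    (ht : IsTransverse g h) :
    ∃ Φ : SCMap (boundary (pullback g h))
        (((pullback (boundary₀Map g) h).sum (pullback g (boundary₀Map h))).sum
          (pullback (boundary₁Map g) (boundary₁Map h))), Φ.IsIso ∧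
      ((((boundary₀Incl g).comp (pullbackFst (boundary₀Map g) h)).sumElim
          (pullbackFst g (boundary₀Map h))).sumElim
          ((boundary₁Incl g).comp (pullbackFst (boundary₁Map g) (boundary₁Map h)))).comp Φ =
        (pullbackFst g h).comp (boundaryIncl (pullback g h)) ∧
      (((pullbackSnd (boundary₀Map g) h).sumElim
          ((boundary₀Incl h).comp (pullbackSnd g (boundary₀Map h)))).sumElim
          ((boundary₁Incl h).comp (pullbackSnd (boundary₁Map g) (boundary₁Map h)))).comp Φ =
        (pullbackSnd g h).comp (boundaryIncl (pullback g h)) := by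
  obtain ⟨I, hI, hI0, hI1, hI2⟩ := exists_isCornerPart_zero hM
  obtain ⟨J, hJ, hJ0, hJ1, hJ2⟩ := exists_isCornerPart_zero hN
  obtain ⟨K, hK, hK0, hK1, hK2⟩ := exists_isCornerPart_zero hP
  have hg := ht.left_bNormal
  have hh := ht.right_bNormal
  have hW := isSManC_pullback hM hN hP ht
  have eI := cornersMap_comp_zero hP (hg.isInterior hP) hI0 hI1 hI2 hK0 hK1 hK2
  have eJ := cornersMap_comp_zero hP (hh.isInterior hP) hJ0 hJ1 hJ2 hK0 hK1 hK2
  have eG := cornersMap_comp_boundary₀ (f := g) hP hK0 hK1 hK2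
  have eH := cornersMap_comp_boundary₀ (f := h) hP hK0 hK1 hK2
  have hG₀ : (boundary₀ g).IsSManC :=
    isSManC_restrict (isSManC_corners hM) (isOpen_boundary_part hM hP hg.toIsMorphism 0)
  have hG₁ : (boundary₁ g).IsSManC :=
    isSManC_restrict (isSManC_corners hM) (isOpen_boundary_part hM hP hg.toIsMorphism 1)
  have hH₀ : (boundary₀ h).IsSManC :=
    isSManC_restrict (isSManC_corners hN) (isOpen_boundary_part hN hP hh.toIsMorphism 0)
  have hH₁ : (boundary₁ h).IsSManC :=
    isSManC_restrict (isSManC_corners hN) (isOpen_boundary_part hN hP hh.toIsMorphism 1)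
  have iG₀ := isCornerPart_boundary_part hM hP hg.toIsMorphism 0
  have iG₁ := isCornerPart_boundary_part hM hP hg.toIsMorphism 1
  have iH₀ := isCornerPart_boundary_part hN hP hh.toIsMorphism 0
  have iH₁ := isCornerPart_boundary_part hN hP hh.toIsMorphism 1
  have hA := isSManC_pullback hG₀ hN hP (isTransverse_boundary₀_left hM hN hP ht)
  have hB := isSManC_pullback hM hH₀ hP (isTransverse_boundary₀_right hM hN hP ht)
  have hC := isSManC_pullback hG₁ hH₁ (isSManC_boundary hP) (isTransverse_boundary₁ hM hN hP ht)
  obtain ⟨oA, rA⟩ := isOpenPart_cornersLift hM hN hP hG₀ hN hP ht iG₀ hJ hK eG eJ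
  obtain ⟨oB, rB⟩ := isOpenPart_cornersLift hM hN hP hM hH₀ hP ht hI iH₀ hK eI eH
  obtain ⟨oC, rC⟩ := isOpenPart_cornersLift hM hN hP hG₁ hH₁ (isSManC_boundary hP) ht iG₁ iH₁
    (isCornerPart_boundary hP) (G := boundary₁Map g) (H := boundary₁Map h) rfl rfl
  have rI : ∀ u, u ∈ range I.base ↔ M.codim u = 0 := fun u =>
    ⟨fun ⟨x, hx⟩ => hx ▸ hI0 x, fun hu => ⟨_, hM.eq_of_codim_zero (hI0 (M.proj u)) hu (hI1 _)⟩⟩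
  have rJ : ∀ u, u ∈ range J.base ↔ N.codim u = 0 := fun u =>
    ⟨fun ⟨x, hx⟩ => hx ▸ hJ0 x, fun hu => ⟨_, hN.eq_of_codim_zero (hJ0 (N.proj u)) hu (hJ1 _)⟩⟩
  have rR : ∀ {Q : PreSManC.{u}} (U : Set Q.C) (u : Q.C),
      u ∈ range (restrictIncl (corners Q) U).base ↔ u ∈ U :=
    fun U u => ⟨fun ⟨x, hx⟩ => hx ▸ x.2, fun hu => ⟨⟨u, hu⟩, rfl⟩⟩
  have mA := fun w : (pullback g h).C =>
    (Set.ext_iff.1 rA w).trans (and_congr (rR _ w.1.1) (rJ w.1.2))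
  have mB := fun w : (pullback g h).C =>
    (Set.ext_iff.1 rB w).trans (and_congr (rI w.1.1) (rR _ w.1.2))
  have mC := fun w : (pullback g h).C =>
    (Set.ext_iff.1 rC w).trans (and_congr (rR _ w.1.1) (rR _ w.1.2))
  have dAB : Disjoint _ _ := disjoint_left.2 fun w hwA hwB =>
    one_ne_zero (((mA w).1 hwA).1.1.symm.trans ((mB w).1 hwB).1)
  have oAB := isOpenPart_sumElim (isSManC_corners hW) hA.isSMan.isStratumChart
    hA.corners_isSMan.isStratumChart hB.isSMan.isStratumChart hB.corners_isSMan.isStratumChart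
    oA oB dAB
  have mAB := fun w : (pullback g h).C => Set.ext_iff.1 (Sum.elim_range _ _ : range (SCMap.sumElim
    (cornersLift _ _ (cornersMap_comp_pullback_eq eG eJ))
    (cornersLift _ _ (cornersMap_comp_pullback_eq eI eH))).base = _) w
  have dABC : Disjoint _ _ := disjoint_left.2 fun w hwAB hwC =>
    ((mAB w).1 hwAB).elim
      (fun hwA => one_ne_zero (((mC w).1 hwC).2.1.symm.trans ((mA w).1 hwA).2))
      (fun hwB => one_ne_zero (((mC w).1 hwC).1.1.symm.trans ((mB w).1 hwB).1))
  have oABC := isOpenPart_sumElim (isSManC_corners hW)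
    (isStratumChart_sum hA.isSMan.isStratumChart hB.isSMan.isStratumChart)
    (isStratumChart_sum hA.corners_isSMan.isStratumChart hB.corners_isSMan.isStratumChart)
    hC.isSMan.isStratumChart hC.corners_isSMan.isStratumChart oAB oC dABC
  obtain ⟨Φ, hΦ, hΦ'⟩ := oABC.exists_isIso (isSManC_corners hW)
    (isStratumChart_sum
      (isStratumChart_sum hA.isSMan.isStratumChart hB.isSMan.isStratumChart)
      hC.isSMan.isStratumChart)
    (isStratumChart_sum
      (isStratumChart_sum hA.corners_isSMan.isStratumChart hB.corners_isSMan.isStratumChart)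
      hC.corners_isSMan.isStratumChart)
    (U := {w | (pullback g h).codim w = 1}) (by
      refine (Sum.elim_range _ _).trans (Set.ext fun w => ?_)
      refine (or_congr (mAB w) Iff.rfl).trans ((or_congr (or_congr (mA w) (mB w)) (mC w)).trans ?_)
      have h1 := ht.codim_le w
      have h2 := hM.codim_nonneg w.1.1
      have h3 := hN.codim_nonneg w.1.2
      have h4 := hP.codim_nonneg (g.corner w.1.1)
      have h5 : P.codim (g.corner w.1.1) = P.codim (h.corner w.1.2) := congrArg P.codim w.2
      have h6 := codim_pullback w
      change ((M.codim w.1.1 = 1 ∧ P.codim (g.corner w.1.1) = 0) ∧ N.codim w.1.2 = 0 ∨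
        M.codim w.1.1 = 0 ∧ N.codim w.1.2 = 1 ∧ P.codim (h.corner w.1.2) = 0) ∨
        (M.codim w.1.1 = 1 ∧ P.codim (g.corner w.1.1) = 1) ∧
          N.codim w.1.2 = 1 ∧ P.codim (h.corner w.1.2) = 1 ↔ (pullback g h).codim w = 1
      omega)
  have zI : (cornersProj M).comp I = SCMap.id M := SCMap.ext (funext hI1) (funext hI2)
  have zJ : (cornersProj N).comp J = SCMap.id N := SCMap.ext (funext hJ1) (funext hJ2)
  refine ⟨Φ, hΦ, ?_, ?_⟩
  · have e : (pullbackFst g h).comp (boundaryIncl (pullback g h)) =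
        ((pullbackFst g h).comp (cornersProj (pullback g h))).comp
          (restrictIncl (corners (pullback g h)) _) := rfl
    rw [e, ← hΦ']
    change _ = (((pullbackFst g h).comp (cornersProj (pullback g h))).comp (SCMap.sumElim _ _)).comp Φ
    rw [comp_sumElim, comp_sumElim]
    have eB : pullbackFst g (boundary₀Map h) =
        ((cornersProj M).comp I).comp (pullbackFst g (boundary₀Map h)) := by
      rw [zI]
      rfl
    exact congrArg (SCMap.comp · Φ) (congrArg₂ SCMap.sumElim (congrArg₂ SCMap.sumElim rfl eB) rfl)
  · have e : (pullbackSnd g h).comp (boundaryIncl (pullback g h)) =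
        ((pullbackSnd g h).comp (cornersProj (pullback g h))).comp
          (restrictIncl (corners (pullback g h)) _) := rfl
    rw [e, ← hΦ']
    change _ = (((pullbackSnd g h).comp (cornersProj (pullback g h))).comp (SCMap.sumElim _ _)).comp Φ
    rw [comp_sumElim, comp_sumElim]
    have eA : pullbackSnd (boundary₀Map g) h =
        ((cornersProj N).comp J).comp (pullbackSnd (boundary₀Map g) h) := by
      rw [zJ]
      rfl
    exact congrArg (SCMap.comp · Φ) (congrArg₂ SCMap.sumElim (congrArg₂ SCMap.sumElim eA rfl) rfl)

end BoundaryPullback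

end SCorners

theorem theorem4p21 (X Y Z : SCorners.PreSManC.{u}) (l m n : ℕ)
    (hX : X.IsSManC) (hl : X.HasDim l) (hY : Y.IsSManC) (hm : Y.HasDim m)
    (hZ : Z.IsSManC) (hn : Z.HasDim n)
    (g : SCorners.SCMap X Z) (h : SCorners.SCMap Y Z) (hgh : SCorners.IsTransverse g h) :
    -- the fibre product is an s-manifold with corners of dimension `d = l + m - n`
    (SCorners.pullback g h).IsSManC ∧
    (SCorners.pullback g h).HasDim ((l : ℤ) + m - n) ∧
    (Nonempty (SCorners.pullback g h).X → 0 ≤ (l : ℤ) + m - n) ∧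
    -- the projections are b-normal, and interior, morphisms
    (SCorners.pullbackFst g h).IsBNormal ∧ (SCorners.pullbackFst g h).IsInterior ∧
    (SCorners.pullbackSnd g h).IsBNormal ∧ (SCorners.pullbackSnd g h).IsInterior ∧
    g.comp (SCorners.pullbackFst g h) = h.comp (SCorners.pullbackSnd g h) ∧
    -- the square is Cartesian
    SCorners.IsCartesianSManC (SCorners.pullbackFst g h) (SCorners.pullbackSnd g h) g h ∧
    SCorners.IsCartesianSManCIn (SCorners.pullbackFst g h) (SCorners.pullbackSnd g h) g h ∧
    -- the square of corners is Cartesian, with transverse legs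
    SCorners.IsTransverse (SCorners.cornersMap g) (SCorners.cornersMap h) ∧
    SCorners.IsCartesianMixed (SCorners.cornersMap (SCorners.pullbackFst g h))
      (SCorners.cornersMap (SCorners.pullbackSnd g h))
      (SCorners.cornersMap g) (SCorners.cornersMap h) ∧
    SCorners.IsCartesianMixedIn (SCorners.cornersMap (SCorners.pullbackFst g h))
      (SCorners.cornersMap (SCorners.pullbackSnd g h))
      (SCorners.cornersMap g) (SCorners.cornersMap h) ∧
    -- the boundary of `W`, and the three boundary pieces with their fibre products
    ((SCorners.boundary (SCorners.pullback g h)).IsSManC ∧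
      (SCorners.boundary (SCorners.pullback g h)).HasDim ((l : ℤ) + m - n - 1)) ∧
    ((SCorners.boundary₀ g).IsSManC ∧ (SCorners.boundary₀ g).HasDim ((l : ℤ) - 1)) ∧
    ((SCorners.boundary₁ g).IsSManC ∧ (SCorners.boundary₁ g).HasDim ((l : ℤ) - 1)) ∧
    ((SCorners.boundary₀ h).IsSManC ∧ (SCorners.boundary₀ h).HasDim ((m : ℤ) - 1)) ∧
    ((SCorners.boundary₁ h).IsSManC ∧ (SCorners.boundary₁ h).HasDim ((m : ℤ) - 1)) ∧
    ((SCorners.boundary Z).IsSManC ∧ (SCorners.boundary Z).HasDim ((n : ℤ) - 1)) ∧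
    SCorners.IsTransverse (SCorners.boundary₀Map g) h ∧
    SCorners.IsTransverse g (SCorners.boundary₀Map h) ∧
    SCorners.IsTransverse (SCorners.boundary₁Map g) (SCorners.boundary₁Map h) ∧
    -- the canonical isomorphism: it is the one compatible with the natural morphisms to `X` and `Y`
    ∃ Φ : SCorners.SCMap (SCorners.boundary (SCorners.pullback g h))
        (((SCorners.pullback (SCorners.boundary₀Map g) h).sum
          (SCorners.pullback g (SCorners.boundary₀Map h))).sum
          (SCorners.pullback (SCorners.boundary₁Map g) (SCorners.boundary₁Map h))),
      Φ.IsIso ∧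
      ((((SCorners.boundary₀Incl g).comp
            (SCorners.pullbackFst (SCorners.boundary₀Map g) h)).sumElim
          (SCorners.pullbackFst g (SCorners.boundary₀Map h))).sumElim
          ((SCorners.boundary₁Incl g).comp
            (SCorners.pullbackFst (SCorners.boundary₁Map g) (SCorners.boundary₁Map h)))).comp Φ =
        (SCorners.pullbackFst g h).comp (SCorners.boundaryIncl (SCorners.pullback g h)) ∧
      (((SCorners.pullbackSnd (SCorners.boundary₀Map g) h).sumElim
          ((SCorners.boundary₀Incl h).comp
            (SCorners.pullbackSnd g (SCorners.boundary₀Map h)))).sumElim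
          ((SCorners.boundary₁Incl h).comp
            (SCorners.pullbackSnd (SCorners.boundary₁Map g) (SCorners.boundary₁Map h)))).comp Φ =
        (SCorners.pullbackSnd g h).comp (SCorners.boundaryIncl (SCorners.pullback g h)) := by
  have hW := SCorners.isSManC_pullback hX hY hZ hgh
  have hd : (SCorners.pullback g h).HasDim ((l : ℤ) + m - n) := fun w => by
    change X.X.dim w.1.1 + Y.X.dim w.1.2 - Z.X.dim (g.base w.1.1) = _
    rw [hl, hm, hn]
  have he := SCorners.isBNormal_pullbackFst hX hY hZ hgh
  have hf := SCorners.isBNormal_pullbackSnd hX hY hZ hgh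
  have hg := hgh.left_bNormal.toIsMorphism
  have hh := hgh.right_bNormal.toIsMorphism
  have oW : (SCorners.pullback g h).IsSManC ∧ ∃ k : ℤ, (SCorners.pullback g h).HasDim k :=
    ⟨hW, _, hd⟩
  have oX : X.IsSManC ∧ ∃ k : ℤ, X.HasDim k := ⟨hX, _, hl⟩
  have oY : Y.IsSManC ∧ ∃ k : ℤ, Y.HasDim k := ⟨hY, _, hm⟩
  have oZ : Z.IsSManC ∧ ∃ k : ℤ, Z.HasDim k := ⟨hZ, _, hn⟩
  refine ⟨hW, hd, fun ⟨w⟩ => ?_, he, he.isInterior hX, hf, hf.isInterior hY,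
    SCorners.pullback_comm g h,
    SCorners.isCartesian_pullback hX hY hZ hgh (fun _ h => h.1) oW oX oY oZ,
    SCorners.isCartesian_pullback_interior hX hY hZ hgh (fun _ h => h.1) oW oX oY oZ,
    SCorners.isTransverse_cornersMap hX hY hZ hgh, SCorners.isCartesianMixed_corners hX hY hZ hgh,
    SCorners.isCartesianMixedIn_corners hX hY hZ hgh,
    ⟨SCorners.isSManC_boundary hW, SCorners.hasDim_restrict_corners hd fun _ h => h⟩,
    ⟨?_, SCorners.hasDim_restrict_corners hl fun _ h => h.1⟩,
    ⟨?_, SCorners.hasDim_restrict_corners hl fun _ h => h.1⟩,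
    ⟨?_, SCorners.hasDim_restrict_corners hm fun _ h => h.1⟩,
    ⟨?_, SCorners.hasDim_restrict_corners hm fun _ h => h.1⟩,
    ⟨SCorners.isSManC_boundary hZ, SCorners.hasDim_restrict_corners hn fun _ h => h⟩,
    SCorners.isTransverse_boundary₀_left hX hY hZ hgh,
    SCorners.isTransverse_boundary₀_right hX hY hZ hgh,
    SCorners.isTransverse_boundary₁ hX hY hZ hgh,
    SCorners.exists_isIso_boundary_pullback hX hY hZ hgh⟩
  · -- strata have dimension at least `0`, and at most that of the space
    rw [← hd w]
    exact (Int.natCast_nonneg _).trans (hW.isSMan.sdim_le w)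
  · exact SCorners.isSManC_restrict (SCorners.isSManC_corners hX)
      (SCorners.isOpen_boundary_part hX hZ hg 0)
  · exact SCorners.isSManC_restrict (SCorners.isSManC_corners hX)
      (SCorners.isOpen_boundary_part hX hZ hg 1)
  · exact SCorners.isSManC_restrict (SCorners.isSManC_corners hY)
      (SCorners.isOpen_boundary_part hY hZ hh 0)
  · exact SCorners.isSManC_restrict (SCorners.isSManC_corners hY)
      (SCorners.isOpen_boundary_part hY hZ hh 1)
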